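/- **Theorem.** Let $P(x)\in\mathbb{R}[x]$ be a polynomial with $P(0)=1$, $P(1)>0$ and no zeros in the interval $[0,1]$. Let $$H(q)=\prod_{n\ge 1}P(q^n)=\sum_{n\ge 0}c(n)q^n ,$$ the product and the series being understood as formal power series in $q$, and suppose that for all sufficiently large $n$ one has $c(n)\ge 0$ and $c(n)\le c(n+1)$. Then the integral $$\mathcal{C}_P:=\int_0^\infty \log\left(P(e^{-x})\right)dx$$ converges absolutely, $\mathcal{C}_P>0$ unless $P$ is the constant polynomial $1$, and as $n\to\infty$ $$c(n)\sim\frac{\mathcal{C}_P^{1/4}}{2\sqrt{\pi P(1)}\,n^{3/4}}\,e^{2\sqrt{\mathcal{C}_P\,n}} .$$ Here $f(n)\sim g(n)$ means $f(n)-g(n)=o(g(n))$; in the trivial case $P=1$ both sides are $0$ for all $n\ge 1$. -/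

import Mathlib

open Filter Topology Asymptotics MeasureTheory
open scoped PowerSeries.WithPiTopology

noncomputable section

/-- The formal power series `H(q) = ∏_{n ≥ 1} P(q^n)`, the infinite product being taken in `ℝ⟦q⟧`
with the topology of coefficientwise convergence. -/
def eulerProduct (P : Polynomial ℝ) : PowerSeries ℝ :=
  ∏' n : ℕ, Polynomial.aeval ((PowerSeries.X : PowerSeries ℝ) ^ (n + 1)) P

/-- The coefficient `c(n)` of `q^n` in `∏_{n ≥ 1} P(q^n)`. -/
def eulerCoeff (P : Polynomial ℝ) (n : ℕ) : ℝ :=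
  PowerSeries.coeff n (eulerProduct P)

/-- The constant `C_P = ∫_0^∞ log P(e^{-x}) dx`. -/
def logIntegral (P : Polynomial ℝ) : ℝ :=
  ∫ x in Set.Ioi (0 : ℝ), Real.log (P.eval (Real.exp (-x)))

/-- If `P(0) = 1`, the infinite product defining `eulerProduct P` converges. -/
theorem multipliable_eulerProduct (P : Polynomial ℝ) (h0 : P.eval 0 = 1) :
    Multipliable fun n : ℕ =>
      Polynomial.aeval ((PowerSeries.X : PowerSeries ℝ) ^ (n + 1)) P := by
  obtain ⟨Q, hQ⟩ : (Polynomial.X : Polynomial ℝ) ∣ P - 1 := by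
    rw [Polynomial.X_dvd_iff, Polynomial.coeff_zero_eq_eval_zero]
    simp [h0]
  have hP : P = 1 + Polynomial.X * Q := by rw [← hQ]; ring
  have key : Multipliable fun n : ℕ =>
      (1 + (PowerSeries.X : PowerSeries ℝ) ^ (n + 1) *
        Polynomial.aeval ((PowerSeries.X : PowerSeries ℝ) ^ (n + 1)) Q) := by
    apply PowerSeries.WithPiTopology.multipliable_one_add_of_tendsto_order_atTop_nhds_top
    rw [ENat.tendsto_nhds_top_iff_natCast_lt]
    intro m
    filter_upwards [eventually_ge_atTop m] with n hn
    refine lt_of_lt_of_le (b := ((n + 1 : ℕ) : ℕ∞)) (by exact_mod_cast Nat.lt_succ_of_le hn) ?_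
    refine PowerSeries.nat_le_order _ _ fun i hi => ?_
    exact PowerSeries.X_pow_dvd_iff.mp (Dvd.intro _ rfl) i hi
  rw [hP]
  simpa using key

end

/-! Write q = e^{-x(1+it)} with x → 0+. The logarithm of H(q) = ∏ P(q^n) is x⁻¹ times a Riemann sum
along the ray r(1+it), r > 0. Where P(e^{-r(1+it)}) has no zero, first-order Euler–Maclaurin
summation gives log|H(q)| = V(t)/x − ½ log P(1) + O(x), with V(t) = ∫_0^∞ log|P(e^{-r(1+it)})| dr
(`exists_norm_eulerFun_eq`). For small |t| this holds for H itself, uniformly in t, with main term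
C_P/(x(1+it)) (`exists_eulerFun_eq_near`).

The coefficient asymptotics need V(t) < C_P for every t ≠ 0, and this is where monotonicity enters.
If A has increasing coefficients and A(0) = 0, then |1−q||A(q)| ≤ (1−|q|)A(|q|), so on the ray A
gains a factor 1/|1+it| + o(1) over its value at |q|. The factor P(1)^{-1/2} in the asymptotics is
the same on all zero-free rays, so V(t) ≥ C_P would contradict 1/|1+it| < 1: a gain of a mere
constant becomes an exponential gap (`integral_log_rayVal_lt_logIntegral`).

On rays through zeros of P that expansion is not available. Factoring P and integrating logarithmic
series shows that (1+t²)V(t) has nonnegative second differences at small scales, with a convex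
corner at each ray through a zero. Neighbouring rays are zero-free, and a corner value V(t) ≥ C_P
would push one of them above C_P as well (`rayEll_second_difference`, `integral_log_rayVal_lt`).
Upper semicontinuity and compactness make the gap uniform for t in compact sets avoiding 0
(`exists_forall_norm_eulerFun_le`).

No estimate is needed as |t| → ∞. The normalised step function of the coefficients around n = C_P/x²
has a Fourier transform tending weakly to 2πδ₀ on compact sets, and monotonicity turns this into a
pointwise limit by a Wiener–Ingham argument with the Fejér kernel (`tendsto_one_of_fourier_tendsto`,
`tendsto_of_powFun_asymptotics`). The theorem follows on taking x = √(C_P/n).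

Positivity of C_P: if C_P ≤ 0 then H(e^{-x}) stays bounded as x → 0, which forces eventually
increasing nonnegative coefficients to vanish eventually. Then H is a polynomial, and comparing
logarithmic derivatives gives P = 1 (`eq_one_of_eventually_eulerCoeff_eq_zero`). -/

noncomputable section

/-! ### Finite products, coefficient bounds and the generating function in the unit disc -/

section PartialProducts

/-- The partial product `∏_{i < N} P(X^{i+1})` as a polynomial. -/
def eulerPartial {R : Type*} [CommSemiring R] (P : Polynomial R) (N : ℕ) : Polynomial R :=
  ∏ i ∈ Finset.range N, Polynomial.expand R (i + 1) P

theorem eulerPartial_eval {R : Type*} [CommSemiring R] (P : Polynomial R) (N : ℕ) (q : R) :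
    (eulerPartial P N).eval q = ∏ i ∈ Finset.range N, P.eval (q ^ (i + 1)) := by
  simp [eulerPartial, Polynomial.eval_prod, Polynomial.expand_eval]

theorem coe_eulerPartial (P : Polynomial ℝ) (N : ℕ) :
    ((eulerPartial P N : Polynomial ℝ) : PowerSeries ℝ) =
      ∏ i ∈ Finset.range N, Polynomial.aeval ((PowerSeries.X : PowerSeries ℝ) ^ (i + 1)) P := by
  have h : ∀ Q : Polynomial ℝ, (Q : PowerSeries ℝ) =
      Polynomial.aeval (PowerSeries.X : PowerSeries ℝ) Q := by
    intro Q
    induction Q using Polynomial.induction_on' with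
    | add p q hp hq => simp [hp, hq]
    | monomial n a =>
      rw [Polynomial.aeval_monomial, Polynomial.coe_monomial, PowerSeries.monomial_eq_mk]
      ext m
      simp [PowerSeries.coeff_X_pow]
  rw [h, eulerPartial, map_prod]
  refine Finset.prod_congr rfl fun i _ => ?_
  rw [Polynomial.expand_aeval]

/-- Because P(0) = 1, the factor P(X^{N+1}) is 1 modulo X^{N+1} and leaves all coefficients of index
at most N unchanged. -/
theorem eulerPartial_coeff_of_le {P : Polynomial ℝ} (h0 : P.eval 0 = 1) {n N : ℕ} (h : n ≤ N) :
    (eulerPartial P N).coeff n = (eulerPartial P n).coeff n := by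
  induction N, h using Nat.le_induction with
  | base => rfl
  | succ N hN ih =>
    rw [← ih, eulerPartial, Finset.prod_range_succ, ← eulerPartial]
    obtain ⟨Q, hQ⟩ : (Polynomial.X : Polynomial ℝ) ∣ P - 1 := by
      rw [Polynomial.X_dvd_iff, Polynomial.coeff_zero_eq_eval_zero]
      simp [h0]
    have hP : P = 1 + Polynomial.X * Q := by rw [← hQ]; ring
    have : eulerPartial P N * Polynomial.expand ℝ (N + 1) P = eulerPartial P N +
        eulerPartial P N * Polynomial.expand ℝ (N + 1) Q * Polynomial.X ^ (N + 1) := by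
      conv_lhs => rw [hP]
      simp only [map_add, map_one, map_mul, Polynomial.expand_X]
      rw [← hP]; ring
    rw [this, Polynomial.coeff_add, Polynomial.coeff_mul_X_pow', if_neg (by omega), add_zero]

/-- The infinite product converges coefficientwise and each coefficient stabilises, so analytic
questions about H reduce to finite products. -/
theorem eulerCoeff_eq {P : Polynomial ℝ} (h0 : P.eval 0 = 1) {n N : ℕ} (h : n ≤ N) :
    eulerCoeff P n = (eulerPartial P N).coeff n := by
  have h1 := (multipliable_eulerProduct P h0).hasProd.tendsto_prod_nat
  have h2 := (PowerSeries.WithPiTopology.tendsto_iff_coeff_tendsto ℝ _ _ _).1 h1 n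
  refine tendsto_nhds_unique h2 ?_
  refine tendsto_const_nhds.congr' ?_
  filter_upwards [eventually_ge_atTop n] with M hM
  rw [← coe_eulerPartial, Polynomial.coeff_coe, eulerPartial_coeff_of_le h0 hM,
    eulerPartial_coeff_of_le h0 h]

/-- The polynomial whose coefficients are the absolute values of those of `P`. -/
def absPoly (P : Polynomial ℝ) : Polynomial ℝ :=
  P.sum fun n a => Polynomial.monomial n |a|

theorem absPoly_coeff (P : Polynomial ℝ) (n : ℕ) : (absPoly P).coeff n = |P.coeff n| := by
  rw [absPoly, Polynomial.sum_def, Polynomial.finsetSum_coeff]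
  simp only [Polynomial.coeff_monomial]
  rw [Finset.sum_ite_eq']
  split_ifs with h
  · rfl
  · rw [Polynomial.notMem_support_iff.1 h, abs_zero]

theorem abs_eulerPartial_coeff_le (P : Polynomial ℝ) (N n : ℕ) :
    |(eulerPartial P N).coeff n| ≤ (eulerPartial (absPoly P) N).coeff n := by
  induction N generalizing n with
  | zero =>
    simp only [eulerPartial, Finset.range_zero, Finset.prod_empty, Polynomial.coeff_one]
    split_ifs <;> simp
  | succ N ih =>
    rw [eulerPartial, eulerPartial, Finset.prod_range_succ, Finset.prod_range_succ,
      ← eulerPartial, ← eulerPartial, Polynomial.coeff_mul, Polynomial.coeff_mul]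
    refine (Finset.abs_sum_le_sum_abs _ _).trans (Finset.sum_le_sum fun p _ => ?_)
    rw [abs_mul]
    refine mul_le_mul (ih _) ?_ (abs_nonneg _) ((abs_nonneg _).trans (ih _))
    rw [Polynomial.coeff_expand (by omega), Polynomial.coeff_expand (by omega)]
    split_ifs
    · rw [absPoly_coeff]
    · simp

theorem absPoly_eval_le {P : Polynomial ℝ} (h0 : P.eval 0 = 1) :
    ∃ A : ℝ, 0 ≤ A ∧ ∀ r : ℝ, 0 ≤ r → r ≤ 1 → (absPoly P).eval r ≤ 1 + A * r := by
  obtain ⟨Q, hQ⟩ : (Polynomial.X : Polynomial ℝ) ∣ absPoly P - 1 := by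
    rw [Polynomial.X_dvd_iff, Polynomial.coeff_sub, absPoly_coeff,
      Polynomial.coeff_zero_eq_eval_zero, h0]
    simp
  have hP : absPoly P = 1 + Polynomial.X * Q := by rw [← hQ]; ring
  obtain ⟨B, hB⟩ := (isCompact_Icc (a := (0 : ℝ)) (b := 1)).exists_bound_of_continuousOn
    Q.continuous.continuousOn
  refine ⟨max B 0, le_max_right _ _, fun r h0 h1 => ?_⟩
  rw [hP]
  simp only [Polynomial.eval_add, Polynomial.eval_one, Polynomial.eval_mul, Polynomial.eval_X]
  have := (le_abs_self _).trans ((hB r ⟨h0, h1⟩).trans (le_max_left B 0))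
  nlinarith

/-- Cauchy-type bound for the coefficients of the partial products. -/
theorem exists_bound_eulerPartial {P : Polynomial ℝ} (h0 : P.eval 0 = 1) {r : ℝ} (hr0 : 0 ≤ r)
    (hr : r < 1) : ∃ B : ℝ, 0 ≤ B ∧ ∀ N n : ℕ, |(eulerPartial P N).coeff n| * r ^ n ≤ B := by
  obtain ⟨A, hA, hAr⟩ := absPoly_eval_le h0
  have habs : ∀ x : ℝ, 0 ≤ x → 0 ≤ (absPoly P).eval x := by
    intro x hx
    rw [Polynomial.eval_eq_sum]
    refine Finset.sum_nonneg fun i _ => ?_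
    simp only [absPoly_coeff]
    positivity
  -- With nonnegative coefficients every term of the majorant is at most its value at r, and that
  -- value is at most ∏ (1 + A r^i) ≤ exp(A ∑ r^i), uniformly in N.
  refine ⟨Real.exp (A * (r * (1 - r)⁻¹)), (Real.exp_pos _).le, fun N n => ?_⟩
  have hnn : ∀ k, 0 ≤ (eulerPartial (absPoly P) N).coeff k := fun k =>
    (abs_nonneg _).trans (abs_eulerPartial_coeff_le P N k)
  calc |(eulerPartial P N).coeff n| * r ^ n
      ≤ (eulerPartial (absPoly P) N).coeff n * r ^ n :=
        mul_le_mul_of_nonneg_right (abs_eulerPartial_coeff_le P N n) (by positivity)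
    _ ≤ (eulerPartial (absPoly P) N).eval r := by
        by_cases hn : n ∈ (eulerPartial (absPoly P) N).support
        · rw [Polynomial.eval_eq_sum]
          exact Finset.single_le_sum (f := fun e => (eulerPartial (absPoly P) N).coeff e * r ^ e)
            (fun i _ => mul_nonneg (hnn i) (by positivity)) hn
        · rw [Polynomial.notMem_support_iff.1 hn, zero_mul, eulerPartial_eval]
          exact Finset.prod_nonneg fun i _ => habs _ (by positivity)
    _ = ∏ i ∈ Finset.range N, (absPoly P).eval (r ^ (i + 1)) := eulerPartial_eval _ _ _
    _ ≤ ∏ i ∈ Finset.range N, Real.exp (A * r ^ (i + 1)) := by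
        refine Finset.prod_le_prod (fun i _ => habs _ (by positivity)) fun i _ => ?_
        refine (hAr _ (by positivity) (pow_le_one₀ hr0 hr.le)).trans ?_
        linarith [Real.add_one_le_exp (A * r ^ (i + 1))]
    _ = Real.exp (A * ∑ i ∈ Finset.range N, r ^ (i + 1)) := by
        rw [← Real.exp_sum, Finset.mul_sum]
    _ ≤ Real.exp (A * (r * (1 - r)⁻¹)) := by
        apply Real.exp_le_exp.2
        refine mul_le_mul_of_nonneg_left ?_ hA
        have : ∑ i ∈ Finset.range N, r ^ (i + 1) = r * ∑ i ∈ Finset.range N, r ^ i := by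
          rw [Finset.mul_sum]; exact Finset.sum_congr rfl fun i _ => by ring
        rw [this, ← tsum_geometric_of_lt_one hr0 hr]
        exact mul_le_mul_of_nonneg_left
          ((summable_geometric_of_lt_one hr0 hr).sum_le_tsum _ fun i _ => by positivity) hr0

/-- The generating function `∑ c(n) q^n`. -/
def eulerFun (P : Polynomial ℝ) (q : ℂ) : ℂ := ∑' n : ℕ, (eulerCoeff P n : ℂ) * q ^ n

theorem summable_eulerCoeff {P : Polynomial ℝ} (h0 : P.eval 0 = 1) {r : ℝ} (hr0 : 0 ≤ r)
    (hr : r < 1) : Summable fun n : ℕ => |eulerCoeff P n| * r ^ n := by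
  -- Any radius strictly between r and 1 serves: the quotient of the two radii yields a geometric
  -- majorant.
  obtain ⟨B, hB, hb⟩ := exists_bound_eulerPartial h0 (r := (1 + r) / 2) (by linarith)
    (by linarith)
  have hs : Summable fun n : ℕ => B * (r / ((1 + r) / 2)) ^ n :=
    (summable_geometric_of_lt_one (by positivity)
      (by rw [div_lt_one (by linarith)]; linarith)).mul_left B
  refine Summable.of_nonneg_of_le (fun n => by positivity) (fun n => ?_) hs
  rw [eulerCoeff_eq h0 le_rfl, div_pow, mul_div_assoc', le_div_iff₀ (by positivity)]
  have := mul_le_mul_of_nonneg_right (hb n n) (pow_nonneg hr0 n)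
  linarith

/-- Links the formal product to the analytic one: the coefficients of the partial products stabilise
under a geometric majorant independent of N, so dominated convergence applies to their power series.
-/
theorem tendsto_prod_eulerFun {P : Polynomial ℝ} (h0 : P.eval 0 = 1) {q : ℂ} (hq : ‖q‖ < 1) :
    Tendsto (fun N : ℕ => ∏ i ∈ Finset.range N,
      (P.map (algebraMap ℝ ℂ)).eval (q ^ (i + 1))) atTop (𝓝 (eulerFun P q)) := by
  obtain ⟨B, hB, hb⟩ := exists_bound_eulerPartial h0 (r := (1 + ‖q‖) / 2)
    (by positivity) (by linarith)
  have hs : Summable fun n : ℕ => B * (‖q‖ / ((1 + ‖q‖) / 2)) ^ n :=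
    (summable_geometric_of_lt_one (by positivity)
      (by rw [div_lt_one (by positivity)]; linarith)).mul_left B
  have hlim : Tendsto (fun N : ℕ => ∑' n : ℕ, ((eulerPartial P N).coeff n : ℂ) * q ^ n) atTop
      (𝓝 (eulerFun P q)) := by
    refine tendsto_tsum_of_dominated_convergence hs (fun n => ?_)
      (Eventually.of_forall fun N n => ?_)
    · refine tendsto_const_nhds.congr' ?_
      filter_upwards [eventually_ge_atTop n] with N hN
      rw [eulerCoeff_eq h0 hN]
    · rw [norm_mul, norm_pow, Complex.norm_real, Real.norm_eq_abs, div_pow, mul_div_assoc',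
        le_div_iff₀ (by positivity)]
      have := mul_le_mul_of_nonneg_right (hb N n) (pow_nonneg (norm_nonneg q) n)
      linarith
  refine hlim.congr fun N => ?_
  have h1 : ∏ i ∈ Finset.range N, (P.map (algebraMap ℝ ℂ)).eval (q ^ (i + 1)) =
      ((eulerPartial P N).map (algebraMap ℝ ℂ)).eval q := by
    rw [eulerPartial, Polynomial.map_prod, Polynomial.eval_prod]
    refine Finset.prod_congr rfl fun i _ => ?_
    rw [Polynomial.map_expand, Polynomial.expand_eval]
  rw [h1, Polynomial.eval_map, Polynomial.eval₂_eq_sum, Polynomial.sum_def,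
    tsum_eq_sum (s := (eulerPartial P N).support)]
  · rfl
  · intro n hn
    rw [Polynomial.notMem_support_iff.1 hn]; simp

end PartialProducts

/-! ### First-order Euler–Maclaurin summation -/

section EulerMaclaurin

theorem summable_of_norm_le_exp {E : Type*} [NormedAddCommGroup E] [CompleteSpace E]
    {G : ℝ → E} {M x : ℝ} (hx : 0 < x)
    (hM : ∀ r, 0 ≤ r → ‖G r‖ ≤ M * Real.exp (-r)) :
    Summable fun n : ℕ => G ((n + 1 : ℕ) * x) := by
  have h1 : Summable fun n : ℕ => M * Real.exp (-(((n + 1 : ℕ) : ℝ) * x)) := by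
    apply Summable.mul_left
    have h2 : Summable fun n : ℕ => Real.exp (-x) ^ n :=
      summable_geometric_of_lt_one (Real.exp_pos _).le (by simpa using hx)
    refine ((summable_nat_add_iff 1).2 h2).congr fun n => ?_
    rw [← Real.exp_nat_mul]
    congr 1; ring
  exact Summable.of_norm_bounded h1 fun n => hM _ (by positivity)

variable {E : Type*} [NormedAddCommGroup E] [NormedSpace ℝ E] [CompleteSpace E]

/-- The error of the trapezoidal rule on one interval. -/
theorem norm_trapezoid_sub_integral_le {G G1 G2 : ℝ → E} {a x K : ℝ} (hx : 0 ≤ x)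
    (hG : ∀ r ∈ Set.Icc a (a + x), HasDerivAt G (G1 r) r)
    (hG1 : ∀ r ∈ Set.Icc a (a + x), HasDerivAt G1 (G2 r) r)
    (hK : ∀ r ∈ Set.Icc a (a + x), ‖G2 r‖ ≤ K) :
    ‖(x / 2) • (G a + G (a + x)) - ∫ r in a..(a + x), G r‖ ≤ K * x ^ 3 / 2 := by
  have hK0 : 0 ≤ K := (norm_nonneg _).trans (hK a ⟨le_rfl, by linarith⟩)
  have hcont : ContinuousOn G (Set.Icc a (a + x)) := fun r hr =>
    (hG r hr).continuousAt.continuousWithinAt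
  -- First-order Taylor formula at b by the mean value inequality, applied twice: y ↦ G y − y·G1 b
  -- has derivative G1 y − G1 b, which is at most Kx in norm.
  have htaylor : ∀ b ∈ Set.Icc a (a + x), ‖G a - G b + (b - a) • G1 b‖ ≤ K * x ^ 2 := by
    intro b hb
    have hsub : Set.Icc a b ⊆ Set.Icc a (a + x) := Set.Icc_subset_Icc_right hb.2
    have h1 : ∀ y ∈ Set.Icc a b, ‖G1 y - G1 b‖ ≤ K * x := by
      intro y hy
      have := (convex_Icc a b).norm_image_sub_le_of_norm_hasDerivWithin_le (f := G1) (f' := G2)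
        (C := K) (fun z hz => (hG1 z (hsub hz)).hasDerivWithinAt) (fun z hz => hK z (hsub hz))
        (x := b) (y := y) ⟨hb.1, le_rfl⟩ hy
      refine this.trans (mul_le_mul_of_nonneg_left ?_ hK0)
      rw [Real.norm_eq_abs, abs_le]
      constructor <;> linarith [hy.1, hy.2, hb.2, hb.1]
    have h2 := (convex_Icc a b).norm_image_sub_le_of_norm_hasDerivWithin_le
      (f := fun y => G y - y • G1 b) (f' := fun y => G1 y - G1 b)
      (C := K * x) (fun z hz => by
        have := ((hG z (hsub hz)).sub ((hasDerivAt_id' z).smul_const (G1 b))).hasDerivWithinAt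
          (s := Set.Icc a b)
        rw [one_smul] at this
        exact this) h1
      (x := b) (y := a) ⟨hb.1, le_rfl⟩ ⟨le_rfl, hb.1⟩
    have h3 : G a - G b + (b - a) • G1 b = G a - a • G1 b - (G b - b • G1 b) := by
      rw [sub_smul]; abel
    rw [h3]
    refine h2.trans ?_
    rw [pow_two, ← mul_assoc]
    refine mul_le_mul_of_nonneg_left ?_ (by positivity)
    rw [Real.norm_eq_abs, abs_le]
    constructor <;> linarith [hb.1, hb.2]
  -- The trapezoidal error is regarded as a function of the right endpoint b; it vanishes at b = a
  -- and its derivative is half the Taylor remainder. The constant 1/2 is not sharp, but any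
  -- constant will do.
  have hderiv : ∀ b ∈ Set.Icc a (a + x), HasDerivWithinAt
      (fun b => ((b - a) / 2) • (G a + G b) - ∫ r in a..b, G r)
      ((1 / 2 : ℝ) • (G a - G b + (b - a) • G1 b)) (Set.Icc a (a + x)) b := by
    intro b hb
    have hi : IntervalIntegrable G volume a b := by
      apply ContinuousOn.intervalIntegrable
      rw [Set.uIcc_of_le hb.1]
      exact hcont.mono (Set.Icc_subset_Icc_right hb.2)
    have h1 : HasDerivWithinAt (fun b => ∫ r in a..b, G r) (G b) (Set.Icc a (a + x)) b := by
      have : Fact (b ∈ Set.Icc a (a + x)) := ⟨hb⟩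
      exact intervalIntegral.integral_hasDerivWithinAt_right hi
        (hcont.stronglyMeasurableAtFilter_nhdsWithin measurableSet_Icc b)
        (hcont b hb)
    have h2 : HasDerivAt (fun b => (b - a) / 2) (1 / 2 : ℝ) b := by
      simpa using ((hasDerivAt_id b).sub_const a).div_const 2
    have h3 := (h2.smul ((hG b hb).const_add (G a))).hasDerivWithinAt
      (s := Set.Icc a (a + x))
    refine (h3.sub h1).congr_deriv ?_
    module
  have h4 := (convex_Icc a (a + x)).norm_image_sub_le_of_norm_hasDerivWithin_le
    (C := K * x ^ 2 / 2) hderiv (fun b hb => by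
      rw [norm_smul]
      have := htaylor b hb
      norm_num
      linarith)
    (x := a) (y := a + x) ⟨le_rfl, by linarith⟩ ⟨by linarith, le_rfl⟩
  simp only [add_sub_cancel_left, sub_self, zero_div, zero_smul,
    intervalIntegral.integral_same, sub_zero, Real.norm_eq_abs, abs_of_nonneg hx] at h4
  refine h4.trans (le_of_eq ?_)
  ring

/-- Euler–Maclaurin summation to first order for functions with exponential decay. -/
theorem norm_tsum_sub_integral_le {G G1 G2 : ℝ → E} {M x : ℝ} (hx : 0 < x) (hx1 : x ≤ 1)
    (hG : ∀ r, 0 ≤ r → HasDerivAt G (G1 r) r)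
    (hG1 : ∀ r, 0 ≤ r → HasDerivAt G1 (G2 r) r)
    (hM : ∀ r, 0 ≤ r → ‖G r‖ ≤ M * Real.exp (-r))
    (hM2 : ∀ r, 0 ≤ r → ‖G2 r‖ ≤ M * Real.exp (-r)) :
    ‖(∑' n : ℕ, G ((n + 1 : ℕ) * x)) -
      (x⁻¹ • (∫ r in Set.Ioi (0 : ℝ), G r) - (1 / 2 : ℝ) • G 0)‖ ≤ M * x := by
  have hM0 : 0 ≤ M := by
    have := (norm_nonneg _).trans (hM 0 le_rfl)
    simpa using this
  have hsum := summable_of_norm_le_exp hx hM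
  have hcont : ContinuousOn G (Set.Ici 0) := fun r hr =>
    (hG r hr).continuousAt.continuousWithinAt
  have hint : IntegrableOn G (Set.Ioi 0) := by
    refine Integrable.mono' (g := fun r => M * Real.exp (-r)) ?_ ?_ ?_
    · exact (integrableOn_exp_neg_Ioi 0).const_mul M
    · exact (hcont.mono Set.Ioi_subset_Ici_self).aestronglyMeasurable measurableSet_Ioi
    · filter_upwards [ae_restrict_mem measurableSet_Ioi] with r hr
      exact hM r (le_of_lt hr)
  have hii : ∀ a b : ℝ, 0 ≤ a → 0 ≤ b → IntervalIntegrable G volume a b := by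
    intro a b ha hb
    apply ContinuousOn.intervalIntegrable
    refine hcont.mono fun y hy => ?_
    exact (le_min ha hb).trans hy.1
  have hx0 : x ≠ 0 := hx.ne'
  -- After multiplication by x the difference is a sum of trapezoidal errors; the half-weight at the
  -- endpoint Nx disappears in the limit.
  have hpart : ∀ N : ℕ, ‖x • ((∑ n ∈ Finset.range N, G ((n + 1 : ℕ) * x)) + (1 / 2 : ℝ) • G 0
      - (1 / 2 : ℝ) • G (N * x)) - ∫ r in (0 : ℝ)..(N * x), G r‖ ≤
      ∑ n ∈ Finset.range N, M * Real.exp (-(x)) ^ n * x ^ 3 / 2 := by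
    intro N
    have hid : x • ((∑ n ∈ Finset.range N, G ((n + 1 : ℕ) * x)) + (1 / 2 : ℝ) • G 0
      - (1 / 2 : ℝ) • G (N * x)) - ∫ r in (0 : ℝ)..(N * x), G r =
      ∑ n ∈ Finset.range N, ((x / 2) • (G (n * x) + G (n * x + x)) -
        ∫ r in (n * x : ℝ)..(n * x + x), G r) := by
      induction N with
      | zero => simp
      | succ N ih =>
        rw [Finset.sum_range_succ, Finset.sum_range_succ, ← ih]
        have h1 : ((N + 1 : ℕ) : ℝ) * x = N * x + x := by push_cast; ring
        rw [h1, ← intervalIntegral.integral_add_adjacent_intervals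
          (hii 0 (N * x) le_rfl (by positivity)) (hii (N * x) (N * x + x) (by positivity)
            (by positivity))]
        module
    rw [hid]
    refine (norm_sum_le _ _).trans (Finset.sum_le_sum fun n _ => ?_)
    have hn0 : (0 : ℝ) ≤ n * x := by positivity
    refine norm_trapezoid_sub_integral_le hx.le (fun r hr => hG r (hn0.trans hr.1))
      (fun r hr => hG1 r (hn0.trans hr.1)) fun r hr => (hM2 r (hn0.trans hr.1)).trans ?_
    refine mul_le_mul_of_nonneg_left ?_ hM0
    rw [← Real.exp_nat_mul]
    apply Real.exp_le_exp.2
    linarith [hr.1]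
  have hgeo : ∀ N : ℕ, ∑ n ∈ Finset.range N, M * Real.exp (-(x)) ^ n * x ^ 3 / 2 ≤ M * x * x := by
    intro N
    have he : Real.exp (-x) < 1 := by simpa using hx
    have h1 : ∑ n ∈ Finset.range N, Real.exp (-x) ^ n ≤ (1 - Real.exp (-x))⁻¹ := by
      rw [← tsum_geometric_of_lt_one (Real.exp_pos _).le he]
      exact (summable_geometric_of_lt_one (Real.exp_pos _).le he).sum_le_tsum _
        fun i _ => by positivity
    -- Here x ≤ 1 enters: (1 + x)(1 − x/2) ≥ 1.
    have h2 : (1 - Real.exp (-x))⁻¹ ≤ 2 / x := by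
      rw [inv_le_comm₀ (by linarith) (by positivity), inv_div]
      have h3 : Real.exp (-x) ≤ (1 + x)⁻¹ := by
        rw [Real.exp_neg]
        exact inv_anti₀ (by linarith) (by linarith [Real.add_one_le_exp x])
      have h4 : (1 + x)⁻¹ ≤ 1 - x / 2 := by
        rw [inv_le_iff_one_le_mul₀ (by linarith)]
        nlinarith
      linarith
    calc ∑ n ∈ Finset.range N, M * Real.exp (-(x)) ^ n * x ^ 3 / 2
        = (M * x ^ 3 / 2) * ∑ n ∈ Finset.range N, Real.exp (-x) ^ n := by
          rw [Finset.mul_sum]; exact Finset.sum_congr rfl fun n _ => by ring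
      _ ≤ (M * x ^ 3 / 2) * (2 / x) :=
          mul_le_mul_of_nonneg_left (h1.trans h2) (by positivity)
      _ = M * x * x := by field_simp
  have hNx : Tendsto (fun N : ℕ => (N : ℝ) * x) atTop atTop :=
    tendsto_natCast_atTop_atTop.atTop_mul_const hx
  have hG0 : Tendsto (fun N : ℕ => G (N * x)) atTop (𝓝 0) := by
    rw [tendsto_zero_iff_norm_tendsto_zero]
    refine squeeze_zero (fun _ => norm_nonneg _) (fun N => hM _ (by positivity)) ?_
    have := ((Real.tendsto_exp_neg_atTop_nhds_zero.comp hNx).const_mul M)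
    simpa using this
  have hlim : Tendsto (fun N : ℕ => x • ((∑ n ∈ Finset.range N, G ((n + 1 : ℕ) * x)) +
      (1 / 2 : ℝ) • G 0 - (1 / 2 : ℝ) • G (N * x)) - ∫ r in (0 : ℝ)..(N * x), G r) atTop
      (𝓝 (x • ((∑' n : ℕ, G ((n + 1 : ℕ) * x)) + (1 / 2 : ℝ) • G 0 - (1 / 2 : ℝ) • (0 : E)) -
        ∫ r in Set.Ioi (0 : ℝ), G r)) := by
    refine Tendsto.sub (Tendsto.const_smul (Tendsto.sub (Tendsto.add ?_ tendsto_const_nhds)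
      (hG0.const_smul _)) x) ?_
    · exact hsum.hasSum.tendsto_sum_nat
    · exact intervalIntegral_tendsto_integral_Ioi 0 hint hNx
  have hfin := le_of_tendsto hlim.norm (Eventually.of_forall fun N => (hpart N).trans (hgeo N))
  have hrw : (∑' n : ℕ, G ((n + 1 : ℕ) * x)) -
      (x⁻¹ • (∫ r in Set.Ioi (0 : ℝ), G r) - (1 / 2 : ℝ) • G 0) =
      x⁻¹ • (x • ((∑' n : ℕ, G ((n + 1 : ℕ) * x)) + (1 / 2 : ℝ) • G 0 - (1 / 2 : ℝ) • (0 : E)) -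
        ∫ r in Set.Ioi (0 : ℝ), G r) := by
    rw [smul_sub, smul_smul, inv_mul_cancel₀ hx0, one_smul, smul_zero]
    abel
  rw [hrw, norm_smul, norm_inv, Real.norm_eq_abs, abs_of_pos hx, inv_mul_le_iff₀ hx]
  linarith

end EulerMaclaurin

/-! ### The modulus of H on a ray free of zeros -/

section Rays

theorem eval_map_ofReal (P : Polynomial ℝ) (x : ℝ) :
    (P.map (algebraMap ℝ ℂ)).eval (x : ℂ) = ((P.eval x : ℝ) : ℂ) := by
  rw [Polynomial.eval_map]
  exact Polynomial.eval₂_at_apply (algebraMap ℝ ℂ) x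

/-- The value of `P` at `e^{-r(1+it)}`. -/
def rayVal (P : Polynomial ℝ) (t r : ℝ) : ℂ :=
  (P.map (algebraMap ℝ ℂ)).eval (Complex.exp (-(r * (1 + t * Complex.I))))

theorem norm_exp_ray (t r : ℝ) :
    ‖Complex.exp (-(r * (1 + t * Complex.I)))‖ = Real.exp (-r) := by
  rw [Complex.norm_exp]; simp

theorem continuous_rayVal (P : Polynomial ℝ) :
    Continuous fun y : ℝ × ℝ => rayVal P y.1 y.2 := by
  unfold rayVal
  fun_prop

theorem rayVal_zero_right (P : Polynomial ℝ) (t : ℝ) : rayVal P t 0 = (P.eval 1 : ℝ) := by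
  rw [rayVal, ← eval_map_ofReal]; simp

theorem rayVal_zero_left (P : Polynomial ℝ) (r : ℝ) :
    rayVal P 0 r = (P.eval (Real.exp (-r)) : ℝ) := by
  rw [rayVal, ← eval_map_ofReal]; simp

theorem exists_norm_eval_le (p : Polynomial ℂ) : ∃ B : ℝ, 0 ≤ B ∧ ∀ w : ℂ, ‖w‖ ≤ 1 →
    ‖p.eval w‖ ≤ B := by
  obtain ⟨B, hB⟩ := (isCompact_closedBall (0 : ℂ) 1).exists_bound_of_continuousOn
    p.continuous.continuousOn
  exact ⟨max B 0, le_max_right _ _, fun w hw => (hB w (by simpa using hw)).trans (le_max_left _ _)⟩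

theorem exists_norm_eval_sub_one_le {P : Polynomial ℝ} (h0 : P.eval 0 = 1) :
    ∃ A : ℝ, 0 < A ∧ ∀ w : ℂ, ‖w‖ ≤ 1 →
      ‖(P.map (algebraMap ℝ ℂ)).eval w - 1‖ ≤ A * ‖w‖ := by
  obtain ⟨Q, hQ⟩ : (Polynomial.X : Polynomial ℂ) ∣ P.map (algebraMap ℝ ℂ) - 1 := by
    rw [Polynomial.X_dvd_iff, Polynomial.coeff_sub, Polynomial.coeff_map,
      Polynomial.coeff_zero_eq_eval_zero, h0]
    simp
  obtain ⟨B, hB, hb⟩ := exists_norm_eval_le Q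
  refine ⟨B + 1, by linarith, fun w hw => ?_⟩
  have h : (P.map (algebraMap ℝ ℂ)).eval w - 1 = (P.map (algebraMap ℝ ℂ) - 1).eval w := by simp
  rw [h, hQ, Polynomial.eval_mul, Polynomial.eval_X, norm_mul]
  nlinarith [hb w hw, norm_nonneg w]

theorem exists_norm_rayVal_sub_one_le {P : Polynomial ℝ} (h0 : P.eval 0 = 1) :
    ∃ A : ℝ, 0 < A ∧ ∀ t r : ℝ, 0 ≤ r → ‖rayVal P t r - 1‖ ≤ A * Real.exp (-r) := by
  obtain ⟨A, hA, h⟩ := exists_norm_eval_sub_one_le h0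
  refine ⟨A, hA, fun t r hr => ?_⟩
  have h1 := norm_exp_ray t r
  rw [← h1]
  exact h _ (by rw [h1]; exact Real.exp_le_one_iff.2 (by linarith))

/-- The logarithmic derivative of `P(e^{-s})` in `s`, as a function of `w = e^{-s}`. -/
def logDer (P : Polynomial ℝ) (w : ℂ) : ℂ :=
  -(w * (P.derivative.map (algebraMap ℝ ℂ)).eval w) / (P.map (algebraMap ℝ ℂ)).eval w

/-- The second logarithmic derivative of `P(e^{-s})` in `s`, as a function of `w = e^{-s}`. -/
def logDer2 (P : Polynomial ℝ) (w : ℂ) : ℂ :=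
  w * (((P.derivative.map (algebraMap ℝ ℂ)).eval w +
    w * (P.derivative.derivative.map (algebraMap ℝ ℂ)).eval w) /
      (P.map (algebraMap ℝ ℂ)).eval w -
    w * (P.derivative.map (algebraMap ℝ ℂ)).eval w ^ 2 / (P.map (algebraMap ℝ ℂ)).eval w ^ 2)

/-- Both logarithmic derivatives carry a factor w = e^{-s} with |w| = e^{-r}; this supplies the
exponential decay required in Euler–Maclaurin summation. -/
theorem exists_norm_logDer_le (P : Polynomial ℝ) {m : ℝ} (hm : 0 < m) :
    ∃ B : ℝ, 0 ≤ B ∧ ∀ t r : ℝ, 0 ≤ r → m ≤ ‖rayVal P t r‖ →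
      ‖logDer P (Complex.exp (-(r * (1 + t * Complex.I))))‖ ≤ B * Real.exp (-r) ∧
      ‖logDer2 P (Complex.exp (-(r * (1 + t * Complex.I))))‖ ≤ B * Real.exp (-r) := by
  obtain ⟨B1, h1, hb1⟩ := exists_norm_eval_le (P.derivative.map (algebraMap ℝ ℂ))
  obtain ⟨B2, h2, hb2⟩ := exists_norm_eval_le (P.derivative.derivative.map (algebraMap ℝ ℂ))
  refine ⟨(B1 + B2) / m + B1 ^ 2 / m ^ 2, by positivity, fun t r hr hmr => ?_⟩
  have hw : ‖Complex.exp (-(r * (1 + t * Complex.I)))‖ = Real.exp (-r) := norm_exp_ray t r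
  unfold rayVal at hmr
  set w := Complex.exp (-(r * (1 + t * Complex.I)))
  have hw1 : ‖w‖ ≤ 1 := by rw [hw]; exact Real.exp_le_one_iff.2 (by linarith)
  have hb1 := hb1 w hw1
  have hb2 := hb2 w hw1
  have hn := norm_nonneg w
  have hpos := hm.trans_le hmr
  constructor
  · rw [logDer, norm_div, norm_neg, norm_mul, ← hw, mul_div_assoc, mul_comm]
    refine mul_le_mul_of_nonneg_right ?_ hn
    calc _ ≤ B1 / m := div_le_div₀ h1 hb1 hm hmr
      _ ≤ (B1 + B2) / m := by gcongr; linarith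
      _ ≤ _ := le_add_of_nonneg_right (by positivity)
  · rw [logDer2, norm_mul, ← hw, mul_comm]
    refine mul_le_mul_of_nonneg_right ?_ hn
    refine (norm_sub_le _ _).trans (add_le_add ?_ ?_)
    · rw [norm_div]
      refine div_le_div₀ (by positivity) ?_ hm hmr
      refine (norm_add_le _ _).trans (add_le_add hb1 ?_)
      rw [norm_mul]
      calc _ ≤ 1 * B2 := mul_le_mul hw1 hb2 (norm_nonneg _) (by norm_num)
        _ = B2 := one_mul _
    · rw [norm_div, norm_mul, norm_pow, norm_pow]
      refine div_le_div₀ (by positivity) ?_ (by positivity) (pow_le_pow_left₀ hm.le hmr 2)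
      calc _ ≤ 1 * B1 ^ 2 := mul_le_mul hw1 (pow_le_pow_left₀ (norm_nonneg _) hb1 2)
            (by positivity) (by norm_num)
        _ = B1 ^ 2 := one_mul _

theorem hasDerivAt_exp_ray (t r : ℝ) :
    HasDerivAt (fun r : ℝ => Complex.exp (-(r * (1 + t * Complex.I))))
      (-(1 + t * Complex.I) * Complex.exp (-(r * (1 + t * Complex.I)))) r := by
  have h : HasDerivAt (fun r : ℝ => -((r : ℂ) * (1 + t * Complex.I))) (-(1 + t * Complex.I)) r := by
    have := ((Complex.ofRealCLM.hasDerivAt (x := r)).mul_const (1 + t * Complex.I)).neg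
    simpa using! this
  exact h.cexp.congr_deriv (mul_comm _ _)

theorem hasDerivAt_exp_ray_left (t r : ℝ) :
    HasDerivAt (fun t : ℝ => Complex.exp (-(r * (1 + t * Complex.I))))
      (-(Complex.I * r) * Complex.exp (-(r * (1 + t * Complex.I)))) t := by
  have h : HasDerivAt (fun t : ℝ => -((r : ℂ) * (1 + t * Complex.I))) (-(Complex.I * r)) t := by
    have := ((((Complex.ofRealCLM.hasDerivAt (x := t)).mul_const Complex.I).const_add 1).const_mul
      (r : ℂ)).neg
    refine this.congr_deriv ?_
    simp [mul_comm]
  exact h.cexp.congr_deriv (mul_comm _ _)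

theorem hasDerivAt_rayVal (P : Polynomial ℝ) (t r : ℝ) (hne : rayVal P t r ≠ 0) :
    HasDerivAt (rayVal P t) ((1 + t * Complex.I) *
      logDer P (Complex.exp (-(r * (1 + t * Complex.I)))) * rayVal P t r) r := by
  have h := ((P.map (algebraMap ℝ ℂ)).hasDerivAt
    (Complex.exp (-(r * (1 + t * Complex.I))))).comp r (hasDerivAt_exp_ray t r)
  refine h.congr_deriv ?_
  rw [rayVal] at hne ⊢
  rw [logDer, Polynomial.derivative_map]
  field_simp

theorem hasDerivAt_rayVal_left (P : Polynomial ℝ) (t r : ℝ) (hne : rayVal P t r ≠ 0) :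
    HasDerivAt (fun t => rayVal P t r) (Complex.I * r *
      logDer P (Complex.exp (-(r * (1 + t * Complex.I)))) * rayVal P t r) t := by
  have h := ((P.map (algebraMap ℝ ℂ)).hasDerivAt
    (Complex.exp (-(r * (1 + t * Complex.I))))).comp t (hasDerivAt_exp_ray_left t r)
  refine h.congr_deriv ?_
  rw [rayVal] at hne ⊢
  rw [logDer, Polynomial.derivative_map]
  field_simp

theorem hasDerivAt_logDer (P : Polynomial ℝ) (t r : ℝ) (hne : rayVal P t r ≠ 0) :
    HasDerivAt (fun r : ℝ => (1 + t * Complex.I) *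
        logDer P (Complex.exp (-(r * (1 + t * Complex.I)))))
      ((1 + t * Complex.I) ^ 2 * logDer2 P (Complex.exp (-(r * (1 + t * Complex.I))))) r := by
  rw [rayVal] at hne
  have hw := hasDerivAt_exp_ray t r
  set w := Complex.exp (-(r * (1 + t * Complex.I))) with hwdef
  have h1 := (P.derivative.map (algebraMap ℝ ℂ)).hasDerivAt w
  have h0 := (P.map (algebraMap ℝ ℂ)).hasDerivAt w
  rw [Polynomial.derivative_map] at h0 h1
  have h2 : HasDerivAt (logDer P) _ w := (((hasDerivAt_id' w).mul h1).neg).div h0 hne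
  refine ((h2.comp r hw).const_mul (1 + t * Complex.I)).congr_deriv ?_
  simp only [logDer2]
  field_simp
  simp
  ring

theorem abs_log_le_of_le {y m : ℝ} (hm : 0 < m) (h : m ≤ y) :
    |Real.log y| ≤ |y - 1| * (1 + 1 / m) := by
  have hy : 0 < y := hm.trans_le h
  have h1 : Real.log y ≤ y - 1 := Real.log_le_sub_one_of_pos hy
  have h2 : -Real.log y ≤ (1 - y) / y := by
    have := Real.log_le_sub_one_of_pos (inv_pos.2 hy)
    rw [Real.log_inv] at this
    refine this.trans (le_of_eq ?_)
    field_simp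
  have h3 : (1 - y) / y ≤ |y - 1| * (1 / m) := by
    rw [mul_one_div]
    refine div_le_div₀ (abs_nonneg _) ?_ hm h
    rw [abs_sub_comm]; exact le_abs_self _
  have h4 : 0 ≤ |y - 1| * (1 / m) := by positivity
  have h5 := abs_nonneg (y - 1)
  rw [abs_le]
  constructor
  · linarith
  · linarith [le_abs_self (y - 1)]

/-- Near 1 the logarithm is at most (3/2)|y − 1|. Elsewhere |y − 1| > 1/2, so the argument, at most
π, is absorbed by 2π|y − 1|. -/
theorem norm_clog_le_of_le {y : ℂ} {m : ℝ} (hm : 0 < m) (h : m ≤ ‖y‖) :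
    ‖Complex.log y‖ ≤ ‖y - 1‖ * (1 + 1 / m + 2 * Real.pi) := by
  by_cases hy : ‖y - 1‖ ≤ 1 / 2
  · have := Complex.norm_log_one_add_half_le_self hy
    rw [add_sub_cancel] at this
    have h1 : (0 : ℝ) < 1 / m := by positivity
    nlinarith [norm_nonneg (y - 1), Real.pi_gt_three]
  · push Not at hy
    have h1 : ‖Complex.log y‖ ≤ |Real.log ‖y‖| + Real.pi := by
      refine (Complex.norm_le_abs_re_add_abs_im _).trans (add_le_add ?_ ?_)
      · rw [Complex.log_re]
      · rw [Complex.log_im]; exact Complex.abs_arg_le_pi y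
    have h2 := abs_log_le_of_le hm h
    have h3 : |‖y‖ - 1| ≤ ‖y - 1‖ := by
      simpa using abs_norm_sub_norm_le y 1
    have h4 : |‖y‖ - 1| * (1 + 1 / m) ≤ ‖y - 1‖ * (1 + 1 / m) :=
      mul_le_mul_of_nonneg_right h3 (by positivity)
    nlinarith [Real.pi_pos]

/-- No branch of log f is needed: f(s)/f(r) is near 1, where the principal logarithm is
differentiable, and its real part is log|f(s)| up to a constant. -/
theorem hasDerivAt_log_norm {f : ℝ → ℂ} {f' : ℂ} {r : ℝ} (h : HasDerivAt f f' r) (hne : f r ≠ 0) :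
    HasDerivAt (fun r => Real.log ‖f r‖) (f' / f r).re r := by
  have h1 : HasDerivAt (fun s => Complex.log (f s / f r)) ((f' / f r) / (f r / f r)) r :=
    (h.div_const (f r)).clog_real (by rw [div_self hne]; simp)
  rw [div_self hne, div_one] at h1
  have h2 := ((Complex.reCLM.hasFDerivAt.comp_hasDerivAt r h1).add_const (Real.log ‖f r‖))
  refine h2.congr_of_eventuallyEq ?_
  filter_upwards [h.continuousAt.eventually_ne hne] with s hs
  simp only [Function.comp_apply, Complex.reCLM_apply, Complex.log_re, norm_div]
  rw [Real.log_div (by simpa using hs) (by simpa using hne)]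
  ring

/-- Beyond log(2A) the value is within 1/2 of 1; on the remaining compact segment a continuous
positive function attains its minimum. -/
theorem exists_le_norm_rayVal {P : Polynomial ℝ} (h0 : P.eval 0 = 1) {t : ℝ}
    (hne : ∀ r, 0 ≤ r → rayVal P t r ≠ 0) :
    ∃ m : ℝ, 0 < m ∧ ∀ r, 0 ≤ r → m ≤ ‖rayVal P t r‖ := by
  obtain ⟨A, hA, hb⟩ := exists_norm_rayVal_sub_one_le h0
  set R := Real.log (2 * A)
  have hcont : Continuous (fun r => ‖rayVal P t r‖) :=
    ((continuous_rayVal P).comp (Continuous.prodMk_right t)).norm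
  obtain ⟨r0, hr0, hmin⟩ := (isCompact_Icc (a := (0 : ℝ)) (b := max R 0)).exists_isMinOn
    ⟨0, by simp⟩ hcont.continuousOn
  refine ⟨min ‖rayVal P t r0‖ (1 / 2), lt_min (norm_pos_iff.2 (hne r0 hr0.1)) (by norm_num),
    fun r hr => ?_⟩
  by_cases hrR : r ≤ max R 0
  · exact (min_le_left _ _).trans (hmin ⟨hr, hrR⟩)
  · push Not at hrR
    have h1 := hb t r hr
    have h2 : A * Real.exp (-r) ≤ 1 / 2 := by
      have : Real.exp (-r) ≤ (2 * A)⁻¹ := by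
        rw [← Real.exp_log (show (0 : ℝ) < (2 * A)⁻¹ by positivity), Real.log_inv]
        exact Real.exp_le_exp.2 (by linarith [le_max_left R 0])
      calc A * Real.exp (-r) ≤ A * (2 * A)⁻¹ := by gcongr
        _ = 1 / 2 := by field_simp
    have h3 : (1 : ℝ) - ‖rayVal P t r‖ ≤ ‖rayVal P t r - 1‖ := by
      rw [norm_sub_rev]; simpa using norm_sub_norm_le (1 : ℂ) (rayVal P t r)
    exact (min_le_right _ _).trans (by linarith)

theorem exp_ray_pow (t x : ℝ) (i : ℕ) :
    Complex.exp (-(x * (1 + t * Complex.I))) ^ (i + 1) =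
      Complex.exp (-((((i + 1 : ℕ) : ℝ) * x : ℝ) * (1 + t * Complex.I))) := by
  rw [← Complex.exp_nat_mul]; congr 1; push_cast; ring

theorem tendsto_prod_rayVal {P : Polynomial ℝ} (h0 : P.eval 0 = 1) (t : ℝ) {x : ℝ} (hx : 0 < x) :
    Tendsto (fun N : ℕ => ∏ i ∈ Finset.range N, rayVal P t ((i + 1 : ℕ) * x)) atTop
      (𝓝 (eulerFun P (Complex.exp (-(x * (1 + t * Complex.I)))))) := by
  refine (tendsto_prod_eulerFun h0 (q := Complex.exp (-(x * (1 + t * Complex.I)))) ?_).congr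
    fun N => Finset.prod_congr rfl fun i _ => ?_
  · rw [norm_exp_ray]; simpa using hx
  · rw [exp_ray_pow, rayVal]

/-- On a ray free of zeros, `|H|` has an explicit asymptotic expansion at the origin. -/
theorem exists_norm_eulerFun_eq {P : Polynomial ℝ} (h0 : P.eval 0 = 1) {t : ℝ}
    (hne : ∀ r, 0 ≤ r → rayVal P t r ≠ 0) :
    IntegrableOn (fun r => Real.log ‖rayVal P t r‖) (Set.Ioi 0) ∧
    ∃ M : ℝ, ∀ x : ℝ, 0 < x → x ≤ 1 → ∃ e : ℝ, |e| ≤ M * x ∧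
      ‖eulerFun P (Complex.exp (-(x * (1 + t * Complex.I))))‖ =
        Real.exp (x⁻¹ * (∫ r in Set.Ioi (0 : ℝ), Real.log ‖rayVal P t r‖) -
          1 / 2 * Real.log |P.eval 1| + e) := by
  obtain ⟨m, hm, hmr⟩ := exists_le_norm_rayVal h0 hne
  obtain ⟨A, hA, hb⟩ := exists_norm_rayVal_sub_one_le h0
  obtain ⟨B, hB, hder⟩ := exists_norm_logDer_le P hm
  set z : ℂ := 1 + t * Complex.I with hz
  set M := max (A * (1 + 1 / m)) (‖z‖ ^ 2 * B)
  have hG : ∀ r : ℝ, 0 ≤ r → HasDerivAt (fun r => Real.log ‖rayVal P t r‖)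
      (z * logDer P (Complex.exp (-(r * z)))).re r := by
    intro r hr
    have := hasDerivAt_log_norm (hasDerivAt_rayVal P t r (hne r hr)) (hne r hr)
    rwa [mul_div_assoc, div_self (hne r hr), mul_one] at this
  have hG1 : ∀ r : ℝ, 0 ≤ r → HasDerivAt (fun r : ℝ => (z * logDer P (Complex.exp (-(r * z)))).re)
      (z ^ 2 * logDer2 P (Complex.exp (-(r * z)))).re r := by
    intro r hr
    exact Complex.reCLM.hasFDerivAt.comp_hasDerivAt r (hasDerivAt_logDer P t r (hne r hr))
  have hM : ∀ r, 0 ≤ r → ‖Real.log ‖rayVal P t r‖‖ ≤ M * Real.exp (-r) := by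
    intro r hr
    rw [Real.norm_eq_abs]
    refine (abs_log_le_of_le hm (hmr r hr)).trans ?_
    have h3 : |‖rayVal P t r‖ - 1| ≤ ‖rayVal P t r - 1‖ := by
      simpa using abs_norm_sub_norm_le (rayVal P t r) 1
    calc _ ≤ (A * Real.exp (-r)) * (1 + 1 / m) :=
          mul_le_mul_of_nonneg_right (h3.trans (hb t r hr)) (by positivity)
      _ = (A * (1 + 1 / m)) * Real.exp (-r) := by ring
      _ ≤ _ := mul_le_mul_of_nonneg_right (le_max_left _ _) (Real.exp_pos _).le
  have hM2 : ∀ r : ℝ, 0 ≤ r → ‖(z ^ 2 * logDer2 P (Complex.exp (-(r * z)))).re‖ ≤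
      M * Real.exp (-r) := by
    intro r hr
    refine (Complex.abs_re_le_norm _).trans ?_
    rw [norm_mul, norm_pow]
    calc _ ≤ ‖z‖ ^ 2 * (B * Real.exp (-r)) :=
          mul_le_mul_of_nonneg_left (hder t r hr (hmr r hr)).2 (by positivity)
      _ = (‖z‖ ^ 2 * B) * Real.exp (-r) := by ring
      _ ≤ _ := mul_le_mul_of_nonneg_right (le_max_right _ _) (Real.exp_pos _).le
  refine ⟨?_, M, fun x hx hx1 => ?_⟩
  · refine Integrable.mono' (g := fun r => M * Real.exp (-r))
      ((integrableOn_exp_neg_Ioi 0).const_mul M) ?_ ?_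
    · exact ContinuousOn.aestronglyMeasurable (fun r hr =>
        (hG r (le_of_lt hr)).continuousAt.continuousWithinAt) measurableSet_Ioi
    · filter_upwards [ae_restrict_mem measurableSet_Ioi] with r hr
      exact hM r (le_of_lt hr)
  · have hem := norm_tsum_sub_integral_le hx hx1 hG hG1 hM hM2
    refine ⟨_, hem, ?_⟩
    have hsum := summable_of_norm_le_exp hx hM
    have h1 : Tendsto (fun N : ℕ => ‖∏ i ∈ Finset.range N, rayVal P t ((i + 1 : ℕ) * x)‖) atTop
        (𝓝 (Real.exp (∑' n : ℕ, Real.log ‖rayVal P t ((n + 1 : ℕ) * x)‖))) := by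
      refine ((Real.continuous_exp.tendsto _).comp hsum.hasSum.tendsto_sum_nat).congr fun N => ?_
      rw [Function.comp_apply, Real.exp_sum, norm_prod]
      exact Finset.prod_congr rfl fun i _ =>
        Real.exp_log (norm_pos_iff.2 (hne _ (by positivity)))
    rw [tendsto_nhds_unique (tendsto_prod_rayVal h0 t hx).norm h1, rayVal_zero_right,
      Complex.norm_real, Real.norm_eq_abs, smul_eq_mul, smul_eq_mul]
    congr 1
    ring

end Rays

/-! ### The behaviour of H itself near the positive real axis -/

section NearRays

/-- The point e^{-r(1+it)} is within r e^{-r}|t| ≤ |t| of e^{-r}, uniformly in r, and P is Lipschitz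
on the unit disc. Staying in the right half-plane makes the principal logarithm available on the
whole ray. -/
theorem exists_le_re_rayVal {P : Polynomial ℝ} (hpos : ∀ x ∈ Set.Icc (0 : ℝ) 1, 0 < P.eval x) :
    ∃ δ : ℝ, 0 < δ ∧ ∃ m : ℝ, 0 < m ∧ ∀ t r : ℝ, |t| ≤ δ → 0 ≤ r → m ≤ (rayVal P t r).re := by
  obtain ⟨B, hB, hb⟩ := exists_norm_eval_le (P.map (algebraMap ℝ ℂ)).derivative
  obtain ⟨x0, hx0, hmin⟩ := (isCompact_Icc (a := (0 : ℝ)) (b := 1)).exists_isMinOn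
    ⟨0, by simp⟩ P.continuous.continuousOn
  set m := P.eval x0
  have hm : 0 < m := hpos x0 hx0
  refine ⟨m / (2 * (B + 1)), by positivity, m / 2, by positivity, fun t r ht hr => ?_⟩
  set w := Complex.exp (-(r * (1 + t * Complex.I)))
  have hw : ‖w‖ = Real.exp (-r) := norm_exp_ray t r
  have he1 : Real.exp (-r) ≤ 1 := Real.exp_le_one_iff.2 (by linarith)
  have hdist : ‖w - (Real.exp (-r) : ℝ)‖ ≤ |t| := by
    have h1 : w - (Real.exp (-r) : ℝ) =
        (Real.exp (-r) : ℝ) * (Complex.exp (Complex.I * (-(r * t) : ℝ)) - 1) := by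
      rw [mul_sub, mul_one, Complex.ofReal_exp, ← Complex.exp_add]
      congr 1
      change Complex.exp _ = _
      congr 1
      push_cast; ring
    rw [h1, norm_mul, Complex.norm_real, Real.norm_of_nonneg (Real.exp_pos _).le]
    have h2 := Real.norm_exp_I_mul_ofReal_sub_one_le (x := -(r * t))
    rw [norm_neg, Real.norm_eq_abs, abs_mul, abs_of_nonneg hr] at h2
    have h3 : Real.exp (-r) * r ≤ 1 := by
      rw [Real.exp_neg, inv_mul_le_iff₀ (Real.exp_pos _)]
      linarith [Real.add_one_le_exp r]
    calc _ ≤ Real.exp (-r) * (r * |t|) := mul_le_mul_of_nonneg_left h2 (Real.exp_pos _).le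
      _ = Real.exp (-r) * r * |t| := by ring
      _ ≤ 1 * |t| := mul_le_mul_of_nonneg_right h3 (abs_nonneg _)
      _ = |t| := one_mul _
  have hlip := (convex_closedBall (0 : ℂ) 1).norm_image_sub_le_of_norm_hasDerivWithin_le
    (f := fun w => (P.map (algebraMap ℝ ℂ)).eval w) (C := B)
    (fun z _ => ((P.map (algebraMap ℝ ℂ)).hasDerivAt z).hasDerivWithinAt)
    (fun z hz => hb z (by simpa using hz)) (x := (Real.exp (-r) : ℝ)) (y := w)
    (by rw [mem_closedBall_zero_iff, Complex.norm_real, Real.norm_of_nonneg (Real.exp_pos _).le]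
        exact he1) (by simpa [hw] using hr)
  rw [eval_map_ofReal] at hlip
  have h4 : B * ‖w - (Real.exp (-r) : ℝ)‖ ≤ m / 2 := by
    calc _ ≤ (B + 1) * (m / (2 * (B + 1))) :=
          mul_le_mul (by linarith) (hdist.trans ht) (norm_nonneg _) (by positivity)
      _ = m / 2 := by field_simp
  have h5 := (abs_le.1 ((Complex.abs_re_le_norm _).trans (hlip.trans h4))).1
  have h6 : m ≤ P.eval (Real.exp (-r)) := hmin ⟨(Real.exp_pos _).le, he1⟩
  rw [Complex.sub_re, Complex.ofReal_re] at h5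
  change m / 2 ≤ ((P.map (algebraMap ℝ ℂ)).eval w).re
  linarith

theorem integrableOn_mul_exp_neg (B : ℝ) :
    IntegrableOn (fun r : ℝ => B * (r * Real.exp (-r))) (Set.Ioi 0) := by
  have h := (Real.GammaIntegral_convergent (s := 2) (by norm_num)).const_mul B
  refine h.congr ?_
  filter_upwards [ae_restrict_mem measurableSet_Ioi] with r hr
  rw [show (2 : ℝ) - 1 = 1 by norm_num, Real.rpow_one]
  ring

theorem hasDerivAt_clog_rayVal {P : Polynomial ℝ} {t r : ℝ} (h : 0 < (rayVal P t r).re) :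
    HasDerivAt (fun r => Complex.log (rayVal P t r))
      ((1 + t * Complex.I) * logDer P (Complex.exp (-(r * (1 + t * Complex.I))))) r := by
  have hne : rayVal P t r ≠ 0 := fun h0 => by simp [h0] at h
  have := (hasDerivAt_rayVal P t r hne).clog_real (Or.inl h)
  rwa [mul_div_assoc, div_self hne, mul_one] at this

/-- Rotating the ray of integration. -/
theorem integral_clog_rayVal {P : Polynomial ℝ} (h0 : P.eval 0 = 1) {δ m : ℝ} (hm : 0 < m)
    (hδ : ∀ t r : ℝ, |t| ≤ δ → 0 ≤ r → m ≤ (rayVal P t r).re) {t : ℝ} (ht : |t| < δ) :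
    ∫ r in Set.Ioi (0 : ℝ), Complex.log (rayVal P t r) =
      logIntegral P / (1 + t * Complex.I) := by
  obtain ⟨A, hA, hb⟩ := exists_norm_rayVal_sub_one_le h0
  obtain ⟨B, hB, hder⟩ := exists_norm_logDer_le P hm
  set K := A * (1 + 1 / m + 2 * Real.pi)
  have hK : ∀ t r : ℝ, |t| ≤ δ → 0 ≤ r → ‖Complex.log (rayVal P t r)‖ ≤ K * Real.exp (-r) := by
    intro t r ht hr
    refine (norm_clog_le_of_le hm ((hδ t r ht hr).trans
      ((le_abs_self _).trans (Complex.abs_re_le_norm _)))).trans ?_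
    calc _ ≤ (A * Real.exp (-r)) * (1 + 1 / m + 2 * Real.pi) :=
          mul_le_mul_of_nonneg_right (hb t r hr) (by positivity)
      _ = _ := by ring
  have hslit : ∀ t r : ℝ, |t| ≤ δ → 0 ≤ r → rayVal P t r ∈ Complex.slitPlane :=
    fun t r ht hr => Or.inl (hm.trans_le (hδ t r ht hr))
  have hne : ∀ t r : ℝ, |t| ≤ δ → 0 ≤ r → rayVal P t r ≠ 0 :=
    fun t r ht hr => Complex.slitPlane_ne_zero (hslit t r ht hr)
  have hmle : ∀ t r : ℝ, |t| ≤ δ → 0 ≤ r → m ≤ ‖rayVal P t r‖ := fun t r ht hr =>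
    (hδ t r ht hr).trans ((le_abs_self _).trans (Complex.abs_re_le_norm _))
  have hcontr : ∀ t, Continuous (rayVal P t) := fun t =>
    (continuous_rayVal P).comp (Continuous.prodMk_right t)
  have hmeas : ∀ t, |t| ≤ δ → AEStronglyMeasurable (fun r => Complex.log (rayVal P t r))
      (volume.restrict (Set.Ioi 0)) := fun t ht =>
    ContinuousOn.aestronglyMeasurable (fun r hr => ((hcontr t).continuousAt.clog
      (hslit t r ht (le_of_lt hr))).continuousWithinAt) measurableSet_Ioi
  have hint : ∀ t, |t| ≤ δ → IntegrableOn (fun r => Complex.log (rayVal P t r)) (Set.Ioi 0) := by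
    intro t ht
    refine Integrable.mono' (g := fun r => K * Real.exp (-r))
      ((integrableOn_exp_neg_Ioi 0).const_mul K) (hmeas t ht) ?_
    filter_upwards [ae_restrict_mem measurableSet_Ioi] with r hr
    exact hK t r ht (le_of_lt hr)
  have hlogDercont : ∀ t, |t| ≤ δ → ContinuousOn
      (fun r : ℝ => logDer P (Complex.exp (-(r * (1 + t * Complex.I))))) (Set.Ioi 0) := by
    intro t ht
    unfold logDer
    refine ContinuousOn.div (by fun_prop) (by fun_prop) fun r hr => ?_
    exact hne t r ht (le_of_lt hr)
  have hbd : ∀ t r : ℝ, |t| ≤ δ → 0 ≤ r → ‖Complex.I * r *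
      logDer P (Complex.exp (-(r * (1 + t * Complex.I))))‖ ≤ B * (r * Real.exp (-r)) := by
    intro t r ht hr
    rw [norm_mul, norm_mul, Complex.norm_I, one_mul, Complex.norm_real, Real.norm_of_nonneg hr]
    have := mul_le_mul_of_nonneg_left (hder t r hr (hmle t r ht hr)).1 hr
    linarith
  have hF : ∀ t, |t| < δ → IntegrableOn (fun r : ℝ => Complex.I * r *
      logDer P (Complex.exp (-(r * (1 + t * Complex.I))))) (Set.Ioi 0) ∧
      HasDerivAt (fun t => ∫ r in Set.Ioi (0 : ℝ), Complex.log (rayVal P t r))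
      (∫ r in Set.Ioi (0 : ℝ), Complex.I * r *
        logDer P (Complex.exp (-(r * (1 + t * Complex.I))))) t := by
    intro t ht
    have hs : {s : ℝ | |s| < δ} ∈ 𝓝 t := (isOpen_lt continuous_abs continuous_const).mem_nhds ht
    refine hasDerivAt_integral_of_dominated_loc_of_deriv_le
      (F := fun t r => Complex.log (rayVal P t r))
      (F' := fun t r => Complex.I * r * logDer P (Complex.exp (-(r * (1 + t * Complex.I)))))
      (bound := fun r => B * (r * Real.exp (-r))) hs ?_ (hint t ht.le) ?_ ?_
      (integrableOn_mul_exp_neg B) ?_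
    · filter_upwards [hs] with s hs
      exact hmeas s (le_of_lt hs)
    · refine ContinuousOn.aestronglyMeasurable ?_ measurableSet_Ioi
      exact ContinuousOn.mul (by fun_prop) (hlogDercont t ht.le)
    · filter_upwards [ae_restrict_mem measurableSet_Ioi] with r hr s hs
      exact hbd s r (le_of_lt hs) (le_of_lt hr)
    · filter_upwards [ae_restrict_mem measurableSet_Ioi] with r hr s hs
      have hs' : |s| ≤ δ := le_of_lt hs
      have hr' : 0 ≤ r := le_of_lt hr
      have := (hasDerivAt_rayVal_left P s r (hne s r hs' hr')).clog_real (hslit s r hs' hr')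
      rwa [mul_div_assoc, div_self (hne s r hs' hr'), mul_one] at this
  -- Integration by parts in r: d/dr (r log P) = log P + r(1+it)·`logDer`, and r log P vanishes at
  -- both ends.
  have hparts : ∀ t, |t| < δ → (1 + t * Complex.I) * (∫ r in Set.Ioi (0 : ℝ), Complex.I * r *
        logDer P (Complex.exp (-(r * (1 + t * Complex.I))))) =
      -Complex.I * ∫ r in Set.Ioi (0 : ℝ), Complex.log (rayVal P t r) := by
    intro t ht
    have hd : ∀ r ∈ Set.Ici (0 : ℝ), HasDerivAt (fun r : ℝ => (r : ℂ) * Complex.log (rayVal P t r))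
        (Complex.log (rayVal P t r) + (-Complex.I * (1 + t * Complex.I)) * (Complex.I * r *
          logDer P (Complex.exp (-(r * (1 + t * Complex.I)))))) r := by
      intro r hr
      have h1 := (Complex.ofRealCLM.hasDerivAt (x := r)).mul
        (hasDerivAt_clog_rayVal (hm.trans_le (hδ t r ht.le hr)))
      refine h1.congr_deriv ?_
      simp only [Complex.ofRealCLM_apply, Complex.ofReal_one]
      linear_combination (r * (1 + t * Complex.I) *
        logDer P (Complex.exp (-(r * (1 + t * Complex.I))))) * Complex.I_sq
    have hlim : Tendsto (fun r : ℝ => (r : ℂ) * Complex.log (rayVal P t r)) atTop (𝓝 0) := by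
      rw [tendsto_zero_iff_norm_tendsto_zero]
      have h2 := (Real.tendsto_pow_mul_exp_neg_atTop_nhds_zero 1).const_mul K
      rw [mul_zero] at h2
      refine squeeze_zero' (Eventually.of_forall fun _ => norm_nonneg _) ?_ h2
      filter_upwards [eventually_ge_atTop 0] with r hr
      rw [norm_mul, Complex.norm_real, Real.norm_of_nonneg hr, pow_one]
      have := mul_le_mul_of_nonneg_left (hK t r ht.le hr) hr
      linarith
    have h3 := integral_Ioi_of_hasDerivAt_of_tendsto' hd
      ((hint t ht.le).add ((hF t ht).1.const_mul _)) hlim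
    rw [integral_add (hint t ht.le) ((hF t ht).1.const_mul _), integral_const_mul] at h3
    simp only [Complex.ofReal_zero, zero_mul, sub_zero] at h3
    linear_combination Complex.I * h3 + ((1 + t * Complex.I) * (∫ r in Set.Ioi (0 : ℝ),
      Complex.I * r * logDer P (Complex.exp (-(r * (1 + t * Complex.I)))))) * Complex.I_sq
  -- In place of a contour shift: with I(t) the integral along the ray, (1+it)I'(t) = −i I(t), so
  -- (1+it)I(t) is constant and equal to I(0) = C_P.
  have hconst : ∀ t ∈ Set.Ioo (-δ) δ, HasDerivWithinAt (fun t : ℝ => (1 + t * Complex.I) *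
      ∫ r in Set.Ioi (0 : ℝ), Complex.log (rayVal P t r)) 0 (Set.Ioo (-δ) δ) t := by
    intro t ht
    have ht' : |t| < δ := abs_lt.2 ht
    have h1 : HasDerivAt (fun t : ℝ => (1 + t * Complex.I)) Complex.I t := by
      have := ((Complex.ofRealCLM.hasDerivAt (x := t)).mul_const Complex.I).const_add 1
      refine this.congr_deriv ?_
      simp
    refine ((h1.mul (hF t ht').2).congr_deriv ?_).hasDerivWithinAt
    rw [hparts t ht']; ring
  have hδ0 : 0 < δ := (abs_nonneg t).trans_lt ht
  have h5 := (convex_Ioo (-δ) δ).norm_image_sub_le_of_norm_hasDerivWithin_le (C := 0) hconst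
    (by simp) (x := 0) (y := t) ⟨by linarith, hδ0⟩ (abs_lt.1 ht)
  rw [zero_mul, norm_le_zero_iff, sub_eq_zero] at h5
  have hz : (1 + t * Complex.I) ≠ 0 := fun h => by simpa using congrArg Complex.re h
  rw [eq_div_iff hz, mul_comm, h5, logIntegral, ← integral_complex_ofReal]
  simp only [Complex.ofReal_zero, zero_mul, add_zero, one_mul]
  refine setIntegral_congr_fun measurableSet_Ioi fun r hr => ?_
  have h6 : 0 ≤ P.eval (Real.exp (-r)) := by
    have := hm.le.trans (hδ 0 r (by simpa using hδ0.le) (le_of_lt hr))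
    rwa [rayVal_zero_left, Complex.ofReal_re] at this
  simp only [rayVal_zero_left]
  rw [Complex.ofReal_log h6]

/-- The behaviour of `H` at the origin near the positive real axis. -/
theorem exists_eulerFun_eq_near {P : Polynomial ℝ} (h0 : P.eval 0 = 1)
    (hpos : ∀ x ∈ Set.Icc (0 : ℝ) 1, 0 < P.eval x) :
    ∃ δ : ℝ, 0 < δ ∧ ∃ M : ℝ, ∀ t x : ℝ, |t| ≤ δ → 0 < x → x ≤ 1 → ∃ e : ℂ, ‖e‖ ≤ M * x ∧
      eulerFun P (Complex.exp (-(x * (1 + t * Complex.I)))) =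
        Complex.exp (logIntegral P / (x * (1 + t * Complex.I)) -
          1 / 2 * Real.log (P.eval 1) + e) := by
  obtain ⟨δ, hδ0, m, hm, hδ⟩ := exists_le_re_rayVal hpos
  obtain ⟨A, hA, hb⟩ := exists_norm_rayVal_sub_one_le h0
  obtain ⟨B, hB, hder⟩ := exists_norm_logDer_le P hm
  set K := A * (1 + 1 / m + 2 * Real.pi)
  set M := max K ((1 + δ) ^ 2 * B)
  -- Halving makes |t| < δ strict, as required for differentiation under the integral in an open
  -- neighbourhood of t.
  refine ⟨δ / 2, by positivity, M, fun t x ht hx hx1 => ?_⟩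
  have ht' : |t| < δ := by linarith
  have hre : ∀ r : ℝ, 0 ≤ r → 0 < (rayVal P t r).re := fun r hr =>
    hm.trans_le (hδ t r ht'.le hr)
  have hne : ∀ r : ℝ, 0 ≤ r → rayVal P t r ≠ 0 := fun r hr h => by
    have := hre r hr
    simp [h] at this
  have hmle : ∀ r : ℝ, 0 ≤ r → m ≤ ‖rayVal P t r‖ := fun r hr =>
    (hδ t r ht'.le hr).trans ((le_abs_self _).trans (Complex.abs_re_le_norm _))
  have hz : ‖1 + t * Complex.I‖ ≤ 1 + δ := by
    refine (norm_add_le _ _).trans ?_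
    simpa using ht'.le
  have hM : ∀ r : ℝ, 0 ≤ r → ‖Complex.log (rayVal P t r)‖ ≤ M * Real.exp (-r) := by
    intro r hr
    refine (norm_clog_le_of_le hm (hmle r hr)).trans ?_
    calc _ ≤ (A * Real.exp (-r)) * (1 + 1 / m + 2 * Real.pi) :=
          mul_le_mul_of_nonneg_right (hb t r hr) (by positivity)
      _ = K * Real.exp (-r) := by ring
      _ ≤ _ := mul_le_mul_of_nonneg_right (le_max_left _ _) (Real.exp_pos _).le
  have hM2 : ∀ r : ℝ, 0 ≤ r → ‖(1 + t * Complex.I) ^ 2 *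
      logDer2 P (Complex.exp (-(r * (1 + t * Complex.I))))‖ ≤ M * Real.exp (-r) := by
    intro r hr
    rw [norm_mul, norm_pow]
    calc _ ≤ (1 + δ) ^ 2 * (B * Real.exp (-r)) :=
          mul_le_mul (pow_le_pow_left₀ (norm_nonneg _) hz 2) (hder t r hr (hmle r hr)).2
            (norm_nonneg _) (by positivity)
      _ = ((1 + δ) ^ 2 * B) * Real.exp (-r) := by ring
      _ ≤ _ := mul_le_mul_of_nonneg_right (le_max_right _ _) (Real.exp_pos _).le
  have hem := norm_tsum_sub_integral_le hx hx1
    (fun r hr => hasDerivAt_clog_rayVal (hre r hr))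
    (fun r hr => hasDerivAt_logDer P t r (hne r hr)) hM hM2
  refine ⟨_, hem, ?_⟩
  have hsum := summable_of_norm_le_exp hx hM
  have h1 : Tendsto (fun N : ℕ => ∏ i ∈ Finset.range N, rayVal P t ((i + 1 : ℕ) * x)) atTop
      (𝓝 (Complex.exp (∑' n : ℕ, Complex.log (rayVal P t ((n + 1 : ℕ) * x))))) := by
    refine ((Complex.continuous_exp.tendsto _).comp hsum.hasSum.tendsto_sum_nat).congr fun N => ?_
    rw [Function.comp_apply, Complex.exp_sum]
    exact Finset.prod_congr rfl fun i _ => Complex.exp_log (hne _ (by positivity))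
  rw [tendsto_nhds_unique (tendsto_prod_rayVal h0 t hx) h1, rayVal_zero_right,
    integral_clog_rayVal h0 hm hδ ht', Complex.ofReal_log (hpos 1 (by simp)).le]
  congr 1
  simp only [Complex.real_smul]
  generalize (∑' n : ℕ, Complex.log (rayVal P t ((n + 1 : ℕ) * x))) = S
  push_cast
  field_simp
  ring

end NearRays

/-! ### Upper bounds for H, also near rays through zeros -/

section UpperBound

/-- A sum over an arithmetic progression is the integral of a step function. -/
theorem tsum_mul_eq_integral_ceil {g : ℝ → ℝ} {x : ℝ} (hx : 0 < x)
    (hint : IntegrableOn (fun r => g ((⌈r / x⌉₊ : ℝ) * x)) (Set.Ioi 0)) :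
    ∫ r in Set.Ioi (0 : ℝ), g ((⌈r / x⌉₊ : ℝ) * x) = x * ∑' n : ℕ, g ((n + 1 : ℕ) * x) := by
  have hmono : Monotone fun n : ℕ => (n : ℝ) * x := fun a b hab =>
    mul_le_mul_of_nonneg_right (Nat.cast_le.2 hab) hx.le
  have hU : ⋃ n : ℕ, Set.Ioc ((n : ℝ) * x) ((n + 1 : ℕ) * x) = Set.Ioi 0 := by
    ext r
    simp only [Set.mem_iUnion, Set.mem_Ioc, Set.mem_Ioi]
    constructor
    · rintro ⟨n, h1, -⟩
      exact lt_of_le_of_lt (by positivity) h1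
    · intro hr
      have h1 : 0 < ⌈r / x⌉₊ := Nat.ceil_pos.2 (by positivity)
      refine ⟨⌈r / x⌉₊ - 1, ?_, ?_⟩
      · have h2 := Nat.ceil_lt_add_one (show 0 ≤ r / x by positivity)
        rw [Nat.cast_sub (by omega), Nat.cast_one, ← lt_div_iff₀ hx]
        linarith
      · rw [Nat.sub_add_cancel h1, ← div_le_iff₀ hx]
        exact Nat.le_ceil _
  have hdisj : Pairwise (Function.onFun Disjoint fun n : ℕ =>
      Set.Ioc ((n : ℝ) * x) ((n + 1 : ℕ) * x)) := hmono.pairwise_disjoint_on_Ioc_succ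
  have h := hasSum_integral_iUnion (fun n : ℕ =>
    (measurableSet_Ioc : MeasurableSet (Set.Ioc ((n : ℝ) * x) ((n + 1 : ℕ) * x)))) hdisj
    (f := fun r => g ((⌈r / x⌉₊ : ℝ) * x)) (μ := volume) (by rw [hU]; exact hint)
  rw [hU] at h
  rw [← h.tsum_eq, ← tsum_mul_left]
  refine tsum_congr fun n => ?_
  have h3 : ∀ r ∈ Set.Ioc ((n : ℝ) * x) ((n + 1 : ℕ) * x),
      g ((⌈r / x⌉₊ : ℝ) * x) = g ((n + 1 : ℕ) * x) := by
    intro r hr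
    congr 3
    rw [Nat.ceil_eq_iff (by omega)]
    constructor
    · rw [lt_div_iff₀ hx]; simpa using hr.1
    · rw [div_le_iff₀ hx]; exact hr.2
  rw [setIntegral_congr_fun measurableSet_Ioc h3, setIntegral_const, smul_eq_mul]
  congr 1
  rw [Real.volume_real_Ioc_of_le (hmono (Nat.le_succ n))]
  push_cast; ring

/-- Riemann sums of a continuous family dominated by `e^{-r}`. -/
theorem tendsto_riemann_sum {u : ℝ → ℝ → ℝ} (hu : Continuous fun y : ℝ × ℝ => u y.1 y.2) {M : ℝ}
    (hM : ∀ t r, 0 ≤ r → ‖u t r‖ ≤ M * Real.exp (-r)) (t0 : ℝ) :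
    Tendsto (fun y : ℝ × ℝ => y.1 * ∑' n : ℕ, u y.2 ((n + 1 : ℕ) * y.1)) (𝓝[>] 0 ×ˢ 𝓝 t0)
      (𝓝 (∫ r in Set.Ioi (0 : ℝ), u t0 r)) := by
  have hM0 : 0 ≤ M := by
    have := (norm_nonneg _).trans (hM 0 0 le_rfl)
    simpa using this
  have hbound : ∀ x t r : ℝ, 0 < x → ‖u t ((⌈r / x⌉₊ : ℝ) * x)‖ ≤ M * Real.exp (-r) := by
    intro x t r hx
    refine (hM _ _ (by positivity)).trans (mul_le_mul_of_nonneg_left ?_ hM0)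
    apply Real.exp_le_exp.2
    have := Nat.le_ceil (r / x)
    rw [div_le_iff₀ hx] at this
    linarith
  have hmeas : ∀ x t : ℝ, AEStronglyMeasurable (fun r => u t ((⌈r / x⌉₊ : ℝ) * x))
      (volume.restrict (Set.Ioi 0)) := by
    intro x t
    have h1 : Continuous (u t) := hu.comp (Continuous.prodMk_right t)
    refine (h1.measurable.comp ?_).aestronglyMeasurable
    exact ((measurable_from_nat (f := fun n : ℕ => (n : ℝ))).comp
      (Nat.measurable_ceil.comp (measurable_id.div_const x))).mul_const x
  have hlim : Tendsto (fun y : ℝ × ℝ => ∫ r in Set.Ioi (0 : ℝ), u y.2 ((⌈r / y.1⌉₊ : ℝ) * y.1))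
      (𝓝[>] 0 ×ˢ 𝓝 t0) (𝓝 (∫ r in Set.Ioi (0 : ℝ), u t0 r)) := by
    refine tendsto_integral_filter_of_dominated_convergence (fun r => M * Real.exp (-r))
      (Eventually.of_forall fun y => hmeas y.1 y.2) ?_
      ((integrableOn_exp_neg_Ioi 0).const_mul M) ?_
    · filter_upwards [(eventually_mem_nhdsWithin (a := (0 : ℝ)) (s := Set.Ioi 0)).prod_inl (𝓝 t0)]
        with y hy
      exact Eventually.of_forall fun r => hbound y.1 y.2 r hy
    · filter_upwards [ae_restrict_mem measurableSet_Ioi] with r hr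
      have hr0 : (0 : ℝ) ≤ r := le_of_lt hr
      have h1 : Tendsto (fun x : ℝ => (⌈r / x⌉₊ : ℝ) * x) (𝓝[>] 0) (𝓝 r) := by
        have h2 : Tendsto (fun x : ℝ => r + x) (𝓝[>] 0) (𝓝 r) := by
          have : Tendsto (fun x : ℝ => r + x) (𝓝 0) (𝓝 (r + 0)) := tendsto_const_nhds.add tendsto_id
          rw [add_zero] at this
          exact this.mono_left nhdsWithin_le_nhds
        refine tendsto_of_tendsto_of_tendsto_of_le_of_le' tendsto_const_nhds h2 ?_ ?_
        · filter_upwards [self_mem_nhdsWithin] with x hx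
          rw [← div_le_iff₀ hx]; exact Nat.le_ceil _
        · filter_upwards [self_mem_nhdsWithin] with x hx
          have hx : (0 : ℝ) < x := hx
          have h3 := (Nat.ceil_lt_add_one (show 0 ≤ r / x by positivity)).le
          calc _ ≤ (r / x + 1) * x := mul_le_mul_of_nonneg_right h3 hx.le
            _ = r + x := by field_simp
      have h4 : Tendsto (fun y : ℝ × ℝ => (y.2, (⌈r / y.1⌉₊ : ℝ) * y.1)) (𝓝[>] 0 ×ˢ 𝓝 t0)
          (𝓝 (t0, r)) := tendsto_snd.prodMk_nhds (h1.comp tendsto_fst)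
      exact (hu.tendsto (t0, r)).comp h4
  refine hlim.congr' ?_
  filter_upwards [(eventually_mem_nhdsWithin (a := (0 : ℝ)) (s := Set.Ioi 0)).prod_inl (𝓝 t0)]
    with y hy
  refine tsum_mul_eq_integral_ceil (g := u y.2) hy ?_
  exact Integrable.mono' ((integrableOn_exp_neg_Ioi 0).const_mul M) (hmeas y.1 y.2)
    (Eventually.of_forall fun r => hbound y.1 y.2 r hy)

/-- Upper bound for `|H|` near a ray, by upper semicontinuity. -/
theorem eventually_norm_eulerFun_le {P : Polynomial ℝ} (h0 : P.eval 0 = 1) {t0 c : ℝ}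
    (hint : IntegrableOn (fun r => Real.log ‖rayVal P t0 r‖) (Set.Ioi 0))
    (hne : ∀ᵐ r ∂(volume.restrict (Set.Ioi 0)), rayVal P t0 r ≠ 0)
    (hc : ∫ r in Set.Ioi (0 : ℝ), Real.log ‖rayVal P t0 r‖ < c) :
    ∀ᶠ y : ℝ × ℝ in 𝓝[>] 0 ×ˢ 𝓝 t0,
      ‖eulerFun P (Complex.exp (-(y.1 * (1 + y.2 * Complex.I))))‖ ≤ Real.exp (c / y.1) := by
  obtain ⟨A, hA, hb⟩ := exists_norm_rayVal_sub_one_le h0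
  have hcontr : Continuous (rayVal P t0) :=
    (continuous_rayVal P).comp (Continuous.prodMk_right t0)
  -- Truncating |P| from below at ε removes the logarithmic singularities and only increases the
  -- product. As ε → 0 the truncated integral returns to the true one, dominated by |log|P|| because
  -- ε < 1.
  have hlim : Tendsto (fun ε : ℝ => ∫ r in Set.Ioi (0 : ℝ), Real.log (max ‖rayVal P t0 r‖ ε))
      (𝓝[>] 0) (𝓝 (∫ r in Set.Ioi (0 : ℝ), Real.log ‖rayVal P t0 r‖)) := by
    refine tendsto_integral_filter_of_dominated_convergence
      (fun r => |Real.log ‖rayVal P t0 r‖|) ?_ ?_ hint.abs ?_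
    · refine Eventually.of_forall fun ε => ?_
      exact (Real.measurable_log.comp
        (hcontr.norm.measurable.max measurable_const)).aestronglyMeasurable
    · filter_upwards [self_mem_nhdsWithin,
        mem_nhdsWithin_of_mem_nhds (Iio_mem_nhds (show (0 : ℝ) < 1 by norm_num))] with ε he he1
      have he : 0 < ε := he
      have he1 : ε < 1 := he1
      filter_upwards [hne] with r hr
      have hpos : 0 < ‖rayVal P t0 r‖ := norm_pos_iff.2 hr
      rw [Real.norm_eq_abs]
      rcases le_total ε ‖rayVal P t0 r‖ with h | h
      · rw [max_eq_left h]
      · rw [max_eq_right h]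
        have h1 := Real.log_le_log hpos h
        have h2 := Real.log_neg he he1
        rw [abs_of_neg h2, abs_of_neg (by linarith)]
        linarith
    · filter_upwards [hne] with r hr
      refine tendsto_const_nhds.congr' ?_
      filter_upwards [mem_nhdsWithin_of_mem_nhds (Iio_mem_nhds (norm_pos_iff.2 hr))] with ε he
      rw [max_eq_left (le_of_lt he)]
  obtain ⟨ε, hε, he0, he1⟩ := ((hlim.eventually (gt_mem_nhds hc)).and
    ((eventually_mem_nhdsWithin (a := (0 : ℝ)) (s := Set.Ioi 0)).and
      (mem_nhdsWithin_of_mem_nhds (Iio_mem_nhds (show (0 : ℝ) < 1 by norm_num))))).exists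
  have he0 : 0 < ε := he0
  have he1 : ε < 1 := he1
  -- The truncated logarithm is jointly continuous in t and r, so its Riemann sums converge as x → 0
  -- and t → t0 simultaneously.
  set u : ℝ → ℝ → ℝ := fun t r => Real.log (max ‖rayVal P t r‖ ε)
  have hu : Continuous fun y : ℝ × ℝ => u y.1 y.2 :=
    ((continuous_rayVal P).norm.max continuous_const).log
      fun y => (he0.trans_le (le_max_right _ _)).ne'
  have hM : ∀ t r, 0 ≤ r → ‖u t r‖ ≤ A * (1 + 1 / ε) * Real.exp (-r) := by
    intro t r hr
    refine (abs_log_le_of_le he0 (le_max_right _ _)).trans ?_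
    have h1 : |max ‖rayVal P t r‖ ε - 1| ≤ |‖rayVal P t r‖ - 1| := by
      rcases le_total ε ‖rayVal P t r‖ with h | h
      · rw [max_eq_left h]
      · rw [max_eq_right h, abs_of_neg (by linarith), abs_of_neg (by linarith)]
        linarith
    have h3 : |‖rayVal P t r‖ - 1| ≤ ‖rayVal P t r - 1‖ := by
      simpa using abs_norm_sub_norm_le (rayVal P t r) 1
    calc _ ≤ (A * Real.exp (-r)) * (1 + 1 / ε) :=
          mul_le_mul_of_nonneg_right (h1.trans (h3.trans (hb t r hr))) (by positivity)
      _ = _ := by ring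
  filter_upwards [(tendsto_riemann_sum hu hM t0).eventually (gt_mem_nhds hε),
    (eventually_mem_nhdsWithin (a := (0 : ℝ)) (s := Set.Ioi 0)).prod_inl (𝓝 t0)] with y hy hy0
  have hy0 : 0 < y.1 := hy0
  have hsum := summable_of_norm_le_exp hy0 (hM y.2)
  have h1 := (tendsto_prod_rayVal h0 y.2 hy0).norm
  have h2 := (Real.continuous_exp.tendsto _).comp hsum.hasSum.tendsto_sum_nat
  refine (le_of_tendsto_of_tendsto' h1 h2 fun N => ?_).trans ?_
  · rw [Function.comp_apply, Real.exp_sum, norm_prod]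
    refine Finset.prod_le_prod (fun _ _ => norm_nonneg _) fun i _ => ?_
    rw [Real.exp_log (he0.trans_le (le_max_right _ _))]
    exact le_max_left _ _
  · apply Real.exp_le_exp.2
    rw [le_div_iff₀ hy0, mul_comm]
    exact hy.le

/-- Each t has a neighbourhood with its own gap η below c; compactness retains finitely many, and
the least η serves for all of K. -/
theorem exists_forall_norm_eulerFun_le {P : Polynomial ℝ} (h0 : P.eval 0 = 1) {K : Set ℝ}
    (hK : IsCompact K) {c : ℝ}
    (hint : ∀ t ∈ K, IntegrableOn (fun r => Real.log ‖rayVal P t r‖) (Set.Ioi 0))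
    (hne : ∀ t ∈ K, ∀ᵐ r ∂(volume.restrict (Set.Ioi 0)), rayVal P t r ≠ 0)
    (hc : ∀ t ∈ K, ∫ r in Set.Ioi (0 : ℝ), Real.log ‖rayVal P t r‖ < c) :
    ∃ η : ℝ, 0 < η ∧ ∀ᶠ x : ℝ in 𝓝[>] 0, ∀ t ∈ K,
      ‖eulerFun P (Complex.exp (-(x * (1 + t * Complex.I))))‖ ≤ Real.exp ((c - η) / x) := by
  refine hK.induction_on (p := fun s => ∃ η : ℝ, 0 < η ∧ ∀ᶠ x : ℝ in 𝓝[>] 0, ∀ t ∈ s,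
      ‖eulerFun P (Complex.exp (-(x * (1 + t * Complex.I))))‖ ≤ Real.exp ((c - η) / x)) ?_ ?_ ?_ ?_
  · exact ⟨1, one_pos, by simp⟩
  · rintro s s' hs ⟨η, h1, h2⟩
    exact ⟨η, h1, h2.mono fun x hx t ht => hx t (hs ht)⟩
  · rintro s s' ⟨η, h1, h2⟩ ⟨η', h1', h2'⟩
    refine ⟨min η η', lt_min h1 h1', ?_⟩
    filter_upwards [h2, h2', self_mem_nhdsWithin] with x hx hx' hx0 t ht
    have hx0 : (0 : ℝ) < x := hx0
    rcases ht with ht | ht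
    · refine (hx t ht).trans (Real.exp_le_exp.2 ?_)
      gcongr; exact min_le_left _ _
    · refine (hx' t ht).trans (Real.exp_le_exp.2 ?_)
      gcongr; exact min_le_right _ _
  · intro t ht
    obtain ⟨d, hd1, hd2⟩ := exists_between (hc t ht)
    have h := eventually_norm_eulerFun_le h0 (hint t ht) (hne t ht) hd1
    obtain ⟨p, hp, q, hq, hpq⟩ := eventually_prod_iff.1 h
    refine ⟨{s | q s}, mem_nhdsWithin_of_mem_nhds hq, c - d, by linarith, ?_⟩
    filter_upwards [hp] with x hx s hs
    have := hpq hx hs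
    simpa using this

end UpperBound

/-! ### Logarithmic integrals of a single linear factor -/

section LogSeries

/-- Termwise integration of the logarithmic series along a curve in the unit disc. -/
theorem integral_log_norm_one_sub {s : Set ℝ} (hs : MeasurableSet s) {w : ℝ → ℂ}
    (hw : Continuous w) (hw1 : ∀ r ∈ s, ‖w r‖ < 1)
    (hint : ∀ k : ℕ, IntegrableOn (fun r => w r ^ (k + 1)) s)
    (hbd : ∀ k : ℕ, ∫ r in s, ‖w r‖ ^ (k + 1) ≤ 1 / ((k : ℝ) + 1)) :
    IntegrableOn (fun r => Real.log ‖1 - w r‖) s ∧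
    HasSum (fun k : ℕ => ((∫ r in s, w r ^ (k + 1)) / ((k : ℂ) + 1)).re)
      (-∫ r in s, Real.log ‖1 - w r‖) := by
  set F : ℕ → ℝ → ℂ := fun k r => w r ^ (k + 1) / ((k : ℂ) + 1)
  have hFint : ∀ k, Integrable (F k) (volume.restrict s) := fun k => (hint k).div_const _
  have hnorm : ∀ k r, ‖F k r‖ = ‖w r‖ ^ (k + 1) / ((k : ℝ) + 1) := by
    intro k r
    have : ‖(k : ℂ) + 1‖ = (k : ℝ) + 1 := by
      have := Complex.norm_natCast (k + 1)
      push_cast at this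
      exact this
    rw [norm_div, norm_pow, this]
  have hsumm : Summable fun k : ℕ => 1 / ((k : ℝ) + 1) ^ 2 := by
    have := (summable_nat_add_iff 1).2 (Real.summable_one_div_nat_pow.2 one_lt_two)
    simpa using this
  -- One factor 1/(k+1) comes from the logarithmic series and one from the integral of |w|^{k+1}, so
  -- termwise integration survives |w| → 1 at the end of the set.
  have hFsum : Summable fun k => ∫ r in s, ‖F k r‖ := by
    refine Summable.of_nonneg_of_le (fun k => integral_nonneg fun r => norm_nonneg _)
      (fun k => ?_) hsumm
    simp only [hnorm]
    rw [integral_div, pow_two, ← div_div]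
    exact div_le_div_of_nonneg_right (hbd k) (by positivity)
  have hlog : ∀ r ∈ s, HasSum (fun k => F k r) (-Complex.log (1 - w r)) := by
    intro r hr
    have := (hasSum_nat_add_iff' 1).2 (Complex.hasSum_taylorSeries_neg_log (hw1 r hr))
    simpa [F] using this
  have hslit : ∀ r ∈ s, 1 - w r ∈ Complex.slitPlane := fun r hr => by
    left
    have := (Complex.abs_re_le_norm (w r)).trans_lt (hw1 r hr)
    simp only [Complex.sub_re, Complex.one_re]
    linarith [(abs_lt.1 this).2]
  have hlogint : IntegrableOn (fun r => -Complex.log (1 - w r)) s := by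
    refine ⟨?_, ?_⟩
    · refine ContinuousOn.aestronglyMeasurable (ContinuousOn.neg fun r hr => ?_) hs
      exact ((continuous_const.sub hw).continuousAt.clog (hslit r hr)).continuousWithinAt
    · have h1 : ∫⁻ r in s, ‖-Complex.log (1 - w r)‖ₑ ≤ ∫⁻ r in s, ∑' k, ‖F k r‖ₑ := by
        refine setLIntegral_mono' hs fun r hr => ?_
        rw [← (hlog r hr).tsum_eq]
        exact enorm_tsum_le_tsum_enorm
      refine lt_of_le_of_lt h1 ?_
      rw [lintegral_tsum fun k => (hFint k).1.enorm]
      have h2 : ∀ k, ∫⁻ r in s, ‖F k r‖ₑ = ENNReal.ofReal (∫ r in s, ‖F k r‖) := by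
        intro k
        rw [ofReal_integral_norm_eq_lintegral_enorm (hFint k)]
      simp only [h2]
      rw [← ENNReal.ofReal_tsum_of_nonneg (fun k => integral_nonneg fun r => norm_nonneg _) hFsum]
      exact ENNReal.ofReal_lt_top
  have hre : ∀ r, Real.log ‖1 - w r‖ = -(-Complex.log (1 - w r)).re := by
    intro r; rw [Complex.neg_re, Complex.log_re, neg_neg]
  refine ⟨?_, ?_⟩
  · simp only [hre]
    exact hlogint.re.neg
  · have h := hasSum_integral_of_summable_integral_norm hFint hFsum
    have h2 : ∫ r in s, ∑' k, F k r = ∫ r in s, -Complex.log (1 - w r) :=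
      setIntegral_congr_fun hs fun r hr => (hlog r hr).tsum_eq
    rw [h2] at h
    have h3 := (Complex.hasSum_iff _ _).1 h |>.1
    simp only [F, integral_div] at h3
    convert h3 using 1
    simp only [hre]
    rw [integral_neg, neg_neg]
    exact integral_re hlogint

/-- The factor of `P(e^{-r(1+it)})` belonging to the root `1 / b`. -/
def rayFactor (b : ℂ) (t r : ℝ) : ℂ := 1 - b * Complex.exp (-(r * (1 + t * Complex.I)))

theorem one_add_mul_I_ne_zero (t : ℝ) : (1 + t * Complex.I) ≠ 0 := fun h => by
  simpa using congrArg Complex.re h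

theorem pow_ray (b : ℂ) (t r : ℝ) (k : ℕ) :
    (b * Complex.exp (-(r * (1 + t * Complex.I)))) ^ k =
      b ^ k * Complex.exp (-(k * (1 + t * Complex.I)) * r) := by
  rw [mul_pow, ← Complex.exp_nat_mul]; congr 2; ring

theorem norm_ray (b : ℂ) (t r : ℝ) :
    ‖b * Complex.exp (-(r * (1 + t * Complex.I)))‖ = ‖b‖ * Real.exp (-r) := by
  rw [norm_mul, Complex.norm_exp]; simp

/-- The part of the ray where the factor is given by the logarithmic series. -/
theorem integral_log_rayFactor_Ioi {b : ℂ} {R : ℝ} (hb : ‖b‖ ≤ Real.exp R) (t : ℝ) :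
    IntegrableOn (fun r => Real.log ‖rayFactor b t r‖) (Set.Ioi R) ∧
    HasSum (fun k : ℕ => (b ^ (k + 1) * Complex.exp (-((k + 1) * (1 + t * Complex.I)) * R) /
        ((k + 1) ^ 2 * (1 + t * Complex.I))).re)
      (-∫ r in Set.Ioi R, Real.log ‖rayFactor b t r‖) := by
  have hre : ∀ k : ℕ, (-(((k : ℂ) + 1) * (1 + t * Complex.I))).re = -((k : ℝ) + 1) := by
    intro k; simp
  have hneg : ∀ k : ℕ, (-(((k : ℂ) + 1) * (1 + t * Complex.I))).re < 0 := by
    intro k; rw [hre]; linarith [k.cast_nonneg (α := ℝ)]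
  have hpow : ∀ (k : ℕ) (r : ℝ), (b * Complex.exp (-(r * (1 + t * Complex.I)))) ^ (k + 1) =
      b ^ (k + 1) * Complex.exp (-((k + 1) * (1 + t * Complex.I)) * r) := by
    intro k r; rw [pow_ray]; push_cast; rfl
  have h := integral_log_norm_one_sub (s := Set.Ioi R) measurableSet_Ioi
    (w := fun r => b * Complex.exp (-(r * (1 + t * Complex.I)))) (by fun_prop) ?_ ?_ ?_
  · refine ⟨h.1, ?_⟩
    convert h.2 using 3 with k
    simp only [hpow]
    rw [integral_const_mul, integral_exp_mul_complex_Ioi (hneg k)]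
    have h1 := one_add_mul_I_ne_zero t
    have h2 : (k : ℂ) + 1 ≠ 0 := Nat.cast_add_one_ne_zero k
    field_simp
    rfl
  · intro r hr
    rw [norm_ray]
    calc _ ≤ Real.exp R * Real.exp (-r) := mul_le_mul_of_nonneg_right hb (Real.exp_pos _).le
      _ = Real.exp (R - r) := by rw [← Real.exp_add]; rfl
      _ < 1 := by rw [Real.exp_lt_one_iff]; linarith [Set.mem_Ioi.1 hr]
  · intro k
    simp only [hpow]
    exact (integrableOn_exp_mul_complex_Ioi (hneg k) R).const_mul _
  · intro k
    have hk : (0 : ℝ) < (k : ℝ) + 1 := by positivity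
    have h1 : ∀ r : ℝ, ‖b * Complex.exp (-(r * (1 + t * Complex.I)))‖ ^ (k + 1) =
        ‖b‖ ^ (k + 1) * Real.exp (-((k : ℝ) + 1) * r) := by
      intro r
      rw [norm_ray, mul_pow, ← Real.exp_nat_mul]
      congr 2; push_cast; ring
    simp only [h1]
    rw [integral_const_mul, integral_exp_mul_Ioi (by linarith)]
    have h2 : ‖b‖ ^ (k + 1) ≤ Real.exp (((k : ℝ) + 1) * R) := by
      have := pow_le_pow_left₀ (norm_nonneg b) hb (k + 1)
      rwa [← Real.exp_nat_mul, Nat.cast_add_one] at this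
    have h3 : -Real.exp (-((k : ℝ) + 1) * R) / -((k : ℝ) + 1) =
        Real.exp (-(((k : ℝ) + 1) * R)) / ((k : ℝ) + 1) := by rw [neg_div_neg_eq, neg_mul]
    rw [h3, mul_div_assoc']
    refine div_le_div_of_nonneg_right ?_ hk.le
    calc _ ≤ Real.exp (((k : ℝ) + 1) * R) * Real.exp (-(((k : ℝ) + 1) * R)) :=
          mul_le_mul_of_nonneg_right h2 (Real.exp_pos _).le
      _ = 1 := by rw [← Real.exp_add]; simp

/-- The part of the ray where the inverse of the factor is given by the logarithmic series. -/
theorem integral_log_rayFactor_Ioo {b : ℂ} (hb : 1 < ‖b‖) (t : ℝ) :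
    IntegrableOn (fun r => Real.log ‖rayFactor b t r‖) (Set.Ioc 0 (Real.log ‖b‖)) ∧
    HasSum (fun k : ℕ => (((b ^ (k + 1))⁻¹ *
        (Complex.exp (((k + 1) * (1 + t * Complex.I)) * Real.log ‖b‖) - 1)) /
        ((k + 1) ^ 2 * (1 + t * Complex.I))).re)
      (Real.log ‖b‖ ^ 2 / 2 -
        ∫ r in Set.Ioc 0 (Real.log ‖b‖), Real.log ‖rayFactor b t r‖) := by
  set R := Real.log ‖b‖ with hR
  have hR0 : 0 < R := Real.log_pos hb
  have hb0 : b ≠ 0 := by rintro rfl; simp at hb; linarith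
  have hbn : ‖b‖ = Real.exp R := by rw [hR, Real.exp_log (by linarith)]
  set w : ℝ → ℂ := fun r => b⁻¹ * Complex.exp (r * (1 + t * Complex.I)) with hw
  have hwn : ∀ r, ‖w r‖ = Real.exp (r - R) := by
    intro r
    rw [hw]
    simp only [norm_mul, norm_inv, Complex.norm_exp]
    rw [hbn, ← Real.exp_neg, ← Real.exp_add]
    simp; ring
  have hpow : ∀ (k : ℕ) (r : ℝ), w r ^ (k + 1) =
      (b ^ (k + 1))⁻¹ * Complex.exp (((k + 1) * (1 + t * Complex.I)) * r) := by
    intro k r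
    rw [hw]
    simp only [mul_pow, inv_pow]
    rw [← Complex.exp_nat_mul]; congr 2; push_cast; ring
  have hwc : Continuous w := by fun_prop
  have h := integral_log_norm_one_sub (s := Set.Ioo 0 R) measurableSet_Ioo hwc ?_ ?_ ?_
  -- For r < R = log|b| the term b e^{-r(1+it)} dominates; extracting it leaves R − r, of integral
  -- R²/2, plus a convergent logarithmic series in w.
  · have hsplit : ∀ r ∈ Set.Ioo 0 R,
        (R - r) + Real.log ‖1 - w r‖ = Real.log ‖rayFactor b t r‖ := by
      intro r hr
      have h1 : rayFactor b t r = -(b * Complex.exp (-(r * (1 + t * Complex.I)))) * (1 - w r) := by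
        have h2 : Complex.exp (-(r * (1 + t * Complex.I))) * Complex.exp (r * (1 + t * Complex.I))
          = 1 := by rw [← Complex.exp_add]; simp
        rw [rayFactor, hw]
        simp only
        linear_combination -b * b⁻¹ * h2 - mul_inv_cancel₀ hb0
      have hlt : ‖w r‖ < 1 := by
        rw [hwn, Real.exp_lt_one_iff]; linarith [hr.2]
      have hne : ‖1 - w r‖ ≠ 0 := by
        rw [norm_ne_zero_iff, sub_ne_zero]
        rintro h3
        rw [← h3] at hlt; simp at hlt
      rw [h1, norm_mul, norm_neg, norm_ray, hbn, ← Real.exp_add,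
        Real.log_mul (Real.exp_pos _).ne' hne, Real.log_exp]
      ring
    have hlin : IntegrableOn (fun r : ℝ => R - r) (Set.Ioo 0 R) :=
      ((continuous_const.sub continuous_id).integrableOn_Icc (a := 0) (b := R)).mono_set
        Set.Ioo_subset_Icc_self
    have hI : IntegrableOn (fun r => Real.log ‖rayFactor b t r‖) (Set.Ioo 0 R) :=
      (hlin.add h.1).congr_fun (fun r hr => hsplit r hr) measurableSet_Ioo
    refine ⟨(integrableOn_Ioc_iff_integrableOn_Ioo (by simp)).2 hI, ?_⟩
    have h4 : ∫ r in Set.Ioc 0 R, Real.log ‖rayFactor b t r‖ =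
        R ^ 2 / 2 + ∫ r in Set.Ioo 0 R, Real.log ‖1 - w r‖ := by
      rw [integral_Ioc_eq_integral_Ioo, ← setIntegral_congr_fun measurableSet_Ioo hsplit,
        integral_add hlin h.1]
      congr 1
      rw [← integral_Ioc_eq_integral_Ioo, ← intervalIntegral.integral_of_le hR0.le]
      rw [intervalIntegral.integral_sub (by simp) (by simp)]
      simp
      ring
    rw [h4]
    convert h.2 using 1
    · funext k
      congr 1
      have h1 := one_add_mul_I_ne_zero t
      have h2 : (k : ℂ) + 1 ≠ 0 := Nat.cast_add_one_ne_zero k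
      simp only [hpow]
      rw [integral_const_mul, ← integral_Ioc_eq_integral_Ioo,
        ← intervalIntegral.integral_of_le hR0.le, integral_exp_mul_complex (mul_ne_zero h2 h1)]
      simp only [Complex.ofReal_zero, mul_zero, Complex.exp_zero]
      field_simp
    · ring
  · intro r hr
    rw [hwn, Real.exp_lt_one_iff]; linarith [hr.2]
  · intro k
    exact ((hwc.pow (k + 1)).integrableOn_Icc (a := 0) (b := R)).mono_set Set.Ioo_subset_Icc_self
  · intro k
    have hk : (0 : ℝ) < (k : ℝ) + 1 := by positivity
    have h1 : ∀ r : ℝ, ‖w r‖ ^ (k + 1) =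
        Real.exp (-(((k : ℝ) + 1) * R)) * Real.exp (((k : ℝ) + 1) * r) := by
      intro r
      rw [hwn, ← Real.exp_nat_mul, ← Real.exp_add]
      congr 1; push_cast; ring
    simp only [h1]
    rw [integral_const_mul, ← integral_Ioc_eq_integral_Ioo,
      ← intervalIntegral.integral_of_le hR0.le]
    have h5 : ∫ r in (0 : ℝ)..R, Real.exp (((k : ℝ) + 1) * r) =
        (Real.exp (((k : ℝ) + 1) * R) - 1) / ((k : ℝ) + 1) := by
      rw [intervalIntegral.integral_comp_mul_left (fun x => Real.exp x) hk.ne', integral_exp]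
      simp; field_simp
    rw [h5, mul_div_assoc']
    refine div_le_div_of_nonneg_right ?_ hk.le
    rw [mul_sub, ← Real.exp_add]
    simp
    positivity

end LogSeries

/-! ### Convex corners of the logarithmic integral as a function of the ray -/

section Corner

/-- The function `2 ∑ cos(ka)/k²`. -/
def cosSeries (a : ℝ) : ℝ := ∑' k : ℕ, 2 * Real.cos ((k + 1) * a) / ((k : ℝ) + 1) ^ 2

theorem summable_inv_sq : Summable fun k : ℕ => 1 / ((k : ℝ) + 1) ^ 2 := by
  have := (summable_nat_add_iff 1).2 (Real.summable_one_div_nat_pow.2 one_lt_two)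
  simpa using this

theorem summable_cosSeries (a : ℝ) :
    Summable fun k : ℕ => 2 * Real.cos ((k + 1) * a) / ((k : ℝ) + 1) ^ 2 := by
  refine Summable.of_norm_bounded (summable_inv_sq.mul_left 2) fun k => ?_
  rw [norm_div, norm_mul, Real.norm_of_nonneg (show (0 : ℝ) ≤ ((k : ℝ) + 1) ^ 2 by positivity),
    mul_one_div]
  refine div_le_div_of_nonneg_right ?_ (by positivity)
  have := Real.abs_cos_le_one ((k + 1) * a)
  rw [Real.norm_eq_abs, Real.norm_eq_abs, abs_two]
  linarith

theorem cosSeries_neg (a : ℝ) : cosSeries (-a) = cosSeries a := by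
  unfold cosSeries
  simp

theorem cosSeries_add_int_mul (a : ℝ) (n : ℤ) :
    cosSeries (a + n * (2 * Real.pi)) = cosSeries a := by
  unfold cosSeries
  refine tsum_congr fun k => ?_
  have h : ((k : ℝ) + 1) * (a + n * (2 * Real.pi)) =
      (k + 1) * a + (((k + 1 : ℤ) * n : ℤ) : ℝ) * (2 * Real.pi) := by push_cast; ring
  rw [h, Real.cos_add_int_mul_two_pi]

/-- The Fourier series of the second Bernoulli polynomial. Under periodic even continuation the
linear term −πa produces a corner at each multiple of 2π. -/
theorem cosSeries_eq {a : ℝ} (h0 : 0 ≤ a) (h1 : a ≤ 2 * Real.pi) :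
    cosSeries a = Real.pi ^ 2 / 3 - Real.pi * a + a ^ 2 / 2 := by
  have hpi := Real.pi_pos
  have h := hasSum_one_div_nat_pow_mul_cos one_ne_zero (x := a / (2 * Real.pi))
    ⟨by positivity, by rw [div_le_one (by positivity)]; exact h1⟩
  have h2 := ((hasSum_nat_add_iff' 1).2 h).mul_left 2
  have h3 := h2.tsum_eq
  rw [cosSeries]
  convert h3 using 1
  · refine tsum_congr fun k => ?_
    have : 2 * Real.pi * ((k + 1 : ℕ) : ℝ) * (a / (2 * Real.pi)) = (k + 1) * a := by
      push_cast; field_simp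
    rw [this]
    push_cast
    ring
  · have hB := bernoulliFun_two (a / (2 * Real.pi))
    rw [bernoulliFun] at hB
    simp only [mul_one]
    rw [hB]
    simp
    field_simp
    ring

/-- The second difference of `cosSeries` at small scales. -/
theorem cosSeries_second_difference (a : ℝ) : ∃ u0 : ℝ, 0 < u0 ∧
    (∀ u, 0 ≤ u → u < u0 → cosSeries (a + u) + cosSeries (a - u) - 2 * cosSeries a ≤ u ^ 2) ∧
    ((∃ n : ℤ, a = n * (2 * Real.pi)) → ∀ u, 0 ≤ u → u < u0 →
      cosSeries (a + u) + cosSeries (a - u) - 2 * cosSeries a = u ^ 2 - 2 * Real.pi * u) := by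
  have hpi := Real.pi_pos
  have key : ∀ n : ℤ, a = n * (2 * Real.pi) → ∀ u, 0 ≤ u → u < 2 * Real.pi →
      cosSeries (a + u) + cosSeries (a - u) - 2 * cosSeries a = u ^ 2 - 2 * Real.pi * u := by
    intro n hn u h0 h1
    have e1 : cosSeries (a + u) = cosSeries u := by
      rw [hn, add_comm, cosSeries_add_int_mul]
    have e2 : cosSeries (a - u) = cosSeries u := by
      rw [hn, sub_eq_add_neg, add_comm, cosSeries_add_int_mul, cosSeries_neg]
    have e3 : cosSeries a = cosSeries 0 := by
      rw [hn, ← zero_add ((n : ℝ) * (2 * Real.pi)), cosSeries_add_int_mul]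
    rw [e1, e2, e3, cosSeries_eq h0 h1.le, cosSeries_eq le_rfl (by positivity)]
    ring
  by_cases hn : ∃ n : ℤ, a = n * (2 * Real.pi)
  · obtain ⟨n, hn⟩ := hn
    refine ⟨2 * Real.pi, by positivity, fun u h0 h1 => ?_, fun _ => key n hn⟩
    rw [key n hn u h0 h1]
    nlinarith
  · set n := ⌊a / (2 * Real.pi)⌋
    set a' := a - n * (2 * Real.pi) with ha'
    have h1 : 0 ≤ a' := by
      have := Int.floor_le (a / (2 * Real.pi))
      rw [le_div_iff₀ (by positivity)] at this
      linarith
    have h2 : a' < 2 * Real.pi := by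
      have := Int.lt_floor_add_one (a / (2 * Real.pi))
      rw [div_lt_iff₀ (by positivity)] at this
      linarith
    have h3 : a' ≠ 0 := fun h => hn ⟨n, by linarith⟩
    have h4 : 0 < a' := lt_of_le_of_ne h1 h3.symm
    -- Within this distance a' ± u stay in [0, 2π], where one quadratic polynomial represents the
    -- series.
    refine ⟨min a' (2 * Real.pi - a'), lt_min h4 (by linarith), fun u h0 hu => ?_,
      fun h => absurd h hn⟩
    have hu1 := hu.trans_le (min_le_left _ _)
    have hu2 := hu.trans_le (min_le_right _ _)
    have e : ∀ v, cosSeries (a + v) = cosSeries (a' + v) := by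
      intro v
      rw [← cosSeries_add_int_mul (a' + v) n]
      congr 1; rw [ha']; ring
    have e0 := e 0
    rw [add_zero, add_zero] at e0
    rw [sub_eq_add_neg a u, e u, e (-u), e0, cosSeries_eq h1 h2.le,
      cosSeries_eq (by linarith) (by linarith), cosSeries_eq (by linarith) (by linarith)]
    apply le_of_eq; ring

/-- `(1 + t²)` times the logarithmic integral of one factor. -/
def rayEll (b : ℂ) (t : ℝ) : ℝ :=
  (1 + t ^ 2) * ∫ r in Set.Ioi (0 : ℝ), Real.log ‖rayFactor b t r‖

theorem re_div_ray (w : ℂ) (t : ℝ) :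
    (1 + t ^ 2) * (w / (1 + t * Complex.I)).re = w.re + t * w.im := by
  have h : w / (1 + t * Complex.I) = w * (1 - t * Complex.I) / ((1 + t ^ 2 : ℝ) : ℂ) := by
    have h1 := one_add_mul_I_ne_zero t
    have h2 : ((1 + t ^ 2 : ℝ) : ℂ) ≠ 0 := by
      rw [Complex.ofReal_ne_zero]; positivity
    rw [div_eq_div_iff h1 h2]
    push_cast
    linear_combination w * t ^ 2 * Complex.I_sq
  rw [h, Complex.div_ofReal_re]
  have : (1 + t ^ 2 : ℝ) ≠ 0 := by positivity
  field_simp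
  simp [mul_comm]

/-- The integral is −Re(D/(1+it)) with D the dilogarithm series at b, and multiplication by 1 + t²
makes this affine in t. -/
theorem rayEll_affine {b : ℂ} (hb : ‖b‖ ≤ 1) : ∃ α β : ℝ, ∀ t, rayEll b t = α + β * t := by
  have hs : Summable fun k : ℕ => b ^ (k + 1) / ((k : ℂ) + 1) ^ 2 := by
    refine Summable.of_norm_bounded summable_inv_sq fun k => ?_
    rw [norm_div, norm_pow, norm_pow]
    have : ‖(k : ℂ) + 1‖ = (k : ℝ) + 1 := by
      have := Complex.norm_natCast (k + 1)
      push_cast at this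
      exact this
    rw [this]
    exact div_le_div_of_nonneg_right (pow_le_one₀ (norm_nonneg _) hb) (by positivity)
  set D := ∑' k : ℕ, b ^ (k + 1) / ((k : ℂ) + 1) ^ 2
  refine ⟨-D.re, -D.im, fun t => ?_⟩
  have h := (integral_log_rayFactor_Ioi (R := 0) (by simpa using hb) t).2
  have h2 := Complex.hasSum_re (hs.hasSum.div_const (1 + t * Complex.I))
  have h3 : (fun k : ℕ => (b ^ (k + 1) / ((k : ℂ) + 1) ^ 2 / (1 + t * Complex.I)).re) =
      (fun k : ℕ => (b ^ (k + 1) * Complex.exp (-((k + 1) * (1 + t * Complex.I)) * (0 : ℝ)) /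
        ((k + 1) ^ 2 * (1 + t * Complex.I))).re) := by
    funext k
    simp [div_div]
  rw [h3] at h2
  have h4 := h.unique h2
  have h5 := re_div_ray D t
  rw [rayEll]
  rw [← h4] at h5
  linarith

/-- The logarithmic series below and above r = R = log|b| contribute, at the splitting point,
e^{-ikθ} and e^{ikθ} with θ = arg b − Rt, which combine to 2cos(kθ). The lower end r = 0 contributes
only the affine part. -/
theorem rayEll_eq {b : ℂ} (hb : 1 < ‖b‖) : ∃ α β : ℝ, ∀ t, rayEll b t = α + β * t +
    t ^ 2 * Real.log ‖b‖ ^ 2 / 2 - cosSeries (b.arg - Real.log ‖b‖ * t) := by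
  set R := Real.log ‖b‖ with hR
  have hb0 : b ≠ 0 := by rintro rfl; simp at hb; linarith
  have hbn : ‖b‖ = Real.exp R := by rw [hR, Real.exp_log (by linarith)]
  have hs : Summable fun k : ℕ => (b ^ (k + 1))⁻¹ / ((k : ℂ) + 1) ^ 2 := by
    refine Summable.of_norm_bounded summable_inv_sq fun k => ?_
    rw [norm_div, norm_inv, norm_pow, norm_pow]
    have : ‖(k : ℂ) + 1‖ = (k : ℝ) + 1 := by
      have := Complex.norm_natCast (k + 1)
      push_cast at this
      exact this
    rw [this]
    exact div_le_div_of_nonneg_right (inv_le_one_of_one_le₀ (one_le_pow₀ hb.le)) (by positivity)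
  set D := ∑' k : ℕ, (b ^ (k + 1))⁻¹ / ((k : ℂ) + 1) ^ 2
  refine ⟨R ^ 2 / 2 + D.re, D.im, fun t => ?_⟩
  have hz := one_add_mul_I_ne_zero t
  obtain ⟨i1, h1⟩ := integral_log_rayFactor_Ioo hb t
  obtain ⟨i2, h2⟩ := integral_log_rayFactor_Ioi hbn.le t
  rw [← hR] at h1 i1
  have hR0 : 0 ≤ R := (Real.log_pos hb).le
  have hsplit : ∫ r in Set.Ioi (0 : ℝ), Real.log ‖rayFactor b t r‖ =
      (∫ r in Set.Ioc 0 R, Real.log ‖rayFactor b t r‖) +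
      ∫ r in Set.Ioi R, Real.log ‖rayFactor b t r‖ := by
    rw [← Set.Ioc_union_Ioi_eq_Ioi hR0]
    exact setIntegral_union (Set.Ioc_disjoint_Ioi le_rfl) measurableSet_Ioi i1 i2
  have hS : HasSum (fun k : ℕ => ((2 * Real.cos ((k + 1) * (b.arg - R * t)) / ((k : ℝ) + 1) ^ 2
      : ℝ) : ℂ)) (cosSeries (b.arg - R * t) : ℝ) :=
    Complex.hasSum_ofReal.2 (summable_cosSeries _).hasSum
  have h3 := Complex.hasSum_re ((hS.sub hs.hasSum).div_const (1 + t * Complex.I))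
  have h12 := h1.add h2
  have hbe : b = Complex.exp (R + b.arg * Complex.I) := by
    rw [Complex.exp_add, ← Complex.ofReal_exp, ← hbn, Complex.norm_mul_exp_arg_mul_I]
  have hterm : (fun k : ℕ => ((((2 * Real.cos ((k + 1) * (b.arg - R * t)) / ((k : ℝ) + 1) ^ 2
      : ℝ) : ℂ) - (b ^ (k + 1))⁻¹ / ((k : ℂ) + 1) ^ 2) / (1 + t * Complex.I)).re) =
      fun k : ℕ => (((b ^ (k + 1))⁻¹ *
        (Complex.exp (((k + 1) * (1 + t * Complex.I)) * R) - 1)) /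
        ((k + 1) ^ 2 * (1 + t * Complex.I))).re +
        (b ^ (k + 1) * Complex.exp (-((k + 1) * (1 + t * Complex.I)) * R) /
        ((k + 1) ^ 2 * (1 + t * Complex.I))).re := by
    funext k
    rw [← Complex.add_re]
    congr 1
    have e1 : b ^ (k + 1) * Complex.exp (-((k + 1) * (1 + t * Complex.I)) * R) =
        Complex.exp (((k + 1) * (b.arg - R * t) : ℂ) * Complex.I) := by
      conv_lhs => rw [hbe]
      rw [← Complex.exp_nat_mul, ← Complex.exp_add]
      congr 1; push_cast; ring
    have e2 : (b ^ (k + 1))⁻¹ * Complex.exp (((k + 1) * (1 + t * Complex.I)) * R) =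
        Complex.exp (-((k + 1) * (b.arg - R * t) : ℂ) * Complex.I) := by
      conv_lhs => rw [hbe]
      rw [← Complex.exp_nat_mul, ← Complex.exp_neg, ← Complex.exp_add]
      congr 1; push_cast; ring
    rw [mul_sub ((b ^ (k + 1))⁻¹), e2, e1]
    push_cast
    rw [Complex.two_cos]
    have h2 : (k : ℂ) + 1 ≠ 0 := Nat.cast_add_one_ne_zero k
    field_simp
    ring
  rw [hterm] at h3
  have h4 := h12.unique h3
  have h5 := re_div_ray ((cosSeries (b.arg - R * t) : ℝ) - D) t
  rw [← h4] at h5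
  rw [rayEll, hsplit]
  simp only [Complex.sub_re, Complex.ofReal_re, Complex.sub_im, Complex.ofReal_im] at h5
  linarith

theorem integrableOn_log_rayFactor (b : ℂ) (t : ℝ) :
    IntegrableOn (fun r => Real.log ‖rayFactor b t r‖) (Set.Ioi 0) := by
  rcases le_or_gt ‖b‖ 1 with hb | hb
  · exact (integral_log_rayFactor_Ioi (R := 0) (by simpa using hb) t).1
  · rw [← Set.Ioc_union_Ioi_eq_Ioi (Real.log_pos hb).le]
    exact (integral_log_rayFactor_Ioo hb t).1.union
      (integral_log_rayFactor_Ioi (by rw [Real.exp_log (by linarith)]) t).1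

theorem eq_log_of_rayFactor_eq_zero {b : ℂ} {t r : ℝ} (h : rayFactor b t r = 0) :
    r = Real.log ‖b‖ := by
  rw [rayFactor, sub_eq_zero] at h
  have h1 := congrArg norm h
  rw [norm_one, norm_ray, Real.exp_neg] at h1
  have h2 : ‖b‖ = Real.exp r := by
    have := Real.exp_pos r
    field_simp at h1
    linarith
  rw [h2, Real.log_exp]

/-- `rayEll` is locally midpoint convex, with a corner on the rays through a zero. -/
theorem rayEll_second_difference (b : ℂ) (t : ℝ) : ∃ κ s0 : ℝ, 0 ≤ κ ∧ 0 < s0 ∧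
    ((∃ r : ℝ, 0 < r ∧ rayFactor b t r = 0) → 0 < κ) ∧
    ∀ s, 0 < s → s < s0 → κ * s ≤ rayEll b (t + s) + rayEll b (t - s) - 2 * rayEll b t := by
  rcases le_or_gt ‖b‖ 1 with hb | hb
  · obtain ⟨α, β, h⟩ := rayEll_affine hb
    refine ⟨0, 1, le_rfl, one_pos, ?_, fun s _ _ => ?_⟩
    · rintro ⟨r, hr, hr0⟩
      rw [eq_log_of_rayFactor_eq_zero hr0] at hr
      exact absurd (Real.log_nonpos (norm_nonneg _) hb) (not_le.2 hr)
    · rw [h, h, h]; apply le_of_eq; ring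
  · obtain ⟨α, β, h⟩ := rayEll_eq hb
    set R := Real.log ‖b‖ with hR
    have hR0 : 0 < R := Real.log_pos hb
    obtain ⟨u0, hu0, hu1, hu2⟩ := cosSeries_second_difference (b.arg - R * t)
    have e1 : ∀ s, b.arg - R * (t + s) = b.arg - R * t - R * s := fun s => by ring
    have e2 : ∀ s, b.arg - R * (t - s) = b.arg - R * t + R * s := fun s => by ring
    have hlt : ∀ s, s < u0 / R → R * s < u0 := fun s hs => by
      rw [lt_div_iff₀ hR0] at hs; linarith
    by_cases hn : ∃ n : ℤ, b.arg - R * t = n * (2 * Real.pi)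
    -- The quadratic term t²R²/2 contributes R²s², cancelling the smooth part of the second
    -- difference of the cosine series; only the corner 2πRs is left.
    · refine ⟨2 * Real.pi * R, u0 / R, by positivity, by positivity, fun _ => by positivity,
        fun s h0 h1 => ?_⟩
      have := hu2 hn (R * s) (by positivity) (hlt s h1)
      rw [h, h, h, e1, e2]
      nlinarith
    · refine ⟨0, u0 / R, le_rfl, by positivity, ?_, fun s h0 h1 => ?_⟩
      · rintro ⟨r, hr, hr0⟩
        refine absurd ?_ hn
        have hrR := eq_log_of_rayFactor_eq_zero hr0
        rw [rayFactor, sub_eq_zero, hrR, ← hR] at hr0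
        have hbe : b = Complex.exp (R + b.arg * Complex.I) := by
          rw [Complex.exp_add, ← Complex.ofReal_exp, hR, Real.exp_log (by linarith),
            Complex.norm_mul_exp_arg_mul_I]
        have h3 : Complex.exp (((b.arg - R * t : ℝ) : ℂ) * Complex.I) = 1 := by
          rw [hr0]
          conv_rhs => rw [hbe, ← Complex.exp_add]
          congr 1
          push_cast
          ring
        obtain ⟨n, hn⟩ := Complex.exp_eq_one_iff.1 h3
        refine ⟨n, ?_⟩
        have h4 : ((b.arg - R * t : ℝ) : ℂ) = ((n * (2 * Real.pi) : ℝ) : ℂ) := by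
          apply mul_right_cancel₀ Complex.I_ne_zero
          rw [hn]; push_cast; ring
        exact_mod_cast h4
      · have := hu1 (R * s) (by positivity) (hlt s h1)
        rw [h, h, h, e1, e2]
        nlinarith

end Corner

/-! ### From factors to P: a strict bound on all rays -/

section RayIntegral

/-- The properties of a function `f t r` along rays used for its logarithmic integrals. -/
structure RayRegular (f : ℝ → ℝ → ℂ) : Prop where
  integrable : ∀ t, IntegrableOn (fun r => Real.log ‖f t r‖) (Set.Ioi 0)
  ae_ne : ∀ t, ∀ᵐ r ∂(volume.restrict (Set.Ioi (0 : ℝ))), f t r ≠ 0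
  eventually_ne : ∀ t, ∀ᶠ s in 𝓝[≠] t, ∀ r : ℝ, 0 < r → f s r ≠ 0
  second_difference : ∀ t, ∃ κ : ℝ, 0 ≤ κ ∧ ((∃ r : ℝ, 0 < r ∧ f t r = 0) → 0 < κ) ∧
    ∀ᶠ s in 𝓝[>] (0 : ℝ), κ * s ≤
      (1 + (t + s) ^ 2) * (∫ r in Set.Ioi (0 : ℝ), Real.log ‖f (t + s) r‖) +
      (1 + (t - s) ^ 2) * (∫ r in Set.Ioi (0 : ℝ), Real.log ‖f (t - s) r‖) -
      2 * ((1 + t ^ 2) * ∫ r in Set.Ioi (0 : ℝ), Real.log ‖f t r‖)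

theorem RayRegular.one : RayRegular fun _ _ => 1 where
  integrable t := by simp
  ae_ne t := by simp
  eventually_ne t := by simp
  second_difference t := by
    refine ⟨0, le_rfl, ?_, ?_⟩
    · rintro ⟨r, -, h⟩; simp at h
    · simp

/-- The logarithms of the moduli add almost everywhere, hence so do the integrals and the corner
constants κ; nonnegative constants cannot cancel a positive corner. -/
theorem RayRegular.mul {f g : ℝ → ℝ → ℂ} (hf : RayRegular f) (hg : RayRegular g) :
    RayRegular fun t r => f t r * g t r := by
  have hlog : ∀ t, (fun r => Real.log ‖f t r * g t r‖) =ᵐ[volume.restrict (Set.Ioi (0 : ℝ))]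
      fun r => Real.log ‖f t r‖ + Real.log ‖g t r‖ := by
    intro t
    filter_upwards [hf.ae_ne t, hg.ae_ne t] with r h1 h2
    rw [norm_mul, Real.log_mul (norm_ne_zero_iff.2 h1) (norm_ne_zero_iff.2 h2)]
  have hI : ∀ t, ∫ r in Set.Ioi (0 : ℝ), Real.log ‖f t r * g t r‖ =
      (∫ r in Set.Ioi (0 : ℝ), Real.log ‖f t r‖) + ∫ r in Set.Ioi (0 : ℝ), Real.log ‖g t r‖ := by
    intro t
    rw [integral_congr_ae (hlog t), integral_add (hf.integrable t) (hg.integrable t)]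
  refine ⟨fun t => ?_, fun t => ?_, fun t => ?_, fun t => ?_⟩
  · exact ((hf.integrable t).add (hg.integrable t)).congr (hlog t).symm
  · filter_upwards [hf.ae_ne t, hg.ae_ne t] with r h1 h2
    exact mul_ne_zero h1 h2
  · filter_upwards [hf.eventually_ne t, hg.eventually_ne t] with s h1 h2 r hr
    exact mul_ne_zero (h1 r hr) (h2 r hr)
  · obtain ⟨κ, h1, h2, h3⟩ := hf.second_difference t
    obtain ⟨κ', h1', h2', h3'⟩ := hg.second_difference t
    refine ⟨κ + κ', add_nonneg h1 h1', ?_, ?_⟩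
    · rintro ⟨r, hr, h⟩
      rcases mul_eq_zero.1 h with h | h
      · linarith [h2 ⟨r, hr, h⟩]
      · linarith [h2' ⟨r, hr, h⟩]
    · filter_upwards [h3, h3'] with s h4 h5
      rw [hI, hI, hI]
      linarith

/-- A zero can only occur at r = log|b|, and when |b| > 1 the factor has nonzero t-derivative there,
so rays through a zero are isolated. -/
theorem RayRegular.rayFactor (b : ℂ) : RayRegular (rayFactor b) where
  integrable := integrableOn_log_rayFactor b
  ae_ne t := by
    have h : ∀ᵐ r ∂(volume : Measure ℝ), r ≠ Real.log ‖b‖ := by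
      simp [ae_iff]
    filter_upwards [ae_restrict_of_ae h] with r hr h0
    exact hr (eq_log_of_rayFactor_eq_zero h0)
  eventually_ne t := by
    rcases le_or_gt ‖b‖ 1 with hb | hb
    · refine Eventually.of_forall fun s r hr h => ?_
      rw [eq_log_of_rayFactor_eq_zero h] at hr
      exact absurd (Real.log_nonpos (norm_nonneg _) hb) (not_le.2 hr)
    · have hb0 : b ≠ 0 := by rintro rfl; simp at hb; linarith
      have hd := ((hasDerivAt_exp_ray_left t (Real.log ‖b‖)).const_mul b).const_sub 1
      have hR : ((Real.log ‖b‖ : ℝ) : ℂ) ≠ 0 := by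
        exact_mod_cast (Real.log_pos hb).ne'
      filter_upwards [hd.eventually_ne (c := 0) (by
        simp [hb0, hR, Complex.exp_ne_zero])] with s hs r hr h
      rw [eq_log_of_rayFactor_eq_zero h] at h
      exact hs h
  second_difference t := by
    obtain ⟨κ, s0, h1, h2, h3, h4⟩ := rayEll_second_difference b t
    refine ⟨κ, h1, h3, ?_⟩
    filter_upwards [self_mem_nhdsWithin, mem_nhdsWithin_of_mem_nhds (Iio_mem_nhds h2)] with s hs hs'
    exact h4 s hs hs'

theorem eval_eq_prod_one_sub {p : Polynomial ℂ} (h0 : p.eval 0 = 1) (x : ℂ) :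
    p.eval x = (p.roots.map fun a => 1 - a⁻¹ * x).prod := by
  have hs := IsAlgClosed.splits p
  have h1 := hs.eval_eq_prod_roots x
  have h2 := hs.eval_eq_prod_roots 0
  rw [h0] at h2
  have hne : ∀ a ∈ p.roots, a ≠ 0 := by
    rintro a ha rfl
    rw [Polynomial.isRoot_of_mem_roots ha] at h0
    exact zero_ne_one h0
  have h3 : (p.roots.map fun a => x - a) =
      p.roots.map fun a => (0 - a) * (1 - a⁻¹ * x) := by
    refine Multiset.map_congr rfl fun a ha => ?_
    have := hne a ha
    field_simp
    ring
  rw [h1, h3, Multiset.prod_map_mul, ← mul_assoc, ← h2, one_mul]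

/-- P(0) = 1 makes P a product of factors 1 − x/a over its complex roots, with no leading constant.
-/
theorem rayRegular_rayVal {P : Polynomial ℝ} (h0 : P.eval 0 = 1) : RayRegular (rayVal P) := by
  have h0' : (P.map (algebraMap ℝ ℂ)).eval 0 = 1 := by
    have := eval_map_ofReal P 0
    rw [h0] at this
    simpa using this
  have h : rayVal P = fun t r =>
      ((P.map (algebraMap ℝ ℂ)).roots.map fun a => rayFactor a⁻¹ t r).prod := by
    funext t r
    rw [rayVal, eval_eq_prod_one_sub h0']
    rfl
  rw [h]
  induction (P.map (algebraMap ℝ ℂ)).roots using Multiset.induction_on with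
  | empty => simpa using RayRegular.one
  | cons a s ih =>
    simp only [Multiset.map_cons, Multiset.prod_cons]
    exact (RayRegular.rayFactor a⁻¹).mul ih

theorem logIntegral_eq (P : Polynomial ℝ) :
    logIntegral P = ∫ r in Set.Ioi (0 : ℝ), Real.log ‖rayVal P 0 r‖ := by
  rw [logIntegral]
  refine integral_congr_ae (Eventually.of_forall fun r => ?_)
  simp only [rayVal_zero_left, Complex.norm_real, Real.norm_eq_abs, Real.log_abs]

theorem integrableOn_log_eval {P : Polynomial ℝ} (h0 : P.eval 0 = 1) :
    IntegrableOn (fun x : ℝ => Real.log (P.eval (Real.exp (-x)))) (Set.Ioi 0) := by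
  refine ((rayRegular_rayVal h0).integrable 0).congr (Eventually.of_forall fun r => ?_)
  simp only [rayVal_zero_left, Complex.norm_real, Real.norm_eq_abs, Real.log_abs]

/-- A strict bound for the logarithmic integrals on all rays follows from one on the rays
free of zeros. -/
theorem integral_log_rayVal_lt {P : Polynomial ℝ} (h0 : P.eval 0 = 1) (h1 : P.eval 1 ≠ 0) {C : ℝ}
    (hlt : ∀ t, t ≠ 0 → (∀ r : ℝ, 0 ≤ r → rayVal P t r ≠ 0) →
      ∫ r in Set.Ioi (0 : ℝ), Real.log ‖rayVal P t r‖ < C) {t : ℝ} (ht : t ≠ 0) :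
    ∫ r in Set.Ioi (0 : ℝ), Real.log ‖rayVal P t r‖ < C := by
  have hreg := rayRegular_rayVal h0
  have hzero : ∀ t, rayVal P t 0 ≠ 0 := fun t => by
    rw [rayVal_zero_right]; exact_mod_cast h1
  by_cases hfree : ∀ r : ℝ, 0 ≤ r → rayVal P t r ≠ 0
  · exact hlt t ht hfree
  · push Not at hfree
    obtain ⟨r, hr, hr0⟩ := hfree
    have hrpos : 0 < r := lt_of_le_of_ne hr fun h => hzero t (by rwa [← h] at hr0)
    obtain ⟨κ, -, hκ, hsd⟩ := hreg.second_difference t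
    have hκ := hκ ⟨r, hrpos, hr0⟩
    by_contra! hcon
    -- Rays sufficiently near t are zero-free and different from the real axis, so the hypothesis
    -- applies to them.
    have hev : ∀ᶠ s in 𝓝[≠] t, ∫ r in Set.Ioi (0 : ℝ), Real.log ‖rayVal P s r‖ < C := by
      filter_upwards [hreg.eventually_ne t,
        mem_nhdsWithin_of_mem_nhds (isOpen_ne.mem_nhds ht)] with s hs hs0
      refine hlt s hs0 fun r hr => ?_
      rcases hr.eq_or_lt with h | h
      · rw [← h]; exact hzero s
      · exact hs r h
    have hp : Tendsto (fun s : ℝ => t + s) (𝓝[>] 0) (𝓝[≠] t) := by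
      refine tendsto_nhdsWithin_iff.2 ⟨?_, ?_⟩
      · have : Tendsto (fun s : ℝ => t + s) (𝓝 0) (𝓝 (t + 0)) := tendsto_const_nhds.add tendsto_id
        rw [add_zero] at this
        exact this.mono_left nhdsWithin_le_nhds
      · filter_upwards [self_mem_nhdsWithin] with s hs
        have hs : (0 : ℝ) < s := hs
        simp [hs.ne']
    have hm : Tendsto (fun s : ℝ => t - s) (𝓝[>] 0) (𝓝[≠] t) := by
      refine tendsto_nhdsWithin_iff.2 ⟨?_, ?_⟩
      · have : Tendsto (fun s : ℝ => t - s) (𝓝 0) (𝓝 (t - 0)) := tendsto_const_nhds.sub tendsto_id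
        rw [sub_zero] at this
        exact this.mono_left nhdsWithin_le_nhds
      · filter_upwards [self_mem_nhdsWithin] with s hs
        have hs : (0 : ℝ) < s := hs
        simp [hs.ne']
    -- If V(t) ≥ C and V(t ± s) < C, the second difference of (1+t²)V is below that of C(1+t²),
    -- which is 2Cs²; the corner makes it at least κs.
    have hsmall : ∀ᶠ s : ℝ in 𝓝[>] 0, 2 * C * s < κ := by
      have : Tendsto (fun s : ℝ => 2 * C * s) (𝓝 0) (𝓝 (2 * C * 0)) :=
        tendsto_const_nhds.mul tendsto_id
      rw [mul_zero] at this
      exact (this.mono_left nhdsWithin_le_nhds).eventually (gt_mem_nhds hκ)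
    obtain ⟨s, h2, h3, h4, h5, hs⟩ := (hsd.and ((hp.eventually hev).and ((hm.eventually hev).and
      (hsmall.and (eventually_mem_nhdsWithin (a := (0 : ℝ)) (s := Set.Ioi 0)))))).exists
    have hs : (0 : ℝ) < s := hs
    have e1 := mul_le_mul_of_nonneg_left h3.le (show 0 ≤ 1 + (t + s) ^ 2 by positivity)
    have e2 := mul_le_mul_of_nonneg_left h4.le (show 0 ≤ 1 + (t - s) ^ 2 by positivity)
    have e3 := mul_le_mul_of_nonneg_left hcon (show 0 ≤ 1 + t ^ 2 by positivity)
    have e4 := mul_lt_mul_of_pos_right h5 hs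
    nlinarith

end RayIntegral

/-! ### The Fejér kernel and its Fourier transform -/

section FejerKernel

/-- The Fejér kernel, with Fourier transform supported in `[-Δ, Δ]`. -/
def fejerKernel (Δ u : ℝ) : ℝ := 2 * (1 - Real.cos (Δ * u)) / (Δ * u ^ 2)

theorem fejerKernel_nonneg {Δ : ℝ} (hΔ : 0 < Δ) (u : ℝ) : 0 ≤ fejerKernel Δ u := by
  have := Real.cos_le_one (Δ * u)
  exact div_nonneg (by linarith) (by positivity)

theorem fejerKernel_le {Δ : ℝ} (hΔ : 0 < Δ) (u : ℝ) : fejerKernel Δ u ≤ Δ := by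
  rcases eq_or_ne u 0 with rfl | hu
  · simp [fejerKernel, hΔ.le]
  · have hu2 : 0 < u ^ 2 := by positivity
    rw [fejerKernel, div_le_iff₀ (by positivity)]
    have := Real.one_sub_sq_div_two_le_cos (x := Δ * u)
    nlinarith

theorem fejerKernel_eq_scale {Δ : ℝ} (hΔ : 0 < Δ) (u : ℝ) :
    fejerKernel Δ u = Δ * fejerKernel 1 (Δ * u) := by
  rcases eq_or_ne u 0 with rfl | hu
  · simp [fejerKernel]
  · rw [fejerKernel, fejerKernel]
    field_simp

theorem measurable_fejerKernel (Δ : ℝ) : Measurable (fejerKernel Δ) := by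
  unfold fejerKernel
  fun_prop

/-- Jordan's inequality sin(u/2) ≥ u/π. The point u = 0 is excluded because division by zero gives
the kernel the value 0 there. -/
theorem le_fejerKernel_one {u : ℝ} (h0 : 0 < u) (h1 : u ≤ 1) :
    4 / Real.pi ^ 2 ≤ fejerKernel 1 u := by
  have hpi := Real.pi_pos
  have hpi3 := Real.pi_gt_three
  have h2 : 1 - Real.cos u = 2 * Real.sin (u / 2) ^ 2 := by
    have := Real.cos_sq' (u / 2)
    have h3 := Real.cos_sq (u / 2)
    rw [mul_div_cancel₀ u two_ne_zero] at h3
    linarith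
  have h4 := Real.mul_le_sin (x := u / 2) (by linarith) (by linarith)
  have h5 : u / Real.pi ≤ Real.sin (u / 2) := by
    refine le_trans (le_of_eq ?_) h4
    field_simp
  have h6 : (u / Real.pi) ^ 2 ≤ Real.sin (u / 2) ^ 2 := pow_le_pow_left₀ (by positivity) h5 2
  rw [fejerKernel, one_mul, one_mul, h2, le_div_iff₀ (by positivity)]
  calc 4 / Real.pi ^ 2 * u ^ 2 = 4 * (u / Real.pi) ^ 2 := by field_simp
    _ ≤ _ := by linarith

theorem integrable_fejerKernel_one : Integrable (fejerKernel 1) := by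
  refine (integrable_inv_one_add_sq.const_mul 8).mono'
    (measurable_fejerKernel 1).aestronglyMeasurable (Eventually.of_forall fun u => ?_)
  rw [Real.norm_of_nonneg (fejerKernel_nonneg one_pos u), ← div_eq_mul_inv]
  rcases le_or_gt (u ^ 2) 1 with hu | hu
  · refine (fejerKernel_le one_pos u).trans ?_
    rw [le_div_iff₀ (by positivity)]
    linarith
  · rw [fejerKernel, one_mul, one_mul, div_le_div_iff₀ (by linarith) (by positivity)]
    have := Real.neg_one_le_cos u
    nlinarith

theorem integral_cos_tent {u : ℝ} (hu : u ≠ 0) :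
    ∫ s in (0 : ℝ)..1, (1 - s) * Real.cos (s * u) = (1 - Real.cos u) / u ^ 2 := by
  have hd : ∀ s ∈ Set.uIcc (0 : ℝ) 1, HasDerivAt
      (fun s => (1 - s) * (Real.sin (s * u) / u) - Real.cos (s * u) / u ^ 2)
      ((1 - s) * Real.cos (s * u)) s := by
    intro s _
    have h1 : HasDerivAt (fun s : ℝ => s * u) u s := by
      simpa using (hasDerivAt_id s).mul_const u
    have h2 := ((hasDerivAt_id' s).const_sub 1).mul (h1.sin.div_const u)
    have h3 := h1.cos.div_const (u ^ 2)
    refine (h2.sub h3).congr_deriv ?_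
    field_simp
    ring
  rw [intervalIntegral.integral_eq_sub_of_hasDerivAt hd
    (Continuous.intervalIntegrable (by fun_prop) _ _)]
  simp
  field_simp
  ring

/-- The tent function, the Fourier transform of the Fejér kernel. -/
theorem integral_tent_mul_exp {Δ u : ℝ} (hΔ : 0 < Δ) (hu : u ≠ 0) :
    ∫ s in (-Δ)..Δ, ((1 - |s| / Δ : ℝ) : ℂ) * Complex.exp (-(s * u * Complex.I)) =
      fejerKernel Δ u := by
  have hc : Continuous fun s : ℝ => ((1 - |s| / Δ : ℝ) : ℂ) *
      Complex.exp (-(s * u * Complex.I)) := by fun_prop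
  rw [← intervalIntegral.integral_add_adjacent_intervals (b := 0)
    (hc.intervalIntegrable _ _) (hc.intervalIntegrable _ _)]
  have h1 : ∫ s in (-Δ)..0, ((1 - |s| / Δ : ℝ) : ℂ) * Complex.exp (-(s * u * Complex.I)) =
      ∫ s in (0 : ℝ)..Δ, ((1 - |s| / Δ : ℝ) : ℂ) * Complex.exp (s * u * Complex.I) := by
    have h := intervalIntegral.integral_comp_neg (a := 0) (b := Δ) (fun s : ℝ =>
      ((1 - |s| / Δ : ℝ) : ℂ) * Complex.exp (-(s * u * Complex.I)))
    rw [neg_zero] at h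
    rw [← h]
    simp
  rw [h1, ← intervalIntegral.integral_add (Continuous.intervalIntegrable (by fun_prop) _ _)
    (hc.intervalIntegrable _ _)]
  have h2 : ∀ s ∈ Set.uIcc (0 : ℝ) Δ, ((1 - |s| / Δ : ℝ) : ℂ) * Complex.exp (s * u * Complex.I) +
      ((1 - |s| / Δ : ℝ) : ℂ) * Complex.exp (-(s * u * Complex.I)) =
      ((2 * ((1 - s / Δ) * Real.cos (s / Δ * (Δ * u))) : ℝ) : ℂ) := by
    intro s hs
    rw [Set.uIcc_of_le hΔ.le] at hs
    have e : s / Δ * (Δ * u) = s * u := by field_simp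
    rw [abs_of_nonneg hs.1, e, ← mul_add]
    push_cast
    rw [Complex.cos]
    ring_nf
  rw [intervalIntegral.integral_congr h2, intervalIntegral.integral_ofReal]
  congr 1
  rw [intervalIntegral.integral_const_mul, intervalIntegral.integral_comp_div
    (fun s => (1 - s) * Real.cos (s * (Δ * u))) hΔ.ne', zero_div, div_self hΔ.ne',
    integral_cos_tent (by positivity), fejerKernel, smul_eq_mul]
  field_simp

/-- Fourier inversion of the tent function, evaluated at the origin. -/
theorem integral_fejerKernel_one : ∫ u, fejerKernel 1 u = 2 * Real.pi := by
  have hpi := Real.pi_pos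
  set f : ℝ → ℂ := fun s => ((max (1 - |s|) 0 : ℝ) : ℂ)
  have hf : Continuous f := by fun_prop
  have hzero : ∀ s, s ∉ Set.Ioc (-1 : ℝ) 1 → f s = 0 := by
    intro s hs
    simp only [f]
    rw [max_eq_right, Complex.ofReal_zero]
    simp only [Set.mem_Ioc, not_and, not_le] at hs
    by_cases h : -1 < s
    · linarith [hs h, le_abs_self s]
    · linarith [neg_abs_le s]
  have hcs : HasCompactSupport f := by
    refine HasCompactSupport.intro (isCompact_Icc (a := (-1 : ℝ)) (b := 1)) fun s hs =>
      hzero s fun h => hs ⟨h.1.le, h.2⟩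
  have hfi : Integrable f := hf.integrable_of_hasCompactSupport hcs
  have hFT : ∀ ξ : ℝ, ξ ≠ 0 → FourierTransform.fourier f ξ =
      fejerKernel 1 (2 * Real.pi * ξ) := by
    intro ξ hξ
    rw [← integral_tent_mul_exp one_pos (show 2 * Real.pi * ξ ≠ 0 by positivity),
      Real.fourier_real_eq_integral_exp_smul,
      intervalIntegral.integral_of_le (by norm_num : (-1 : ℝ) ≤ 1),
      ← setIntegral_eq_integral_of_forall_compl_eq_zero (s := Set.Ioc (-1 : ℝ) 1)]
    · refine setIntegral_congr_fun measurableSet_Ioc fun s hs => ?_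
      simp only [f, smul_eq_mul, div_one]
      rw [max_eq_left, mul_comm]
      · congr 2
        push_cast; ring
      · have := abs_le.2 ⟨hs.1.le, hs.2⟩
        linarith
    · intro s hs
      rw [hzero s hs, smul_zero]
  have hae : FourierTransform.fourier f =ᵐ[volume] fun ξ =>
      ((fejerKernel 1 (2 * Real.pi * ξ) : ℝ) : ℂ) := by
    have h : ∀ᵐ ξ ∂(volume : Measure ℝ), ξ ≠ 0 := by simp [ae_iff]
    filter_upwards [h] with ξ hξ
    exact hFT ξ hξ
  have hFi : Integrable (FourierTransform.fourier f) :=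
    ((integrable_fejerKernel_one.comp_mul_left' (by positivity)).ofReal).congr hae.symm
  have hinv := congrFun (hf.fourierInv_fourier_eq hfi hFi) 0
  rw [Real.fourierInv_eq'] at hinv
  simp only [inner_zero_right, mul_zero, Complex.ofReal_zero, zero_mul, Complex.exp_zero,
    one_smul] at hinv
  rw [integral_congr_ae hae, integral_complex_ofReal,
    Measure.integral_comp_mul_left (fejerKernel 1) (2 * Real.pi)] at hinv
  simp only [f, abs_zero, sub_zero, smul_eq_mul] at hinv
  rw [max_eq_left zero_le_one] at hinv
  have h3 : |(2 * Real.pi)⁻¹| * ∫ u, fejerKernel 1 u = 1 := by exact_mod_cast hinv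
  rw [abs_of_pos (by positivity)] at h3
  field_simp at h3
  linarith

theorem integrable_fejerKernel {Δ : ℝ} (hΔ : 0 < Δ) : Integrable (fejerKernel Δ) := by
  have := (integrable_fejerKernel_one.comp_mul_left' hΔ.ne').const_mul Δ
  exact this.congr (Eventually.of_forall fun u => (fejerKernel_eq_scale hΔ u).symm)

theorem integral_fejerKernel {Δ : ℝ} (hΔ : 0 < Δ) : ∫ u, fejerKernel Δ u = 2 * Real.pi := by
  simp only [fejerKernel_eq_scale hΔ]
  rw [integral_const_mul, Measure.integral_comp_mul_left (fejerKernel 1) Δ,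
    integral_fejerKernel_one, smul_eq_mul, abs_of_pos (by positivity)]
  field_simp

theorem setIntegral_fejerKernel {Δ w : ℝ} (hΔ : 0 < Δ) :
    ∫ u in (-w)..w, fejerKernel Δ u = ∫ u in (-(Δ * w))..(Δ * w), fejerKernel 1 u := by
  simp only [fejerKernel_eq_scale hΔ]
  rw [intervalIntegral.integral_const_mul, intervalIntegral.integral_comp_mul_left _ hΔ.ne',
    smul_eq_mul, mul_inv_cancel_left₀ hΔ.ne', mul_neg]

theorem tendsto_integral_fejerKernel :
    Tendsto (fun x : ℝ => ∫ u in (-x)..x, fejerKernel 1 u) atTop (𝓝 (2 * Real.pi)) := by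
  rw [← integral_fejerKernel_one]
  exact intervalIntegral_tendsto_integral integrable_fejerKernel_one tendsto_neg_atTop_atBot
    tendsto_id

/-- Smoothing with the Fejér kernel, in terms of the Fourier transform. -/
theorem integral_mul_fejerKernel {h : ℝ → ℝ} (hi : Integrable h) {Δ : ℝ} (hΔ : 0 < Δ) (w : ℝ) :
    ((∫ v, h v * fejerKernel Δ (v - w) : ℝ) : ℂ) =
      ∫ s in (-Δ)..Δ, (((1 - |s| / Δ : ℝ) : ℂ) * Complex.exp (s * w * Complex.I)) *
        ∫ v, (h v : ℂ) * Complex.exp (-(s * v * Complex.I)) := by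
  have hle : -Δ ≤ Δ := by linarith
  set G : ℝ → ℝ → ℂ := fun s v => (((1 - |s| / Δ : ℝ) : ℂ) * Complex.exp (s * w * Complex.I)) *
    ((h v : ℂ) * Complex.exp (-(s * v * Complex.I))) with hG
  have hint : Integrable (Function.uncurry G) ((volume.restrict (Set.Ioc (-Δ) Δ)).prod volume) := by
    have h1 : Integrable (fun s : ℝ => (((1 - |s| / Δ : ℝ) : ℂ) *
        Complex.exp (s * w * Complex.I))) (volume.restrict (Set.Ioc (-Δ) Δ)) :=
      (Continuous.integrableOn_Icc (by fun_prop)).mono_set Set.Ioc_subset_Icc_self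
    have h2 := h1.mul_prod (hi.ofReal (𝕜 := ℂ))
    refine h2.norm.mono' ?_ (Eventually.of_forall fun p => ?_)
    · have h3 : Continuous fun p : ℝ × ℝ => Complex.exp (-(p.1 * p.2 * Complex.I)) := by fun_prop
      refine (h2.1.mul h3.aestronglyMeasurable).congr (Eventually.of_forall fun p => ?_)
      simp only [Function.uncurry, hG, Pi.mul_apply]
      rw [mul_assoc]
      rfl
    · simp only [Function.uncurry, hG, norm_mul]
      have : ‖Complex.exp (-(p.1 * p.2 * Complex.I))‖ = 1 := by
        rw [Complex.norm_exp]; simp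
      rw [this, mul_one]
      exact le_rfl
  have hswap := integral_integral_swap hint
  rw [intervalIntegral.integral_of_le hle]
  have e1 : ∀ s : ℝ, (((1 - |s| / Δ : ℝ) : ℂ) * Complex.exp (s * w * Complex.I)) *
        ∫ v, (h v : ℂ) * Complex.exp (-(s * v * Complex.I)) = ∫ v, G s v := fun s => by
    rw [hG]; simp only; rw [integral_const_mul]
  simp only [e1]
  rw [hswap, ← integral_complex_ofReal]
  refine integral_congr_ae ?_
  -- At v = w the kernel has the default value 0 instead of its limit Δ, so the tent identity holds
  -- only almost everywhere.
  have hne : ∀ᵐ v ∂(volume : Measure ℝ), v ≠ w := by simp [ae_iff]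
  filter_upwards [hne] with v hv
  rw [Complex.ofReal_mul, ← integral_tent_mul_exp hΔ (sub_ne_zero.2 hv),
    ← intervalIntegral.integral_of_le hle, ← intervalIntegral.integral_const_mul]
  refine intervalIntegral.integral_congr fun s _ => ?_
  simp only [hG]
  rw [show -(s * (v - w : ℝ) * Complex.I : ℂ) = s * w * Complex.I + -(s * v * Complex.I) by
    push_cast; ring, Complex.exp_add]
  ring

end FejerKernel

/-! ### A Wiener–Ingham argument for functions h with e^v h(v) increasing -/

section Tauberian

theorem integrable_mul_fejerKernel {h : ℝ → ℝ} (hi : Integrable h) {Δ : ℝ} (hΔ : 0 < Δ) (w : ℝ) :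
    Integrable fun v => h v * fejerKernel Δ (v - w) := by
  refine hi.mul_bdd (c := Δ)
    ((measurable_fejerKernel Δ).comp (measurable_id.sub_const w)).aestronglyMeasurable
    (Eventually.of_forall fun v => ?_)
  rw [Real.norm_of_nonneg (fejerKernel_nonneg hΔ _)]
  exact fejerKernel_le hΔ _

/-- A pointwise bound from a bound for the Fourier transform near the origin. -/
theorem le_of_integral_norm_fourier_le {h : ℝ → ℝ} (hnn : ∀ v, 0 ≤ h v) (hi : Integrable h)
    (hm : Monotone fun v => Real.exp v * h v) {B : ℝ}
    (hB : ∫ s in (-1 : ℝ)..1, ‖∫ v, (h v : ℂ) * Complex.exp (-(s * v * Complex.I))‖ ≤ B)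
    (hFi : IntervalIntegrable (fun s : ℝ => ∫ v, (h v : ℂ) * Complex.exp (-(s * v * Complex.I)))
      volume (-1) 1) (v0 : ℝ) :
    h v0 ≤ B * (Real.exp 1 * (Real.pi ^ 2 / 4)) := by
  have hpi := Real.pi_pos
  have h1 : ∫ v, h v * fejerKernel 1 (v - v0) ≤ B := by
    have h2 := integral_mul_fejerKernel hi one_pos v0
    have h3 : ‖((∫ v, h v * fejerKernel 1 (v - v0) : ℝ) : ℂ)‖ ≤ B := by
      rw [h2]
      refine (intervalIntegral.norm_integral_le_integral_norm (by norm_num)).trans (le_trans ?_ hB)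
      refine intervalIntegral.integral_mono_on (by norm_num) ?_ hFi.norm fun s hs => ?_
      · exact (hFi.continuousOn_mul (Continuous.continuousOn (by fun_prop))).norm
      · rw [norm_mul]
        refine mul_le_of_le_one_left (norm_nonneg _) ?_
        rw [norm_mul, Complex.norm_real, Complex.norm_exp]
        have h4 := abs_le.2 ⟨hs.1, hs.2⟩
        have h5 := abs_nonneg s
        simp only [div_one]
        rw [Real.norm_of_nonneg (by linarith)]
        simp
    rw [Complex.norm_real] at h3
    exact (le_abs_self _).trans h3
  -- On (v0, v0 + 1] the growth condition keeps h above e^{-1}h(v0), while the kernel is at least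
  -- 4/π².
  have h2 : Real.exp (-1) * h v0 * (4 / Real.pi ^ 2) ≤ ∫ v, h v * fejerKernel 1 (v - v0) := by
    calc Real.exp (-1) * h v0 * (4 / Real.pi ^ 2)
        = ∫ _ in Set.Ioc v0 (v0 + 1), Real.exp (-1) * h v0 * (4 / Real.pi ^ 2) := by
          rw [setIntegral_const, Real.volume_real_Ioc_of_le (by linarith)]; simp
      _ ≤ ∫ v in Set.Ioc v0 (v0 + 1), h v * fejerKernel 1 (v - v0) := by
          refine setIntegral_mono_on (integrableOn_const (by simp))
            (integrable_mul_fejerKernel hi one_pos v0).integrableOn measurableSet_Ioc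
            fun v hv => ?_
          refine mul_le_mul ?_ (le_fejerKernel_one (by linarith [hv.1]) (by linarith [hv.2]))
            (by positivity) (hnn v)
          have h3 : Real.exp v0 * h v0 ≤ Real.exp v * h v := hm hv.1.le
          have h4 : Real.exp v ≤ Real.exp 1 * Real.exp v0 := by
            rw [← Real.exp_add]; exact Real.exp_le_exp.2 (by linarith [hv.2])
          have h5 := mul_le_mul_of_nonneg_right h4 (hnn v)
          have h6 : Real.exp v0 * h v0 ≤ Real.exp v0 * (Real.exp 1 * h v) := by linarith
          have h7 := le_of_mul_le_mul_left h6 (Real.exp_pos v0)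
          rw [Real.exp_neg, inv_mul_le_iff₀ (Real.exp_pos 1)]
          exact h7
      _ ≤ ∫ v, h v * fejerKernel 1 (v - v0) :=
          setIntegral_le_integral (integrable_mul_fejerKernel hi one_pos v0)
            (Eventually.of_forall fun v => mul_nonneg (hnn v) (fejerKernel_nonneg one_pos _))
  have h3 := h2.trans h1
  rw [Real.exp_neg] at h3
  have he := Real.exp_pos 1
  calc h v0 = ((Real.exp 1)⁻¹ * h v0 * (4 / Real.pi ^ 2)) * (Real.exp 1 * (Real.pi ^ 2 / 4)) := by
        field_simp
    _ ≤ _ := mul_le_mul_of_nonneg_right h3 (by positivity)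

theorem integral_comp_sub_fejerKernel (Δ w c d : ℝ) :
    ∫ v in c..d, fejerKernel Δ (v - w) = ∫ u in (c - w)..(d - w), fejerKernel Δ u :=
  intervalIntegral.integral_comp_sub_right _ _

/-- The kernel is centred at w, to the right of 0, so that its central window (0, 2w] sees only
values h(v) ≥ e^{-2w}h(0). -/
theorem mul_integral_fejerKernel_le {h : ℝ → ℝ} (hnn : ∀ v, 0 ≤ h v) (hi : Integrable h)
    (hm : Monotone fun v => Real.exp v * h v) {Δ w : ℝ} (hΔ : 0 < Δ) (hw : 0 ≤ w) :
    Real.exp (-(2 * w)) * h 0 * ∫ u in (-(Δ * w))..(Δ * w), fejerKernel 1 u ≤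
      ∫ v, h v * fejerKernel Δ (v - w) := by
  have hk : ∫ v in Set.Ioc 0 (2 * w), fejerKernel Δ (v - w) =
      ∫ u in (-(Δ * w))..(Δ * w), fejerKernel 1 u := by
    rw [← intervalIntegral.integral_of_le (by linarith), integral_comp_sub_fejerKernel,
      ← setIntegral_fejerKernel hΔ]
    congr 1 <;> ring
  rw [← hk, ← integral_const_mul]
  calc _ ≤ ∫ v in Set.Ioc 0 (2 * w), h v * fejerKernel Δ (v - w) := by
        refine setIntegral_mono_on
          (((integrable_fejerKernel hΔ).comp_sub_right w).integrableOn.const_mul _)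
          (integrable_mul_fejerKernel hi hΔ w).integrableOn measurableSet_Ioc fun v hv => ?_
        refine mul_le_mul_of_nonneg_right ?_ (fejerKernel_nonneg hΔ _)
        have h3 : Real.exp 0 * h 0 ≤ Real.exp v * h v := hm hv.1.le
        rw [Real.exp_zero, one_mul] at h3
        rw [Real.exp_neg, inv_mul_le_iff₀ (Real.exp_pos _)]
        exact h3.trans (mul_le_mul_of_nonneg_right (Real.exp_le_exp.2 hv.2) (hnn v))
    _ ≤ _ := setIntegral_le_integral (integrable_mul_fejerKernel hi hΔ w)
        (Eventually.of_forall fun v => mul_nonneg (hnn v) (fejerKernel_nonneg hΔ _))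

/-- The mirror image: centred at −w, the window (−2w, 0] sees only values at most e^{2w}h(0), and
outside it the global bound B is paid against the tail of the kernel. -/
theorem integral_mul_fejerKernel_le {h : ℝ → ℝ} (hnn : ∀ v, 0 ≤ h v) (hi : Integrable h)
    (hm : Monotone fun v => Real.exp v * h v) {B : ℝ} (hB : ∀ v, h v ≤ B) {Δ w : ℝ} (hΔ : 0 < Δ)
    (hw : 0 ≤ w) :
    ∫ v, h v * fejerKernel Δ (v + w) ≤ Real.exp (2 * w) * h 0 * (2 * Real.pi) +
      B * (2 * Real.pi - ∫ u in (-(Δ * w))..(Δ * w), fejerKernel 1 u) := by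
  have hk : ∫ v in Set.Ioc (-(2 * w)) 0, fejerKernel Δ (v + w) =
      ∫ u in (-(Δ * w))..(Δ * w), fejerKernel 1 u := by
    rw [← intervalIntegral.integral_of_le (by linarith),
      intervalIntegral.integral_comp_add_right (fejerKernel Δ), ← setIntegral_fejerKernel hΔ]
    congr 1 <;> ring
  have hki : Integrable fun v => fejerKernel Δ (v + w) := (integrable_fejerKernel hΔ).comp_add_right w
  have hhk : Integrable fun v => h v * fejerKernel Δ (v + w) := by
    simpa using integrable_mul_fejerKernel hi hΔ (-w)
  have htot : ∫ v, fejerKernel Δ (v + w) = 2 * Real.pi := by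
    rw [integral_add_right_eq_self (fejerKernel Δ), integral_fejerKernel hΔ]
  have hsplit := integral_add_compl (measurableSet_Ioc (a := -(2 * w)) (b := (0 : ℝ))) hki
  have hsplit2 := integral_add_compl (measurableSet_Ioc (a := -(2 * w)) (b := (0 : ℝ))) hhk
  have hnk : ∀ v, 0 ≤ fejerKernel Δ (v + w) := fun v => fejerKernel_nonneg hΔ _
  have h1 : ∫ v in Set.Ioc (-(2 * w)) 0, h v * fejerKernel Δ (v + w) ≤
      Real.exp (2 * w) * h 0 * ∫ v in Set.Ioc (-(2 * w)) 0, fejerKernel Δ (v + w) := by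
    rw [← integral_const_mul]
    refine setIntegral_mono_on hhk.integrableOn (hki.integrableOn.const_mul _)
      measurableSet_Ioc fun v hv => ?_
    refine mul_le_mul_of_nonneg_right ?_ (hnk v)
    have h3 : Real.exp v * h v ≤ Real.exp 0 * h 0 := hm hv.2
    rw [Real.exp_zero, one_mul] at h3
    have h4 : h v = Real.exp (-v) * (Real.exp v * h v) := by
      rw [← mul_assoc, ← Real.exp_add]; simp
    rw [h4]
    refine mul_le_mul (Real.exp_le_exp.2 (by linarith [hv.1])) h3
      (mul_nonneg (Real.exp_pos _).le (hnn v)) (Real.exp_pos _).le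
  have h2 : ∫ v in (Set.Ioc (-(2 * w)) 0)ᶜ, h v * fejerKernel Δ (v + w) ≤
      B * ∫ v in (Set.Ioc (-(2 * w)) 0)ᶜ, fejerKernel Δ (v + w) := by
    rw [← integral_const_mul]
    exact setIntegral_mono hhk.integrableOn (hki.integrableOn.const_mul _)
      fun v => mul_le_mul_of_nonneg_right (hB v) (hnk v)
  have h3 : ∫ v in Set.Ioc (-(2 * w)) 0, fejerKernel Δ (v + w) ≤ 2 * Real.pi := by
    rw [← htot]
    exact setIntegral_le_integral hki (Eventually.of_forall hnk)
  have h4 : ∫ v in (Set.Ioc (-(2 * w)) 0)ᶜ, fejerKernel Δ (v + w) =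
      2 * Real.pi - ∫ u in (-(Δ * w))..(Δ * w), fejerKernel 1 u := by
    rw [← hk, ← htot]; linarith
  rw [h4] at h2
  have h5 := mul_le_mul_of_nonneg_left h3 (mul_nonneg (Real.exp_pos (2 * w)).le (hnn 0))
  linarith

/-- A Wiener–Ingham type theorem: if the Fourier transforms of `h i` tend to `2πδ₀` weakly and
`e^v h i v` is increasing, then `h i 0` tends to `1`. -/
theorem tendsto_one_of_fourier_tendsto {ι : Type*} {l : Filter ι} {h : ι → ℝ → ℝ}
    (hnn : ∀ᶠ i in l, ∀ v, 0 ≤ h i v) (hi : ∀ᶠ i in l, Integrable (h i))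
    (hm : ∀ᶠ i in l, Monotone fun v => Real.exp v * h i v) {F : ι → ℝ → ℂ}
    (hF : ∀ᶠ i in l, ∀ s : ℝ, F i s = ∫ v, (h i v : ℂ) * Complex.exp (-(s * v * Complex.I)))
    (hlim : ∀ Δ : ℝ, 0 < Δ → ∀ g : ℝ → ℂ, Continuous g →
      Tendsto (fun i => ∫ s in (-Δ)..Δ, g s * F i s) l (𝓝 (2 * Real.pi * g 0)))
    (hFi : ∀ᶠ i in l, IntervalIntegrable (F i) volume (-1) 1)
    {B : ℝ} (hB : ∀ᶠ i in l, ∫ s in (-1 : ℝ)..1, ‖F i s‖ ≤ B) :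
    Tendsto (fun i => h i 0) l (𝓝 1) := by
  have hpi := Real.pi_pos
  set B' := B * (Real.exp 1 * (Real.pi ^ 2 / 4))
  have hbound : ∀ᶠ i in l, ∀ v, h i v ≤ B' := by
    filter_upwards [hnn, hi, hm, hF, hB, hFi] with i h1 h2 h3 h4 h5 h6 v
    have h4' : F i = fun s : ℝ => ∫ v, (h i v : ℂ) * Complex.exp (-(s * v * Complex.I)) :=
      funext h4
    rw [h4'] at h5 h6
    exact le_of_integral_norm_fourier_le h1 h2 h3 h5 h6 v
  -- The test function is the shifted tent, which equals 1 at s = 0; hence the limit 2π, whatever Δ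
  -- and w are.
  have hJ : ∀ Δ : ℝ, 0 < Δ → ∀ w : ℝ,
      Tendsto (fun i => ∫ v, h i v * fejerKernel Δ (v - w)) l (𝓝 (2 * Real.pi)) := by
    intro Δ hΔ w
    have h1 := hlim Δ hΔ (fun s => ((1 - |s| / Δ : ℝ) : ℂ) * Complex.exp (s * w * Complex.I))
      (by fun_prop)
    simp only [abs_zero, zero_div, sub_zero, Complex.ofReal_one, Complex.ofReal_zero, zero_mul,
      Complex.exp_zero, mul_one] at h1
    have h2 : Tendsto (fun i => ((∫ v, h i v * fejerKernel Δ (v - w) : ℝ) : ℂ)) l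
        (𝓝 ((2 * Real.pi : ℝ) : ℂ)) := by
      have : ((2 * Real.pi : ℝ) : ℂ) = 2 * Real.pi := by push_cast; rfl
      rw [this]
      refine h1.congr' ?_
      filter_upwards [hi, hF] with i h3 h4
      rw [integral_mul_fejerKernel h3 hΔ w]
      refine intervalIntegral.integral_congr fun s _ => ?_
      simp only [h4]
    have h3 := (Complex.continuous_re.tendsto _).comp h2
    exact h3
  set I : ℝ → ℝ := fun x => ∫ u in (-x)..x, fejerKernel 1 u
  have hI : Tendsto I atTop (𝓝 (2 * Real.pi)) := tendsto_integral_fejerKernel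
  have hinv : Tendsto (fun x : ℝ => 2 * x⁻¹) atTop (𝓝 0) := by
    simpa using tendsto_inv_atTop_zero.const_mul (2 : ℝ)
  rw [tendsto_order]
  constructor
  · intro a ha
    -- The choice w = 1/x, Δ = x² lets the window shrink (w → 0) while Δw = x → ∞, so that it
    -- captures nearly all the mass of the kernel.
    have hl : Tendsto (fun x : ℝ => Real.exp (2 * x⁻¹) * a * (2 * Real.pi) +
        B' * (2 * Real.pi - I x)) atTop (𝓝 (Real.exp 0 * a * (2 * Real.pi) +
        B' * (2 * Real.pi - 2 * Real.pi))) :=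
      ((((Real.continuous_exp.tendsto 0).comp hinv).mul_const a).mul_const _).add
        ((tendsto_const_nhds.sub hI).const_mul B')
    have hlt : Real.exp 0 * a * (2 * Real.pi) + B' * (2 * Real.pi - 2 * Real.pi) <
        2 * Real.pi := by
      rw [Real.exp_zero]; nlinarith
    obtain ⟨x, hx, hx0⟩ := ((hl.eventually (gt_mem_nhds hlt)).and (eventually_gt_atTop 0)).exists
    have hΔ : 0 < x ^ 2 := by positivity
    filter_upwards [hnn, hi, hm, hbound, (hJ (x ^ 2) hΔ (-x⁻¹)).eventually (lt_mem_nhds hx)]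
      with i h1 h2 h3 h4 h5
    have h6 := integral_mul_fejerKernel_le h1 h2 h3 h4 hΔ (inv_pos.2 hx0).le
    simp only [sub_neg_eq_add] at h5
    have h7 : x ^ 2 * x⁻¹ = x := by field_simp
    rw [h7] at h6
    have h8 := h5.trans_le h6
    have h9 : Real.exp (2 * x⁻¹) * (2 * Real.pi) * a < Real.exp (2 * x⁻¹) * (2 * Real.pi) * h i 0 := by
      simp only [I] at h8
      linarith
    exact lt_of_mul_lt_mul_left h9 (by positivity)
  · intro a ha
    have hl : Tendsto (fun x : ℝ => Real.exp (-(2 * x⁻¹)) * a * I x) atTop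
        (𝓝 (Real.exp (-0) * a * (2 * Real.pi))) :=
      (((Real.continuous_exp.tendsto _).comp hinv.neg).mul_const a).mul hI
    have hlt : 2 * Real.pi < Real.exp (-0) * a * (2 * Real.pi) := by
      rw [neg_zero, Real.exp_zero]; nlinarith
    obtain ⟨x, hx, hx0⟩ := ((hl.eventually (lt_mem_nhds hlt)).and
      ((hI.eventually (lt_mem_nhds (show 0 < 2 * Real.pi by positivity))).and
      (eventually_gt_atTop 0))).exists
    obtain ⟨hIx, hx0⟩ := hx0
    have hΔ : 0 < x ^ 2 := by positivity
    filter_upwards [hnn, hi, hm, (hJ (x ^ 2) hΔ x⁻¹).eventually (gt_mem_nhds hx)] with i h1 h2 h3 h5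
    have h6 := mul_integral_fejerKernel_le h1 h2 h3 hΔ (inv_pos.2 hx0).le
    have h7 : x ^ 2 * x⁻¹ = x := by field_simp
    rw [h7] at h6
    have h8 := h6.trans_lt h5
    have h9 : Real.exp (-(2 * x⁻¹)) * I x * h i 0 < Real.exp (-(2 * x⁻¹)) * I x * a := by
      simp only [I] at h8 ⊢
      linarith
    exact lt_of_mul_lt_mul_left h9 (by positivity)

end Tauberian

/-! ### Logarithmic derivatives of formal products and power sums of inverse roots -/

section LogDerivative

/-- `f` has logarithmic derivative `X f' / f = -s`. -/
def HasLogSeries (f s : PowerSeries ℂ) : Prop :=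
  PowerSeries.X * PowerSeries.derivative ℂ f + f * s = 0

theorem HasLogSeries.one : HasLogSeries 1 0 := by
  simp [HasLogSeries]

theorem HasLogSeries.mul {f g s t : PowerSeries ℂ} (hf : HasLogSeries f s)
    (hg : HasLogSeries g t) : HasLogSeries (f * g) (s + t) := by
  unfold HasLogSeries at *
  rw [Derivation.leibniz]
  simp only [smul_eq_mul]
  linear_combination g * hf + f * hg

theorem HasLogSeries.multiset_prod {α : Type*} (B : Multiset α) {f s : α → PowerSeries ℂ}
    (h : ∀ b, HasLogSeries (f b) (s b)) : HasLogSeries (B.map f).prod (B.map s).sum := by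
  induction B using Multiset.induction_on with
  | empty => simpa using HasLogSeries.one
  | cons a B ih => simpa using (h a).mul ih

/-- The power sums of `B`, spread out over the multiples of `n` and multiplied by `n`. -/
def powerSumSeries (b : ℂ) (n : ℕ) : PowerSeries ℂ :=
  PowerSeries.mk fun N => if n ∣ N ∧ N ≠ 0 then n * b ^ (N / n) else 0

/-- The geometric series: −X f'/f = ∑_{k ≥ 1} n b^k X^{nk} for f = 1 − bX^n. -/
theorem hasLogSeries_one_sub (b : ℂ) {n : ℕ} (hn : 0 < n) :
    HasLogSeries (1 - PowerSeries.C b * PowerSeries.X ^ n) (powerSumSeries b n) := by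
  unfold HasLogSeries
  have hder : PowerSeries.X * PowerSeries.derivative ℂ
      (1 - PowerSeries.C b * PowerSeries.X ^ n : PowerSeries ℂ) =
      -(PowerSeries.C (n * b) * PowerSeries.X ^ n) := by
    obtain ⟨m, rfl⟩ : ∃ m, n = m + 1 := ⟨n - 1, by omega⟩
    rw [map_sub, Derivation.leibniz, Derivation.leibniz_pow]
    simp only [PowerSeries.derivative_one, PowerSeries.derivative_C, PowerSeries.derivative_X,
      smul_eq_mul, mul_one, Nat.add_sub_cancel, nsmul_eq_mul, map_mul,
      map_natCast]
    ring
  rw [hder, sub_mul, one_mul, mul_comm (PowerSeries.C b), mul_assoc]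
  ext N
  simp only [map_add, map_sub, map_neg, PowerSeries.coeff_C_mul, PowerSeries.coeff_X_pow,
    PowerSeries.coeff_X_pow_mul', powerSumSeries, PowerSeries.coeff_mk, map_zero]
  by_cases hN : n ∣ N
  · obtain ⟨k, rfl⟩ := hN
    rcases k with _ | _ | k
    · simp [hn.ne, hn.ne']
    · simp [hn.ne', Nat.div_self hn]
    · have h1 : n * (k + 1 + 1) ≠ n := by
        intro h
        have := Nat.mul_left_cancel hn (h.trans (mul_one n).symm)
        omega
      have h2 : n * (k + 1 + 1) - n = n * (k + 1) := by
        rw [mul_add n (k + 1) 1, mul_one, Nat.add_sub_cancel]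
      have h3 : n ≤ n * (k + 1 + 1) := Nat.le_mul_of_pos_right n (by omega)
      rw [if_neg h1, if_pos h3, h2, if_pos ⟨dvd_mul_right _ _, by positivity⟩,
        if_pos ⟨dvd_mul_right _ _, by positivity⟩, Nat.mul_div_cancel_left _ hn,
        Nat.mul_div_cancel_left _ hn]
      ring
  · have h1 : N ≠ n := fun h => hN (h ▸ dvd_rfl)
    rw [if_neg h1, if_neg (fun h => hN h.1)]
    by_cases h3 : n ≤ N
    · rw [if_pos h3, if_neg]
      · simp
      · rintro ⟨h4, -⟩
        exact hN ((Nat.dvd_sub_iff_left h3 dvd_rfl).1 h4)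
    · rw [if_neg h3]; simp

/-- Logarithmic derivatives are determined coefficient by coefficient. -/
theorem HasLogSeries.coeff_eq {f g s t : PowerSeries ℂ} (hf : HasLogSeries f s)
    (hg : HasLogSeries g t) (h0 : PowerSeries.constantCoeff f = 1) {M : ℕ}
    (hfg : ∀ n ≤ M, PowerSeries.coeff n f = PowerSeries.coeff n g) :
    PowerSeries.coeff M s = PowerSeries.coeff M t := by
  unfold HasLogSeries at *
  have hfd : (PowerSeries.X : PowerSeries ℂ) ^ (M + 1) ∣ f - g := by
    rw [PowerSeries.X_pow_dvd_iff]
    intro n hn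
    rw [map_sub, hfg n (by omega), sub_self]
  have hfd' : (PowerSeries.X : PowerSeries ℂ) ^ (M + 1) ∣
      PowerSeries.X * PowerSeries.derivative ℂ (f - g) := by
    rw [PowerSeries.X_pow_dvd_iff]
    intro n hn
    rcases n with _ | n
    · simp
    · rw [PowerSeries.coeff_succ_X_mul, PowerSeries.coeff_derivative, map_sub,
        hfg (n + 1) (by omega), sub_self, zero_mul]
  have h1 : f * (s - t) = -(PowerSeries.X * PowerSeries.derivative ℂ (f - g)) - (f - g) * t := by
    rw [map_sub]
    linear_combination hf - hg
  have h2 : (PowerSeries.X : PowerSeries ℂ) ^ (M + 1) ∣ f * (s - t) := by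
    rw [h1]
    exact dvd_sub (dvd_neg.2 hfd') (Dvd.dvd.mul_right hfd t)
  have hu : IsUnit f := by
    rw [PowerSeries.isUnit_iff_constantCoeff, h0]
    exact isUnit_one
  rw [hu.dvd_mul_left, PowerSeries.X_pow_dvd_iff] at h2
  have h3 := h2 M (by omega)
  rwa [map_sub, sub_eq_zero] at h3

theorem eq_multiset_prod_one_sub {p : Polynomial ℂ} (h0 : p.eval 0 = 1) :
    p = (p.roots.map fun a => 1 - Polynomial.C a⁻¹ * Polynomial.X).prod := by
  apply Polynomial.funext
  intro x
  rw [eval_eq_prod_one_sub h0, Polynomial.eval_multiset_prod, Multiset.map_map]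
  simp

/-- The power sums of the inverse roots. -/
def invPowerSum (p : Polynomial ℂ) (k : ℕ) : ℂ := (p.roots.map fun a => a⁻¹ ^ k).sum

theorem coe_expand_eq {p : Polynomial ℂ} (h0 : p.eval 0 = 1) (n : ℕ) :
    ((Polynomial.expand ℂ n p : Polynomial ℂ) : PowerSeries ℂ) =
      (p.roots.map fun a => (1 - PowerSeries.C a⁻¹ * PowerSeries.X ^ n : PowerSeries ℂ)).prod := by
  conv_lhs => rw [eq_multiset_prod_one_sub h0]
  rw [map_multiset_prod, ← Polynomial.coeToPowerSeries.ringHom_apply, map_multiset_prod,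
    Multiset.map_map, Multiset.map_map]
  congr 1
  refine Multiset.map_congr rfl fun a _ => ?_
  simp

theorem hasLogSeries_expand {p : Polynomial ℂ} (h0 : p.eval 0 = 1) {n : ℕ} (hn : 0 < n) :
    HasLogSeries (Polynomial.expand ℂ n p : Polynomial ℂ)
      (p.roots.map fun a => powerSumSeries a⁻¹ n).sum := by
  rw [coe_expand_eq h0]
  exact HasLogSeries.multiset_prod _ fun a => hasLogSeries_one_sub a⁻¹ hn

theorem coeff_sum_powerSumSeries (p : Polynomial ℂ) (n N : ℕ) :
    PowerSeries.coeff N (p.roots.map fun a => powerSumSeries a⁻¹ n).sum =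
      if n ∣ N ∧ N ≠ 0 then n * invPowerSum p (N / n) else 0 := by
  rw [map_multiset_sum, Multiset.map_map]
  simp only [Function.comp_def, powerSumSeries, PowerSeries.coeff_mk]
  split_ifs
  · rw [invPowerSum, ← Multiset.sum_map_mul_left]
  · simp

theorem hasLogSeries_eulerPartial {p : Polynomial ℂ} (h0 : p.eval 0 = 1) (M : ℕ) :
    HasLogSeries (eulerPartial p M : Polynomial ℂ)
      (∑ i ∈ Finset.range M, (p.roots.map fun a => powerSumSeries a⁻¹ (i + 1)).sum) := by
  induction M with
  | zero => simpa [eulerPartial] using HasLogSeries.one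
  | succ M ih =>
    rw [eulerPartial, Finset.prod_range_succ, Finset.sum_range_succ, ← eulerPartial,
      Polynomial.coe_mul]
    exact ih.mul (hasLogSeries_expand h0 (by omega))

theorem norm_invPowerSum_le {p : Polynomial ℂ} (hroots : ∀ a ∈ p.roots, 1 ≤ ‖a‖) (k : ℕ) :
    ‖invPowerSum p k‖ ≤ p.roots.card := by
  rw [invPowerSum]
  refine (norm_multiset_sum_le _).trans ?_
  rw [Multiset.map_map]
  have h := Multiset.sum_le_card_nsmul (p.roots.map (norm ∘ fun a => a⁻¹ ^ k)) 1 (by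
    intro x hx
    obtain ⟨a, ha, rfl⟩ := Multiset.mem_map.1 hx
    simp only [Function.comp_apply, norm_pow, norm_inv]
    exact pow_le_one₀ (by positivity) (inv_le_one_of_one_le₀ (hroots a ha)))
  simpa using h

/-- If all zeros of `p` and `F` lie outside the open unit disc, then `F` is not the infinite
product `∏ p(X^n)`, unless `p = 1`. -/
theorem eq_one_of_eulerPartial_coeff_eq {p F : Polynomial ℂ} (h0 : p.eval 0 = 1)
    (hF0 : F.eval 0 = 1) (hp : ∀ a ∈ p.roots, 1 ≤ ‖a‖) (hF : ∀ a ∈ F.roots, 1 ≤ ‖a‖)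
    (hpF : ∀ n, ∀ N ≥ n, (eulerPartial p N).coeff n = F.coeff n) : p = 1 := by
  have hp1 := hasLogSeries_expand h0 one_pos
  have hF1 := hasLogSeries_expand hF0 one_pos
  rw [Polynomial.expand_one] at hp1 hF1
  -- If all power sums vanish, the logarithmic derivative of p is zero and p is constant. Otherwise
  -- the least m with nonzero power sum is examined.
  by_cases hall : ∀ k, 0 < k → invPowerSum p k = 0
  · have hz : (p.roots.map fun a => powerSumSeries a⁻¹ 1).sum = 0 := by
      ext N
      rw [coeff_sum_powerSumSeries, map_zero]
      split_ifs with h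
      · rw [Nat.div_one, hall N (Nat.pos_of_ne_zero h.2), mul_zero]
      · rfl
    rw [hz, HasLogSeries, mul_zero, add_zero] at hp1
    have hder : PowerSeries.derivative ℂ (p : PowerSeries ℂ) = 0 :=
      (mul_eq_zero.1 hp1).resolve_left PowerSeries.X_ne_zero
    rw [PowerSeries.derivative_coe] at hder
    have hder' : Polynomial.derivative p = 0 := by exact_mod_cast hder
    have hc := Polynomial.eq_C_of_derivative_eq_zero hder'
    rw [hc, Polynomial.eval_C] at h0
    rw [hc, h0, Polynomial.C_1]
  · exfalso
    push Not at hall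
    classical
    obtain ⟨hm0, hm⟩ := Nat.find_spec hall
    have hmin : ∀ k, 0 < k → k < Nat.find hall → invPowerSum p k = 0 := by
      intro k hk hk'
      by_contra h
      exact Nat.find_min hall hk' ⟨hk, h⟩
    set m := Nat.find hall
    set d : ℝ := ((Multiset.card p.roots : ℕ) : ℝ)
    set D : ℝ := ((Multiset.card F.roots : ℕ) : ℝ)
    -- The coefficient of index N = ml is ∑_{n ∣ N} n·S(N/n), S being the power sums of p. Divisors
    -- of m contribute a bounded amount, and a divisor le with e > 1 contributes nothing because
    -- S(m/e) = 0 by minimality. What remains is l·S(m), unbounded in l, while the power sums of F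
    -- are bounded.
    have key : ∀ l : ℕ, l.Prime → m < l → l * ‖invPowerSum p m‖ ≤ D + (m + 1) * (m * d) := by
      intro l hl hml
      have hmll : 0 < m * l := Nat.mul_pos hm0 hl.pos
      have hs := (hasLogSeries_eulerPartial h0 (m * l)).coeff_eq hF1 (M := m * l) (by
          rw [Polynomial.constantCoeff_coe, hpF 0 _ (Nat.zero_le _),
            Polynomial.coeff_zero_eq_eval_zero, hF0]) (by
          intro n hn
          rw [Polynomial.coeff_coe, Polynomial.coeff_coe, hpF n _ hn])
      rw [coeff_sum_powerSumSeries, if_pos ⟨one_dvd _, hmll.ne'⟩, Nat.div_one, Nat.cast_one,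
        one_mul, map_sum] at hs
      simp only [coeff_sum_powerSumSeries] at hs
      have hli : l - 1 ∈ Finset.range (m * l) := by
        rw [Finset.mem_range]
        have : l ≤ m * l := Nat.le_mul_of_pos_left l hm0
        have := hl.pos
        omega
      rw [← Finset.add_sum_erase _ _ hli, Nat.sub_add_cancel hl.one_le,
        if_pos ⟨dvd_mul_left _ _, hmll.ne'⟩, Nat.mul_div_cancel _ hl.pos] at hs
      have hrest : ‖∑ i ∈ (Finset.range (m * l)).erase (l - 1),
          (if i + 1 ∣ m * l ∧ m * l ≠ 0 then
            ((i + 1 : ℕ) : ℂ) * invPowerSum p (m * l / (i + 1)) else 0)‖ ≤ (m + 1) * (m * d) := by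
        have hterm : ∀ i ∈ (Finset.range (m * l)).erase (l - 1),
            ‖(if i + 1 ∣ m * l ∧ m * l ≠ 0 then
              ((i + 1 : ℕ) : ℂ) * invPowerSum p (m * l / (i + 1)) else 0)‖ ≤
              if i ∈ Finset.range (m + 1) then m * d else 0 := by
          intro i hi
          have hil : i + 1 ≠ l := by
            have := (Finset.mem_erase.1 hi).1
            omega
          by_cases hd : i + 1 ∣ m * l
          · by_cases him : i + 1 ∣ m
            · have hle := Nat.le_of_dvd hm0 him
              rw [if_pos ⟨hd, hmll.ne'⟩, if_pos (Finset.mem_range.2 (by omega)), norm_mul,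
                Complex.norm_natCast]
              exact mul_le_mul (by exact_mod_cast hle) (norm_invPowerSum_le hp _)
                (norm_nonneg _) (by positivity)
            · have hldvd : l ∣ i + 1 := by
                by_contra hnd
                have hco : Nat.Coprime (i + 1) l := ((Nat.Prime.coprime_iff_not_dvd hl).2 hnd).symm
                exact him (hco.dvd_of_dvd_mul_right hd)
              obtain ⟨e, he⟩ := hldvd
              have hem : e ∣ m := by
                rw [he, mul_comm m l] at hd
                exact (Nat.mul_dvd_mul_iff_left hl.pos).1 hd
              have he1 : e ≠ 1 := by
                rintro rfl
                rw [mul_one] at he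
                exact hil he
              have he0 : 0 < e := Nat.pos_of_dvd_of_pos hem hm0
              have hdiv : m * l / (i + 1) = m / e := by
                rw [he, mul_comm m l, Nat.mul_div_mul_left _ _ hl.pos]
              have hz : invPowerSum p (m / e) = 0 :=
                hmin _ (Nat.div_pos (Nat.le_of_dvd hm0 hem) he0)
                  (Nat.div_lt_self hm0 (by omega))
              rw [hdiv, hz, mul_zero, ite_self, norm_zero]
              split_ifs <;> positivity
          · rw [if_neg (fun h => hd h.1), norm_zero]
            split_ifs <;> positivity
        refine (norm_sum_le_of_le _ hterm).trans ?_
        rw [← Finset.sum_filter, Finset.sum_const, nsmul_eq_mul]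
        refine mul_le_mul_of_nonneg_right ?_ (by positivity)
        have h5 : (((Finset.range (m * l)).erase (l - 1)).filter
            (· ∈ Finset.range (m + 1))).card ≤ (Finset.range (m + 1)).card :=
          Finset.card_le_card fun i hi => (Finset.mem_filter.1 hi).2
        rw [Finset.card_range] at h5
        exact_mod_cast h5
      have hFb := norm_invPowerSum_le hF (m * l)
      have h6 : (l : ℂ) * invPowerSum p m = invPowerSum F (m * l) -
          ∑ i ∈ (Finset.range (m * l)).erase (l - 1),
          (if i + 1 ∣ m * l ∧ m * l ≠ 0 then
            ((i + 1 : ℕ) : ℂ) * invPowerSum p (m * l / (i + 1)) else 0) := by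
        rw [← hs]; ring
      have h7 := norm_sub_le (invPowerSum F (m * l))
        (∑ i ∈ (Finset.range (m * l)).erase (l - 1),
          (if i + 1 ∣ m * l ∧ m * l ≠ 0 then
            ((i + 1 : ℕ) : ℂ) * invPowerSum p (m * l / (i + 1)) else 0))
      rw [← h6, norm_mul, Complex.norm_natCast] at h7
      linarith
    have hpos : 0 < ‖invPowerSum p m‖ := norm_pos_iff.2 hm
    obtain ⟨K, hK⟩ := exists_nat_gt ((D + (m + 1) * (m * d)) / ‖invPowerSum p m‖)
    obtain ⟨l, hl1, hl2⟩ := Nat.exists_infinite_primes (max K (m + 1))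
    have h8 := key l hl2 (lt_of_lt_of_le (Nat.lt_succ_self m) ((le_max_right _ _).trans hl1))
    rw [div_lt_iff₀ hpos] at hK
    have h9 : (K : ℝ) ≤ l := by exact_mod_cast (le_max_left _ _).trans hl1
    have h10 := mul_le_mul_of_nonneg_right h9 hpos.le
    linarith

end LogDerivative

/-! ### The infinite product is a polynomial only for P = 1 -/

section NotPolynomial

/-- |P(q^i) − 1| is at most a constant times |q|^i, so the product converges absolutely and vanishes
only if a factor does. -/
theorem eulerFun_ne_zero {P : Polynomial ℝ} (h0 : P.eval 0 = 1) {q : ℂ} (hq : ‖q‖ < 1)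
    (hne : ∀ i : ℕ, (P.map (algebraMap ℝ ℂ)).eval (q ^ (i + 1)) ≠ 0) : eulerFun P q ≠ 0 := by
  obtain ⟨A, hA, hb⟩ := exists_norm_eval_sub_one_le h0
  have hs : Summable fun i : ℕ => ‖(P.map (algebraMap ℝ ℂ)).eval (q ^ (i + 1)) - 1‖ := by
    refine Summable.of_nonneg_of_le (fun _ => norm_nonneg _) (fun i => ?_)
      (((summable_nat_add_iff 1).2
        (summable_geometric_of_lt_one (norm_nonneg q) hq)).mul_left A)
    rw [← norm_pow]
    exact hb _ (by rw [norm_pow]; exact pow_le_one₀ (norm_nonneg _) hq.le)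
  have h1 := tprod_one_add_ne_zero_of_summable
    (f := fun i : ℕ => (P.map (algebraMap ℝ ℂ)).eval (q ^ (i + 1)) - 1)
    (fun i => by simpa using hne i) hs
  have h2 := (multipliable_one_add_of_summable hs).hasProd.tendsto_prod_nat
  simp only [add_sub_cancel] at h1 h2
  rwa [tendsto_nhds_unique (tendsto_prod_eulerFun h0 hq) h2]

theorem eulerFun_eq_zero {P : Polynomial ℝ} (h0 : P.eval 0 = 1) {q : ℂ} (hq : ‖q‖ < 1) {i : ℕ}
    (hi : (P.map (algebraMap ℝ ℂ)).eval (q ^ (i + 1)) = 0) : eulerFun P q = 0 := by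
  refine tendsto_nhds_unique (tendsto_prod_eulerFun h0 hq) (tendsto_const_nhds.congr' ?_)
  filter_upwards [eventually_gt_atTop i] with N hN
  exact (Finset.prod_eq_zero (Finset.mem_range.2 hN) hi).symm

/-- The infinite product is never a polynomial, unless `P = 1`. -/
theorem eq_one_of_eventually_eulerCoeff_eq_zero {P : Polynomial ℝ} (h0 : P.eval 0 = 1)
    (hz : ∀ᶠ n : ℕ in atTop, eulerCoeff P n = 0) : P = 1 := by
  obtain ⟨n1, hn1⟩ := eventually_atTop.1 hz
  set p := P.map (algebraMap ℝ ℂ)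
  set F : Polynomial ℂ := ∑ n ∈ Finset.range n1, Polynomial.monomial n (eulerCoeff P n : ℂ)
  have hFc : ∀ n, F.coeff n = eulerCoeff P n := by
    intro n
    simp only [F, Polynomial.finsetSum_coeff, Polynomial.coeff_monomial, Finset.sum_ite_eq',
      Finset.mem_range]
    split_ifs with h
    · rfl
    · rw [hn1 n (by omega), Complex.ofReal_zero]
  have hFe : ∀ q, eulerFun P q = F.eval q := by
    intro q
    rw [eulerFun, tsum_eq_sum (s := Finset.range n1)]
    · simp [F, Polynomial.eval_finsetSum, Polynomial.eval_monomial]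
    · intro n hn
      rw [hn1 n (by simpa using hn)]; simp
  have hp0 : p.eval 0 = 1 := by
    have := eval_map_ofReal P 0
    rwa [h0, Complex.ofReal_zero, Complex.ofReal_one] at this
  have hpart : ∀ n, ∀ N ≥ n, (eulerPartial p N).coeff n = F.coeff n := by
    intro n N hN
    have : eulerPartial p N = (eulerPartial P N).map (algebraMap ℝ ℂ) := by
      simp [eulerPartial, p, Polynomial.map_prod, Polynomial.map_expand]
    rw [this, Polynomial.coeff_map, hFc, eulerCoeff_eq h0 hN]
    rfl
  have hF0 : F.eval 0 = 1 := by
    rw [← Polynomial.coeff_zero_eq_eval_zero, ← hpart 0 0 le_rfl]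
    simp [eulerPartial]
  have hFne : F ≠ 0 := by
    intro h
    rw [h, Polynomial.eval_zero] at hF0
    exact zero_ne_one hF0
  have hp : ∀ a ∈ p.roots, 1 ≤ ‖a‖ := by
    intro a ha
    have ha' : p.eval a = 0 := Polynomial.isRoot_of_mem_roots ha
    by_contra! hlt
    have ha0 : a ≠ 0 := by
      rintro rfl
      rw [hp0] at ha'
      exact one_ne_zero ha'
    -- A root a of p with 0 < |a| < 1 would give a zero q_i of H with q_i^{i+1} = a for every i.
    -- These are distinct, since 0 < |q_i| < 1 determines the exponent from |a|, whereas F has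
    -- finitely many roots.
    choose q hq using fun i : ℕ => IsAlgClosed.exists_pow_nat_eq a (Nat.succ_pos i)
    have hq1 : ∀ i, ‖q i‖ < 1 := by
      intro i
      by_contra! h
      have := one_le_pow₀ h (n := i + 1)
      rw [← norm_pow, hq] at this
      linarith
    have hq0 : ∀ i, 0 < ‖q i‖ := by
      intro i
      rw [norm_pos_iff]
      intro h
      have := hq i
      rw [h, zero_pow (Nat.succ_ne_zero i)] at this
      exact ha0 this.symm
    have hroot : ∀ i, q i ∈ F.roots.toFinset := by
      intro i
      rw [Multiset.mem_toFinset, Polynomial.mem_roots hFne, Polynomial.IsRoot, ← hFe]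
      exact eulerFun_eq_zero h0 (hq1 i) (i := i) (by
        have := hq i
        rw [Nat.succ_eq_add_one] at this
        rw [this]; exact ha')
    have hinj : Function.Injective q := by
      intro i j hij
      have h1 : ‖q i‖ ^ (i + 1) = ‖q i‖ ^ (j + 1) := by
        conv_rhs => rw [hij]
        rw [← norm_pow, ← norm_pow]
        exact congrArg norm ((hq i).trans (hq j).symm)
      have := pow_right_injective₀ (hq0 i) (hq1 i).ne h1
      omega
    exact Set.infinite_range_of_injective hinj
      ((F.roots.toFinset.finite_toSet).subset (by
        rintro _ ⟨i, rfl⟩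
        exact hroot i))
  have hF : ∀ a ∈ F.roots, 1 ≤ ‖a‖ := by
    intro a ha
    have ha' : F.eval a = 0 := Polynomial.isRoot_of_mem_roots ha
    by_contra! hlt
    refine eulerFun_ne_zero h0 hlt (fun i hi => ?_) (by rw [hFe, ha'])
    have hpne : p ≠ 0 := by
      intro h
      rw [h, Polynomial.eval_zero] at hp0
      exact zero_ne_one hp0
    have := hp _ ((Polynomial.mem_roots hpne).2 hi)
    rw [norm_pow] at this
    exact absurd (pow_lt_one₀ (norm_nonneg a) hlt (Nat.succ_ne_zero i)) (not_lt.2 this)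
  have h1 := eq_one_of_eulerPartial_coeff_eq hp0 hF0 hp hF hpart
  apply Polynomial.map_injective (algebraMap ℝ ℂ) (algebraMap ℝ ℂ).injective
  rw [Polynomial.map_one]
  exact h1

end NotPolynomial

/-! ### Concentration at the origin at scale √x -/

section Concentration

theorem tendsto_sqrt_nhdsGT_zero : Tendsto Real.sqrt (𝓝[>] 0) (𝓝 0) := by
  have := Real.continuous_sqrt.tendsto 0
  rw [Real.sqrt_zero] at this
  exact this.mono_left nhdsWithin_le_nhds

/-- Functions concentrating at the origin at scale `√x`, with a Gaussian majorant. -/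
theorem tendsto_integral_of_concentration {F : ℝ → ℝ → ℂ} {c K δ : ℝ} {L : ℝ → ℂ} (hc : 0 < c)
    (hδ : 0 < δ) (hcont : ∀ᶠ x in 𝓝[>] (0 : ℝ), Continuous (F x))
    (hnear : ∀ᶠ x in 𝓝[>] (0 : ℝ), ∀ s, |s| ≤ δ →
      √x * ‖F x s‖ ≤ K * Real.exp (-(c / x) * s ^ 2))
    (hpt : ∀ σ : ℝ, Tendsto (fun x : ℝ => (√x : ℂ) * F x (σ * √x)) (𝓝[>] 0) (𝓝 (L σ)))
    (hfar : ∀ Δ ε : ℝ, 0 < ε → ∀ᶠ x in 𝓝[>] (0 : ℝ), ∀ s, δ ≤ |s| → |s| ≤ Δ → ‖F x s‖ ≤ ε)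
    {Δ : ℝ} (hΔ : 0 < Δ) {g : ℝ → ℂ} (hg : Continuous g) :
    Tendsto (fun x => ∫ s in (-Δ)..Δ, g s * F x s) (𝓝[>] 0) (𝓝 (∫ σ, g 0 * L σ)) := by
  obtain ⟨B, hB⟩ := (isCompact_Icc (a := -Δ) (b := Δ)).exists_bound_of_continuousOn
    hg.continuousOn
  have hB0 : 0 ≤ B := (norm_nonneg _).trans (hB 0 ⟨by linarith, hΔ.le⟩)
  have hle : -Δ ≤ Δ := by linarith
  set S : Set ℝ := Set.Ioc (-Δ) Δ ∩ {s | |s| ≤ δ}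
  have hSm : MeasurableSet S :=
    measurableSet_Ioc.inter (measurableSet_le measurable_norm measurable_const)
  set T : Set ℝ := Set.Ioc (-Δ) Δ \ {s | |s| ≤ δ}
  have hTm : MeasurableSet T :=
    measurableSet_Ioc.diff (measurableSet_le measurable_norm measurable_const)
  have hsplit : ∀ᶠ x in 𝓝[>] (0 : ℝ), (∫ s in S, g s * F x s) + (∫ s in T, g s * F x s) =
      ∫ s in (-Δ)..Δ, g s * F x s := by
    filter_upwards [hcont] with x hx
    rw [intervalIntegral.integral_of_le hle]
    exact integral_inter_add_sdiff (measurableSet_le measurable_norm measurable_const)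
      (((hg.mul hx).integrableOn_Icc).mono_set Set.Ioc_subset_Icc_self)
  -- Away from the origin F x tends to 0 uniformly on a set of measure at most 2Δ.
  have hT : Tendsto (fun x => ∫ s in T, g s * F x s) (𝓝[>] 0) (𝓝 0) := by
    rw [Metric.tendsto_nhds]
    intro ε hε
    have hε' : 0 < ε / (2 * (B + 1) * (2 * Δ)) := by positivity
    filter_upwards [hfar Δ _ hε'] with x hx
    rw [dist_zero_right]
    have hvol : volume T < ⊤ := (measure_mono Set.sdiff_subset).trans_lt
      (by rw [Real.volume_Ioc]; exact ENNReal.ofReal_lt_top)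
    have h1 := norm_setIntegral_le_of_norm_le_const (f := fun s => g s * F x s)
      (C := B * (ε / (2 * (B + 1) * (2 * Δ)))) hvol (fun s hs => by
        have hs1 : |s| ≤ Δ := abs_le.2 ⟨hs.1.1.le, hs.1.2⟩
        have hs2 : δ ≤ |s| := (not_le.1 hs.2).le
        rw [norm_mul]
        exact mul_le_mul (hB s ⟨hs.1.1.le, hs.1.2⟩) (hx s hs2 hs1) (norm_nonneg _) hB0)
    have h2 : volume.real T ≤ 2 * Δ := by
      have h3 : volume.real T ≤ volume.real (Set.Ioc (-Δ) Δ) :=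
        measureReal_mono Set.sdiff_subset (by rw [Real.volume_Ioc]; exact ENNReal.ofReal_ne_top)
      rw [Real.volume_real_Ioc_of_le hle] at h3
      linarith
    refine h1.trans_lt ?_
    calc _ ≤ (B + 1) * (ε / (2 * (B + 1) * (2 * Δ))) * (2 * Δ) := by
          refine mul_le_mul ?_ h2 (by positivity) (by positivity)
          exact mul_le_mul_of_nonneg_right (by linarith) hε'.le
      _ = ε / 2 := by field_simp
      _ < ε := by linarith
  have hS : Tendsto (fun x => ∫ s in S, g s * F x s) (𝓝[>] 0) (𝓝 (∫ σ, g 0 * L σ)) := by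
    -- The substitution s = σ√x turns the majorant into the fixed Gaussian e^{-cσ²}, so dominated
    -- convergence applies.
    have hscale : ∀ᶠ x in 𝓝[>] (0 : ℝ), ∫ s in S, g s * F x s =
        ∫ σ, (√x : ℂ) * S.indicator (fun s => g s * F x s) (σ * √x) := by
      filter_upwards [self_mem_nhdsWithin] with x hx
      have hx : 0 < √x := Real.sqrt_pos.2 hx
      rw [integral_const_mul, Measure.integral_comp_mul_right, integral_indicator hSm,
        abs_of_pos (inv_pos.2 hx), Complex.real_smul, ← mul_assoc, ← Complex.ofReal_mul,
        mul_inv_cancel₀ hx.ne', Complex.ofReal_one, one_mul]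
    refine Tendsto.congr' (hscale.mono fun x hx => hx.symm) ?_
    refine tendsto_integral_filter_of_dominated_convergence
      (fun σ => B * (K * Real.exp (-c * σ ^ 2))) ?_ ?_
      (((integrable_exp_neg_mul_sq hc).const_mul K).const_mul B) ?_
    · filter_upwards [hcont] with x hx
      have h1 : Measurable fun σ : ℝ => S.indicator (fun s => g s * F x s) (σ * √x) :=
        ((hg.mul hx).measurable.indicator hSm).comp (measurable_id.mul_const _)
      exact (h1.const_mul _).aestronglyMeasurable
    · filter_upwards [hnear, self_mem_nhdsWithin] with x hx hx0
      have hx0 : (0 : ℝ) < x := hx0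
      have hsx : 0 < √x := Real.sqrt_pos.2 hx0
      refine Eventually.of_forall fun σ => ?_
      rw [norm_mul, Complex.norm_real, Real.norm_of_nonneg hsx.le]
      by_cases hσ : σ * √x ∈ S
      · rw [Set.indicator_of_mem hσ, norm_mul]
        have h1 := hx (σ * √x) hσ.2
        have h2 : -(c / x) * (σ * √x) ^ 2 = -c * σ ^ 2 := by
          rw [mul_pow, Real.sq_sqrt hx0.le]; field_simp
        rw [h2] at h1
        calc _ = ‖g (σ * √x)‖ * (√x * ‖F x (σ * √x)‖) := by ring
          _ ≤ _ := mul_le_mul (hB _ ⟨hσ.1.1.le, hσ.1.2⟩) h1 (by positivity) hB0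
      · rw [Set.indicator_of_notMem hσ, norm_zero, mul_zero]
        have h1 : 0 ≤ K * Real.exp (-(c / x) * 0 ^ 2) := by
          refine le_trans ?_ (hx 0 (by simpa using hδ.le))
          positivity
        have h2 : 0 ≤ K := by simpa using h1
        positivity
    · refine Eventually.of_forall fun σ => ?_
      have h0 : Tendsto (fun x : ℝ => σ * √x) (𝓝[>] 0) (𝓝 0) := by
        simpa using tendsto_sqrt_nhdsGT_zero.const_mul σ
      have h1 : ∀ᶠ x in 𝓝[>] (0 : ℝ), σ * √x ∈ S := by
        have h2 : ∀ᶠ s : ℝ in 𝓝 0, s ∈ S := by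
          filter_upwards [Ioo_mem_nhds (show -Δ < 0 by linarith) hΔ,
            Ioo_mem_nhds (show -δ < 0 by linarith) hδ] with s hs hs'
          exact ⟨⟨hs.1, hs.2.le⟩, abs_le.2 ⟨hs'.1.le, hs'.2.le⟩⟩
        exact h0.eventually h2
      have h3 : Tendsto (fun x : ℝ => g (σ * √x) * ((√x : ℂ) * F x (σ * √x))) (𝓝[>] 0)
          (𝓝 (g 0 * L σ)) := ((hg.tendsto 0).comp h0).mul (hpt σ)
      refine h3.congr' ?_
      filter_upwards [h1] with x hx
      rw [Set.indicator_of_mem hx]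
      ring
  have h := hS.add hT
  rw [add_zero] at h
  exact h.congr' hsplit

/-- The Gaussian has total mass K√(π/c) independently of x; the summand 2 is the length of [−1, 1]
times the bound 1 on the far part. -/
theorem integral_norm_le_of_concentration {F : ℝ → ℝ → ℂ} {c K δ : ℝ} (hc : 0 < c)
    (hδ : 0 < δ) (hcont : ∀ᶠ x in 𝓝[>] (0 : ℝ), Continuous (F x))
    (hnear : ∀ᶠ x in 𝓝[>] (0 : ℝ), ∀ s, |s| ≤ δ →
      √x * ‖F x s‖ ≤ K * Real.exp (-(c / x) * s ^ 2))
    (hfar : ∀ Δ ε : ℝ, 0 < ε → ∀ᶠ x in 𝓝[>] (0 : ℝ), ∀ s, δ ≤ |s| → |s| ≤ Δ → ‖F x s‖ ≤ ε) :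
    ∀ᶠ x in 𝓝[>] (0 : ℝ), ∫ s in (-1 : ℝ)..1, ‖F x s‖ ≤ K * √(Real.pi / c) + 2 := by
  filter_upwards [hcont, hnear, hfar 1 1 one_pos, self_mem_nhdsWithin] with x h1 h2 h3 hx
  have hx : (0 : ℝ) < x := hx
  have hsx : 0 < √x := Real.sqrt_pos.2 hx
  have hcx : 0 < c / x := by positivity
  have hK : 0 ≤ K := by
    have h4 : 0 ≤ K * Real.exp (-(c / x) * 0 ^ 2) :=
      le_trans (by positivity) (h2 0 (by simpa using hδ.le))
    simpa using h4
  have hgi : Integrable fun s : ℝ => K / √x * Real.exp (-(c / x) * s ^ 2) :=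
    (integrable_exp_neg_mul_sq hcx).const_mul _
  calc ∫ s in (-1 : ℝ)..1, ‖F x s‖
      ≤ ∫ s in (-1 : ℝ)..1, (K / √x * Real.exp (-(c / x) * s ^ 2) + 1) := by
        refine intervalIntegral.integral_mono_on (by norm_num) (h1.norm.intervalIntegrable _ _)
          (hgi.intervalIntegrable.add (by simp)) fun s hs => ?_
        have hs1 : |s| ≤ 1 := abs_le.2 ⟨hs.1, hs.2⟩
        rcases le_total |s| δ with h | h
        · have := h2 s h
          have h5 : ‖F x s‖ ≤ K / √x * Real.exp (-(c / x) * s ^ 2) := by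
            rw [div_mul_eq_mul_div, le_div_iff₀ hsx]
            linarith
          linarith
        · have := h3 s h hs1
          have h5 : 0 ≤ K / √x * Real.exp (-(c / x) * s ^ 2) := by positivity
          linarith
    _ = (∫ s in (-1 : ℝ)..1, K / √x * Real.exp (-(c / x) * s ^ 2)) + 2 := by
        rw [intervalIntegral.integral_add hgi.intervalIntegrable (by simp)]
        simp
        norm_num
    _ ≤ (∫ s, K / √x * Real.exp (-(c / x) * s ^ 2)) + 2 := by
        rw [intervalIntegral.integral_of_le (by norm_num)]
        have := setIntegral_le_integral (s := Set.Ioc (-1 : ℝ) 1) hgi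
          (Eventually.of_forall fun s => by positivity)
        linarith
    _ = K * √(Real.pi / c) + 2 := by
        rw [integral_const_mul, integral_gaussian]
        congr 1
        have : Real.pi / (c / x) = Real.pi / c * x := by field_simp
        rw [this, Real.sqrt_mul (by positivity)]
        field_simp

end Concentration

/-! ### Power series with increasing coefficients and Laplace transforms of step functions -/

section PowerSeriesTransform

/-- The complex power series with coefficients `a`. -/
def powFun (a : ℕ → ℝ) (q : ℂ) : ℂ := ∑' n : ℕ, (a n : ℂ) * q ^ n

theorem summable_powFun {a : ℕ → ℝ} (hnn : ∀ n, 0 ≤ a n)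
    (hs : ∀ r : ℝ, 0 ≤ r → r < 1 → Summable fun n => a n * r ^ n) {q : ℂ} (hq : ‖q‖ < 1) :
    Summable fun n : ℕ => (a n : ℂ) * q ^ n := by
  refine Summable.of_norm ((hs ‖q‖ (norm_nonneg q) hq).congr fun n => ?_)
  rw [norm_mul, norm_pow, Complex.norm_real, Real.norm_of_nonneg (hnn n)]

/-- Bound for a power series with increasing coefficients. -/
theorem norm_one_sub_mul_powFun_le {a : ℕ → ℝ} (hm : Monotone a) (ha0 : a 0 = 0)
    (hs : ∀ r : ℝ, 0 ≤ r → r < 1 → Summable fun n => a n * r ^ n) {q : ℂ} (hq : ‖q‖ < 1) :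
    ‖1 - q‖ * ‖powFun a q‖ ≤ (1 - ‖q‖) * ∑' n : ℕ, a n * ‖q‖ ^ n := by
  have hnn : ∀ n, 0 ≤ a n := fun n => ha0 ▸ hm (Nat.zero_le n)
  -- Summation by parts, with no boundary term as a 0 = 0. The differences are nonnegative, so the
  -- triangle inequality compares q with |q|.
  have hid : ∀ q : ℂ, ‖q‖ < 1 → HasSum (fun n : ℕ => ((a (n + 1) - a n : ℝ) : ℂ) * q ^ (n + 1))
      ((1 - q) * powFun a q) := by
    intro q hq
    have h1 := (summable_powFun hnn hs hq).hasSum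
    have h2 := (hasSum_nat_add_iff' 1).2 h1
    simp only [Finset.range_one, Finset.sum_singleton, ha0, Complex.ofReal_zero, zero_mul,
      sub_zero] at h2
    have h3 := h2.sub (h1.mul_left q)
    have h4 : (1 - q) * powFun a q =
        (∑' n : ℕ, (a n : ℂ) * q ^ n) - q * ∑' n : ℕ, (a n : ℂ) * q ^ n := by
      rw [powFun]; ring
    rw [h4]
    have h5 : (fun n : ℕ => ((a (n + 1) - a n : ℝ) : ℂ) * q ^ (n + 1)) =
        fun n : ℕ => (a (n + 1) : ℂ) * q ^ (n + 1) - q * ((a n : ℂ) * q ^ n) := by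
      funext n; push_cast; ring
    rw [h5]
    exact h3
  have hr := hid (‖q‖ : ℝ) (by simpa using hq)
  have hr' : HasSum (fun n : ℕ => (a (n + 1) - a n) * ‖q‖ ^ (n + 1))
      ((1 - ‖q‖) * ∑' n : ℕ, a n * ‖q‖ ^ n) := by
    rw [← Complex.hasSum_ofReal]
    convert hr using 1
    · funext n; push_cast; rfl
    · rw [powFun]; push_cast; rfl
  rw [← norm_mul, ← (hid q hq).tsum_eq, ← hr'.tsum_eq]
  refine tsum_of_norm_bounded hr'.summable.hasSum fun n => ?_
  rw [norm_mul, norm_pow, Complex.norm_real, Real.norm_of_nonneg (sub_nonneg.2 (hm (Nat.le_succ n)))]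

/-- Half of the exponential bounds a(n)e^{-nx/2}, a term of a convergent series; the other half is
integrable. -/
theorem integrable_floor_mul_exp {a : ℕ → ℝ} (hm : Monotone a) (ha0 : a 0 = 0)
    (hs : ∀ r : ℝ, 0 ≤ r → r < 1 → Summable fun n => a n * r ^ n) {x : ℝ} (hx : 0 < x) :
    Integrable fun u : ℝ => a ⌊u⌋₊ * Real.exp (-(u * x)) := by
  have hnn : ∀ n, 0 ≤ a n := fun n => ha0 ▸ hm (Nat.zero_le n)
  have hmeas : Measurable fun u : ℝ => a ⌊u⌋₊ := measurable_from_nat.comp Nat.measurable_floor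
  have hsum := hs (Real.exp (-(x / 2))) (Real.exp_pos _).le
    (by rw [Real.exp_lt_one_iff]; linarith)
  set K := ∑' n : ℕ, a n * Real.exp (-(x / 2)) ^ n
  have hK : ∀ n, a n * Real.exp (-(x / 2)) ^ n ≤ K := fun n =>
    hsum.le_tsum n fun j _ => mul_nonneg (hnn j) (by positivity)
  -- The natural floor of a negative number is 0, so a 0 = 0 makes the integrand vanish on the
  -- negative half-line.
  have hind : (fun u : ℝ => a ⌊u⌋₊ * Real.exp (-(u * x))) =
      (Set.Ioi (0 : ℝ)).indicator fun u : ℝ => a ⌊u⌋₊ * Real.exp (-(u * x)) := by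
    funext u
    by_cases hu : u ∈ Set.Ioi (0 : ℝ)
    · rw [Set.indicator_of_mem hu]
    · rw [Set.indicator_of_notMem hu, Nat.floor_of_nonpos (not_lt.1 hu), ha0, zero_mul]
  rw [hind, integrable_indicator_iff measurableSet_Ioi]
  refine Integrable.mono' (g := fun u => K * Real.exp (-(x / 2) * u))
    ((integrableOn_exp_mul_Ioi (by linarith) 0).const_mul K) ?_ ?_
  · exact (hmeas.mul (by fun_prop)).aestronglyMeasurable
  · filter_upwards [ae_restrict_mem measurableSet_Ioi] with u hu
    have hu0 : (0 : ℝ) ≤ u := le_of_lt hu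
    rw [Real.norm_of_nonneg (mul_nonneg (hnn _) (Real.exp_pos _).le)]
    have h1 := hK ⌊u⌋₊
    rw [← Real.exp_nat_mul] at h1
    have h2 : Real.exp (-(u * x)) ≤
        Real.exp (⌊u⌋₊ * (-(x / 2))) * Real.exp (-(x / 2) * u) := by
      rw [← Real.exp_add]
      apply Real.exp_le_exp.2
      have := mul_le_mul_of_nonneg_right (Nat.floor_le hu0) (by linarith : 0 ≤ x / 2)
      linarith
    calc _ ≤ a ⌊u⌋₊ * (Real.exp (⌊u⌋₊ * (-(x / 2))) * Real.exp (-(x / 2) * u)) :=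
          mul_le_mul_of_nonneg_left h2 (hnn _)
      _ = a ⌊u⌋₊ * Real.exp (⌊u⌋₊ * (-(x / 2))) * Real.exp (-(x / 2) * u) := by ring
      _ ≤ _ := mul_le_mul_of_nonneg_right h1 (Real.exp_pos _).le

/-- The Laplace transform of `u ↦ a ⌊u⌋`. -/
theorem integral_floor_mul_exp {a : ℕ → ℝ} (hm : Monotone a) (ha0 : a 0 = 0)
    (hs : ∀ r : ℝ, 0 ≤ r → r < 1 → Summable fun n => a n * r ^ n) {z : ℂ} (hz : 0 < z.re) :
    Integrable (fun u : ℝ => (a ⌊u⌋₊ : ℂ) * Complex.exp (-(u * z))) ∧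
    ∫ u : ℝ, (a ⌊u⌋₊ : ℂ) * Complex.exp (-(u * z)) =
      powFun a (Complex.exp (-z)) * ((1 - Complex.exp (-z)) / z) := by
  have hnn : ∀ n, 0 ≤ a n := fun n => ha0 ▸ hm (Nat.zero_le n)
  have hz0 : z ≠ 0 := by rintro rfl; simp at hz
  have hmeas : Measurable fun u : ℝ => (a ⌊u⌋₊ : ℂ) :=
    Complex.measurable_ofReal.comp (measurable_from_nat.comp Nat.measurable_floor)
  have hint : Integrable (fun u : ℝ => (a ⌊u⌋₊ : ℂ) * Complex.exp (-(u * z))) := by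
    refine (integrable_floor_mul_exp hm ha0 hs hz).mono'
      (hmeas.mul (Continuous.measurable (by fun_prop))).aestronglyMeasurable
      (Eventually.of_forall fun u => ?_)
    rw [norm_mul, Complex.norm_real, Real.norm_of_nonneg (hnn _), Complex.norm_exp]
    simp
  refine ⟨hint, ?_⟩
  have hU : ⋃ n : ℕ, Set.Ioc (n : ℝ) ((n + 1 : ℕ) : ℝ) = Set.Ioi 0 := by
    ext r
    simp only [Set.mem_iUnion, Set.mem_Ioc, Set.mem_Ioi]
    constructor
    · rintro ⟨n, h1, -⟩
      exact lt_of_le_of_lt n.cast_nonneg h1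
    · intro hr
      have h1 : 0 < ⌈r⌉₊ := Nat.ceil_pos.2 hr
      refine ⟨⌈r⌉₊ - 1, ?_, ?_⟩
      · have h2 := Nat.ceil_lt_add_one hr.le
        rw [Nat.cast_sub (by omega), Nat.cast_one]
        linarith
      · rw [Nat.sub_add_cancel h1]
        exact Nat.le_ceil _
  have hdisj : Pairwise (Function.onFun Disjoint fun n : ℕ =>
      Set.Ioc (n : ℝ) ((n + 1 : ℕ) : ℝ)) :=
    (Nat.mono_cast (α := ℝ)).pairwise_disjoint_on_Ioc_succ
  have h := hasSum_integral_iUnion (fun n : ℕ =>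
    (measurableSet_Ioc : MeasurableSet (Set.Ioc (n : ℝ) ((n + 1 : ℕ) : ℝ)))) hdisj
    (f := fun u : ℝ => (a ⌊u⌋₊ : ℂ) * Complex.exp (-(u * z))) (μ := volume) hint.integrableOn
  rw [hU, setIntegral_eq_integral_of_forall_compl_eq_zero] at h
  · have hq : ‖Complex.exp (-z)‖ < 1 := by
      rw [Complex.norm_exp, Real.exp_lt_one_iff]; simpa using hz
    have h2 := (summable_powFun hnn hs hq).hasSum.mul_right ((1 - Complex.exp (-z)) / z)
    refine h.unique (Eq.mpr (congrArg (HasSum · _) (funext fun n => ?_)) h2)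
    have h3 : ∀ u ∈ Set.Ioo (n : ℝ) ((n + 1 : ℕ) : ℝ), (a ⌊u⌋₊ : ℂ) * Complex.exp (-(u * z)) =
        (a n : ℂ) * Complex.exp (-z * u) := by
      intro u hu
      have : ⌊u⌋₊ = n := by
        rw [Nat.floor_eq_iff (n.cast_nonneg.trans hu.1.le)]
        exact ⟨hu.1.le, by simpa using hu.2⟩
      rw [this]
      congr 2; ring
    rw [integral_Ioc_eq_integral_Ioo, setIntegral_congr_fun measurableSet_Ioo h3,
      ← integral_Ioc_eq_integral_Ioo, integral_const_mul,
      ← intervalIntegral.integral_of_le (by simp), integral_exp_mul_complex (neg_ne_zero.2 hz0),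
      ← Complex.exp_nat_mul]
    have h4 : Complex.exp (-z * ((n + 1 : ℕ) : ℝ)) =
        Complex.exp (n * -z) * Complex.exp (-z) := by
      rw [← Complex.exp_add]; congr 1; push_cast; ring
    have h5 : Complex.exp (-z * (n : ℝ)) = Complex.exp (n * -z) := by
      congr 1; push_cast; ring
    rw [h4, h5]
    field_simp
    ring
  · intro u hu
    rw [Nat.floor_of_nonpos (not_lt.1 hu), ha0]; simp

end PowerSeriesTransform

/-! ### The Tauberian theorem for an exponential singularity at q = 1 -/

section Tauberian

/-- The factor (1 − e^{-z})/z is the price of replacing a sum by the Laplace transform of a step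
function; it tends to 1. -/
theorem norm_one_sub_exp_neg_div_sub_one_le {z : ℂ} (hz : z ≠ 0) (h1 : ‖z‖ ≤ 1) :
    ‖(1 - Complex.exp (-z)) / z - 1‖ ≤ ‖z‖ := by
  have h := Complex.norm_exp_sub_one_sub_id_le (x := -z) (by rwa [norm_neg])
  have h2 : (1 - Complex.exp (-z)) / z - 1 = -((Complex.exp (-z) - 1 - -z) / z) := by
    field_simp; ring
  have hz' : 0 < ‖z‖ := norm_pos_iff.2 hz
  rw [h2, norm_neg, norm_div, div_le_iff₀ hz']
  rw [norm_neg] at h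
  linarith [sq ‖z‖]

theorem Real.exp_neg_div_le {c x : ℝ} (hc : 0 < c) (hx : 0 < x) : Real.exp (-(c / x)) ≤ x / c := by
  rw [Real.exp_neg, inv_le_comm₀ (Real.exp_pos _) (by positivity), inv_div]
  linarith [Real.add_one_le_exp (c / x)]

theorem Complex.norm_one_add_ofReal_mul_I_le (t : ℝ) : ‖(1 + t * Complex.I : ℂ)‖ ≤ 1 + |t| := by
  refine (norm_add_le _ _).trans ?_
  simp

theorem one_add_ofReal_mul_I_ne_zero (t : ℝ) : (1 + t * Complex.I : ℂ) ≠ 0 := by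
  intro h
  simpa using congrArg Complex.re h

/-- The Fourier transform of the normalised step function of an increasing sequence. -/
def stepTransform (a : ℕ → ℝ) (C A x s : ℝ) : ℂ :=
  (A / √x : ℝ) * Complex.exp ((C / x : ℝ) * (s * Complex.I - 1)) *
    (powFun a (Complex.exp (-(x * (1 + s * Complex.I)))) *
      ((1 - Complex.exp (-(x * (1 + s * Complex.I)))) / (x * (1 + s * Complex.I))))

/-- The normalised step function of an increasing sequence. -/
def stepFun (a : ℕ → ℝ) (C A x v : ℝ) : ℝ :=
  A / (x * √x) * Real.exp (-(2 * C / x)) * a ⌊C / x ^ 2 + v / x⌋₊ * Real.exp (-v)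

section StepFunction

variable {a : ℕ → ℝ} {C A x : ℝ}

theorem integrable_stepFun_mul_exp (hm : Monotone a) (ha0 : a 0 = 0)
    (hs : ∀ r : ℝ, 0 ≤ r → r < 1 → Summable fun n => a n * r ^ n) (hx : 0 < x) (s : ℝ) :
    Integrable (fun v : ℝ => (stepFun a C A x v : ℂ) * Complex.exp (-(s * v * Complex.I))) ∧
    ∫ v : ℝ, (stepFun a C A x v : ℂ) * Complex.exp (-(s * v * Complex.I)) =
      stepTransform a C A x s := by
  have hxc : (x : ℂ) ≠ 0 := by exact_mod_cast hx.ne'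
  obtain ⟨h1, h2⟩ := integral_floor_mul_exp hm ha0 hs (z := x * (1 + s * Complex.I))
    (by simpa using hx)
  set f : ℝ → ℂ := fun u => (a ⌊u⌋₊ : ℂ) * Complex.exp (-(u * (x * (1 + s * Complex.I))))
  have hid : (fun v : ℝ => (stepFun a C A x v : ℂ) * Complex.exp (-(s * v * Complex.I))) =
      fun v : ℝ => ((A / (x * √x) : ℝ) * Complex.exp ((C / x : ℝ) * (s * Complex.I - 1))) *
        f (C / x ^ 2 + v / x) := by
    funext v
    -- With u = C/x² + v/x one has ux = C/x + v: half of the exponent 2C/x is absorbed by the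
    -- Laplace kernel, the other half remains in front together with the phase isC/x.
    have h3 : Complex.exp (-(2 * C / x : ℝ)) * Complex.exp (-v) *
        Complex.exp (-(s * v * Complex.I)) = Complex.exp ((C / x : ℝ) * (s * Complex.I - 1)) *
        Complex.exp (-((C / x ^ 2 + v / x : ℝ) * (x * (1 + s * Complex.I)))) := by
      rw [← Complex.exp_add, ← Complex.exp_add, ← Complex.exp_add]
      congr 1
      push_cast
      field_simp
      ring
    simp only [stepFun, f]
    push_cast at h3 ⊢
    linear_combination (A / (x * √x) : ℂ) * (a ⌊C / x ^ 2 + v / x⌋₊ : ℂ) * h3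
  rw [hid]
  refine ⟨(((h1.comp_add_left (C / x ^ 2)).comp_div hx.ne').const_mul _), ?_⟩
  rw [integral_const_mul, Measure.integral_comp_div (fun w => f (C / x ^ 2 + w)),
    integral_add_left_eq_self f, h2, abs_of_pos hx, stepTransform, Complex.real_smul]
  have hsx : (√x : ℂ) ≠ 0 := by exact_mod_cast (Real.sqrt_pos.2 hx).ne'
  push_cast
  field_simp

theorem integrable_stepFun (hm : Monotone a) (ha0 : a 0 = 0)
    (hs : ∀ r : ℝ, 0 ≤ r → r < 1 → Summable fun n => a n * r ^ n) (hx : 0 < x) :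
    Integrable (stepFun a C A x) := by
  have h := (integrable_stepFun_mul_exp (C := C) (A := A) hm ha0 hs hx 0).1
  simp only [Complex.ofReal_zero, zero_mul, neg_zero, Complex.exp_zero, mul_one] at h
  simpa using h.re

theorem continuous_stepTransform (hm : Monotone a) (ha0 : a 0 = 0)
    (hs : ∀ r : ℝ, 0 ≤ r → r < 1 → Summable fun n => a n * r ^ n) (hx : 0 < x) :
    Continuous (stepTransform a C A x) := by
  have h : stepTransform a C A x = fun s : ℝ =>
      ∫ v : ℝ, (stepFun a C A x v : ℂ) * Complex.exp (-(s * v * Complex.I)) :=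
    funext fun s => ((integrable_stepFun_mul_exp hm ha0 hs hx s).2).symm
  rw [h]
  refine continuous_of_dominated (bound := fun v => ‖stepFun a C A x v‖)
    (fun s => (integrable_stepFun_mul_exp hm ha0 hs hx s).1.aestronglyMeasurable)
    (fun s => Eventually.of_forall fun v => ?_) (integrable_stepFun hm ha0 hs hx).norm
    (Eventually.of_forall fun v => by fun_prop)
  rw [norm_mul, Complex.norm_real, Complex.norm_exp]
  simp

theorem monotone_exp_mul_stepFun (hm : Monotone a) (hx : 0 < x) (hA : 0 ≤ A) :
    Monotone fun v => Real.exp v * stepFun a C A x v := by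
  have h : (fun v => Real.exp v * stepFun a C A x v) = fun v =>
      A / (x * √x) * Real.exp (-(2 * C / x)) * a ⌊C / x ^ 2 + v / x⌋₊ := by
    funext v
    have : Real.exp v * Real.exp (-v) = 1 := by rw [← Real.exp_add]; simp
    simp only [stepFun]
    linear_combination (A / (x * √x) * Real.exp (-(2 * C / x)) * a ⌊C / x ^ 2 + v / x⌋₊) * this
  rw [h]
  intro v w hvw
  refine mul_le_mul_of_nonneg_left (hm (Nat.floor_mono ?_)) (by positivity)
  gcongr

theorem norm_stepTransform (hx : 0 < x) (hA : 0 ≤ A) (s : ℝ) :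
    √x * ‖stepTransform a C A x s‖ = A * Real.exp (-(C / x)) *
      (‖powFun a (Complex.exp (-(x * (1 + s * Complex.I))))‖ *
        ‖(1 - Complex.exp (-(x * (1 + s * Complex.I)))) / (x * (1 + s * Complex.I))‖) := by
  have hsx : 0 < √x := Real.sqrt_pos.2 hx
  rw [stepTransform, norm_mul, norm_mul, norm_mul, Complex.norm_real, Complex.norm_exp,
    Real.norm_of_nonneg (by positivity)]
  have : ((C / x : ℝ) * (s * Complex.I - 1) : ℂ).re = -(C / x) := by simp
  rw [this]
  field_simp

theorem norm_one_sub_exp_div_le (hx : 0 < x) {s : ℝ} (h : x * (1 + |s|) ≤ 1) :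
    ‖(1 - Complex.exp (-(x * (1 + s * Complex.I)))) / (x * (1 + s * Complex.I))‖ ≤ 2 := by
  have hz0 : (x * (1 + s * Complex.I) : ℂ) ≠ 0 :=
    mul_ne_zero (by exact_mod_cast hx.ne') (one_add_ofReal_mul_I_ne_zero s)
  have hz1 : ‖(x * (1 + s * Complex.I) : ℂ)‖ ≤ 1 := by
    rw [norm_mul, Complex.norm_real, Real.norm_of_nonneg hx.le]
    exact (mul_le_mul_of_nonneg_left (Complex.norm_one_add_ofReal_mul_I_le s) hx.le).trans h
  have h1 := (norm_one_sub_exp_neg_div_sub_one_le hz0 hz1).trans hz1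
  have h2 := norm_add_le ((1 - Complex.exp (-(x * (1 + s * Complex.I)))) /
    (x * (1 + s * Complex.I)) - 1) 1
  rw [sub_add_cancel, norm_one] at h2
  linarith

/-- Since (is − 1)(is + 1) + 1 = −s², centring at C/x² cancels the terms of order 0 and 1 in s and
leaves a Gaussian of width about √x. -/
theorem stepTransform_exponent (hx : 0 < x) (s : ℝ) :
    ((C / x : ℝ) * (s * Complex.I - 1) + C / (x * (1 + s * Complex.I)) : ℂ) =
      -((C * s ^ 2 / x : ℝ) / (1 + s * Complex.I)) := by
  have hxc : (x : ℂ) ≠ 0 := by exact_mod_cast hx.ne'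
  have h1 := one_add_ofReal_mul_I_ne_zero s
  push_cast
  field_simp
  ring_nf
  rw [Complex.I_sq]
  ring

end StepFunction

/-- Tauberian theorem: the coefficients of a power series with increasing coefficients whose
singularity at `1` dominates. -/
theorem tendsto_of_powFun_asymptotics {a : ℕ → ℝ} (hm : Monotone a) (ha0 : a 0 = 0)
    (hs : ∀ r : ℝ, 0 ≤ r → r < 1 → Summable fun n => a n * r ^ n) {C lam δ M K : ℝ}
    (hC : 0 < C) (hlam : 0 < lam) (hδ : 0 < δ) (hδ1 : δ ≤ 1)
    (hnear : ∀ t x : ℝ, |t| ≤ δ → 0 < x → x ≤ 1 → ∃ e p : ℂ, ‖e‖ ≤ M * x ∧ ‖p‖ ≤ K ∧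
      powFun a (Complex.exp (-(x * (1 + t * Complex.I)))) =
        lam * Complex.exp (C / (x * (1 + t * Complex.I)) + e) - p)
    (hfar : ∀ Δ : ℝ, ∃ η : ℝ, 0 < η ∧ ∀ᶠ x : ℝ in 𝓝[>] (0 : ℝ), ∀ t : ℝ, δ ≤ |t| → |t| ≤ Δ →
      ‖powFun a (Complex.exp (-(x * (1 + t * Complex.I))))‖ ≤ Real.exp ((C - η) / x) + K) :
    Tendsto (fun x => 2 * √(Real.pi * C) / lam / (x * √x) * Real.exp (-(2 * C / x)) *
      a ⌊C / x ^ 2⌋₊) (𝓝[>] 0) (𝓝 1) := by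
  have hnn : ∀ n, 0 ≤ a n := fun n => ha0 ▸ hm (Nat.zero_le n)
  -- Chosen so that Aλ∫e^{-Cσ²}dσ = Aλ√(π/C) = 2π.
  set A := 2 * √(Real.pi * C) / lam with hAdef
  have hA : 0 < A := by have := Real.pi_pos; positivity
  clear_value A
  have hM : 0 ≤ M := by
    obtain ⟨e, p, he, -⟩ := hnear 0 1 (by simpa using hδ.le) one_pos le_rfl
    linarith [norm_nonneg e]
  have hK : 0 ≤ K := by
    obtain ⟨e, p, -, hp, -⟩ := hnear 0 1 (by simpa using hδ.le) one_pos le_rfl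
    linarith [norm_nonneg p]
  have hpos : ∀ᶠ x : ℝ in 𝓝[>] 0, 0 < x := self_mem_nhdsWithin
  have hsmall : ∀ b : ℝ, 0 < b → ∀ᶠ x : ℝ in 𝓝[>] 0, x < b := fun b hb =>
    Filter.Eventually.filter_mono nhdsWithin_le_nhds (Iio_mem_nhds hb)
  have hcont : ∀ᶠ x in 𝓝[>] (0 : ℝ), Continuous (stepTransform a C A x) :=
    hpos.mono fun x hx => continuous_stepTransform hm ha0 hs hx
  -- The real part of the exponent is −Cs²/(x(1+s²)), at most −Cs²/(2x) because |s| ≤ δ ≤ 1; hence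
  -- C/2 in the Gaussian majorant.
  have hn : ∀ᶠ x in 𝓝[>] (0 : ℝ), ∀ s, |s| ≤ δ → √x * ‖stepTransform a C A x s‖ ≤
      2 * A * (lam * Real.exp M + K) * Real.exp (-(C / 2 / x) * s ^ 2) := by
    filter_upwards [hpos, hsmall (1 / 2) (by norm_num)] with x hx hx2 s hsδ
    obtain ⟨e, p, he, hp, heq⟩ := hnear s x hsδ hx (by linarith)
    have hs1 : |s| ≤ 1 := hsδ.trans hδ1
    have hs2 : s ^ 2 ≤ 1 := by rw [← sq_abs]; exact pow_le_one₀ (abs_nonneg s) hs1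
    have hw := norm_one_sub_exp_div_le hx (s := s) (by nlinarith)
    rw [norm_stepTransform hx hA.le]
    have hCx : 0 < C / x := by positivity
    have hre : ((C / (x * (1 + s * Complex.I)) + e : ℂ)).re ≤
        C / x + -(C / 2 / x) * s ^ 2 + M := by
      have h1 : (e.re) ≤ M := (Complex.re_le_norm e).trans (he.trans (by nlinarith))
      have h2 := congrArg Complex.re (stepTransform_exponent (C := C) hx s)
      have h3 : (-((C * s ^ 2 / x : ℝ) / (1 + s * Complex.I)) : ℂ).re =
          -(C * s ^ 2 / x / (1 + s ^ 2)) := by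
        rw [Complex.neg_re, Complex.div_re]
        simp [Complex.normSq_apply, ← sq, -Complex.ofReal_pow]
      have h4 : ((C / x : ℝ) * (s * Complex.I - 1) : ℂ).re = -(C / x) := by simp
      rw [Complex.add_re, h3, h4] at h2
      rw [Complex.add_re]
      have h5 : C / 2 / x * s ^ 2 ≤ C * s ^ 2 / x / (1 + s ^ 2) := by
        rw [le_div_iff₀ (by positivity)]
        have h6 : C / 2 / x * s ^ 2 * (1 + s ^ 2) ≤ C / 2 / x * s ^ 2 * 2 :=
          mul_le_mul_of_nonneg_left (by linarith) (by positivity)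
        refine h6.trans (le_of_eq ?_)
        ring
      linarith
    have hpow : ‖powFun a (Complex.exp (-(x * (1 + s * Complex.I))))‖ ≤
        (lam * Real.exp M + K) * Real.exp (C / x + -(C / 2 / x) * s ^ 2) := by
      rw [heq]
      refine (norm_sub_le _ _).trans ?_
      rw [norm_mul, Complex.norm_real, Real.norm_of_nonneg hlam.le, Complex.norm_exp, add_mul,
        mul_assoc lam, ← Real.exp_add]
      refine add_le_add (mul_le_mul_of_nonneg_left (Real.exp_le_exp.2 (by linarith)) hlam.le)
        (hp.trans (le_mul_of_one_le_right hK (Real.one_le_exp ?_)))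
      have : C / 2 / x * s ^ 2 ≤ C / 2 / x * 1 := mul_le_mul_of_nonneg_left hs2 (by positivity)
      have h7 : C / 2 / x = C / x / 2 := by ring
      linarith
    calc _ ≤ A * Real.exp (-(C / x)) * ((lam * Real.exp M + K) *
          Real.exp (C / x + -(C / 2 / x) * s ^ 2) * 2) := by
          gcongr
      _ = 2 * A * (lam * Real.exp M + K) * (Real.exp (-(C / x)) *
          Real.exp (C / x + -(C / 2 / x) * s ^ 2)) := by ring
      _ = _ := by rw [← Real.exp_add]; congr 2; ring
  -- The gap η and the bounded error both gain an exponential factor, and e^{-c/x} ≤ x/c already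
  -- suffices: the transform is O(√x).
  have hf : ∀ Δ ε : ℝ, 0 < ε → ∀ᶠ x in 𝓝[>] (0 : ℝ), ∀ s, δ ≤ |s| → |s| ≤ Δ →
      ‖stepTransform a C A x s‖ ≤ ε := by
    intro Δ ε hε
    obtain ⟨η, hη, hev⟩ := hfar Δ
    have hb : 0 < 2 * A * (1 / η + K / C) := by positivity
    have hsq := tendsto_sqrt_nhdsGT_zero.eventually (Iio_mem_nhds (div_pos hε hb))
    filter_upwards [hpos, hsmall (1 / (2 + |Δ|)) (by positivity), hev, hsq] with x hx hx2 hx3 hx4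
      s hs1 hs2
    have hsx : 0 < √x := Real.sqrt_pos.2 hx
    have hw := norm_one_sub_exp_div_le hx (s := s) (by
      rw [lt_div_iff₀ (by positivity)] at hx2
      have : |s| ≤ 1 + |Δ| := hs2.trans ((le_abs_self Δ).trans (by linarith))
      nlinarith)
    have h1 := norm_stepTransform (a := a) (C := C) hx hA.le s
    have h2 : Real.exp (-(C / x)) * (Real.exp ((C - η) / x) + K) ≤ x * (1 / η + K / C) := by
      rw [mul_add, ← Real.exp_add]
      have h3 : -(C / x) + (C - η) / x = -(η / x) := by ring
      rw [h3]
      have h4 := Real.exp_neg_div_le hη hx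
      have h5 := mul_le_mul_of_nonneg_right (Real.exp_neg_div_le hC hx) hK
      calc _ ≤ x / η + x / C * K := add_le_add h4 h5
        _ = _ := by ring
    have h6 : √x * ‖stepTransform a C A x s‖ ≤ √x * (2 * A * (1 / η + K / C) * √x) := by
      rw [h1]
      calc _ ≤ A * Real.exp (-(C / x)) * ((Real.exp ((C - η) / x) + K) * 2) := by
            gcongr
            exact hx3 s hs1 hs2
        _ = 2 * A * (Real.exp (-(C / x)) * (Real.exp ((C - η) / x) + K)) := by ring
        _ ≤ 2 * A * (x * (1 / η + K / C)) := by gcongr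
        _ = _ := by
            nth_rewrite 1 [← Real.mul_self_sqrt hx.le]
            ring
    refine (le_of_mul_le_mul_left h6 hsx).trans ?_
    have h7 := (lt_div_iff₀ hb).1 hx4
    linarith
  have hpt : ∀ σ : ℝ, Tendsto (fun x : ℝ => (√x : ℂ) * stepTransform a C A x (σ * √x)) (𝓝[>] 0)
      (𝓝 ((A * lam : ℝ) * (Real.exp (-C * σ ^ 2) : ℝ))) := by
    intro σ
    -- Moving the conditions on t and x inside the existential makes e and p total functions that
    -- can be chosen once and for all.
    have hnear' : ∀ t x : ℝ, ∃ e p : ℂ, |t| ≤ δ → 0 < x → x ≤ 1 → ‖e‖ ≤ M * x ∧ ‖p‖ ≤ K ∧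
        powFun a (Complex.exp (-(x * (1 + t * Complex.I)))) =
          lam * Complex.exp (C / (x * (1 + t * Complex.I)) + e) - p := by
      intro t x
      by_cases h : |t| ≤ δ ∧ 0 < x ∧ x ≤ 1
      · obtain ⟨e, p, h'⟩ := hnear t x h.1 h.2.1 h.2.2
        exact ⟨e, p, fun _ _ _ => h'⟩
      · exact ⟨0, 0, fun h1 h2 h3 => absurd ⟨h1, h2, h3⟩ h⟩
    choose e p hep using hnear'
    have hid0 : Tendsto (fun x : ℝ => x) (𝓝[>] 0) (𝓝 0) := nhdsWithin_le_nhds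
    have hst : Tendsto (fun x : ℝ => σ * √x) (𝓝[>] 0) (𝓝 0) := by
      simpa using tendsto_sqrt_nhdsGT_zero.const_mul σ
    have hst' : ∀ᶠ x : ℝ in 𝓝[>] 0, |σ * √x| ≤ δ := by
      have := hst.abs.eventually (Iio_mem_nhds (show |(0 : ℝ)| < δ by simpa using hδ))
      exact this.mono fun x hx => le_of_lt hx
    have hgood : ∀ᶠ x : ℝ in 𝓝[>] 0, 0 < x ∧ x < 1 / 2 ∧ |σ * √x| ≤ δ :=
      hpos.and ((hsmall _ (by norm_num)).and hst')
    have he : Tendsto (fun x => e (σ * √x) x) (𝓝[>] 0) (𝓝 0) := by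
      refine squeeze_zero_norm' (a := fun x => M * x) ?_ (by simpa using hid0.const_mul M)
      filter_upwards [hgood] with x hx
      exact (hep _ _ hx.2.2 hx.1 (by linarith)).1
    have hone : Tendsto (fun x : ℝ => (1 + (σ * √x : ℝ) * Complex.I : ℂ)) (𝓝[>] 0) (𝓝 1) := by
      have h1 := ((Complex.continuous_ofReal.tendsto 0).comp hst).mul_const Complex.I
      simpa using h1.const_add 1
    have hw : Tendsto (fun x : ℝ => (1 - Complex.exp (-(x * (1 + (σ * √x : ℝ) * Complex.I)))) /
        (x * (1 + (σ * √x : ℝ) * Complex.I))) (𝓝[>] 0) (𝓝 1) := by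
      rw [tendsto_iff_norm_sub_tendsto_zero]
      refine squeeze_zero' (g := fun x : ℝ => x * 2) (Eventually.of_forall fun _ => norm_nonneg _)
        ?_ (by simpa using hid0.mul_const 2)
      filter_upwards [hgood] with x hx
      have hz : ‖(x * (1 + (σ * √x : ℝ) * Complex.I) : ℂ)‖ ≤ x * 2 := by
        rw [norm_mul, Complex.norm_real, Real.norm_of_nonneg hx.1.le]
        refine mul_le_mul_of_nonneg_left ?_ hx.1.le
        exact (Complex.norm_one_add_ofReal_mul_I_le _).trans (by linarith [hx.2.2])
      exact (norm_one_sub_exp_neg_div_sub_one_le (mul_ne_zero (by exact_mod_cast hx.1.ne')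
        (one_add_ofReal_mul_I_ne_zero _)) (hz.trans (by linarith [hx.2.1]))).trans hz
    have hmain : Tendsto (fun x : ℝ => Complex.exp (-((C * σ ^ 2 : ℝ) /
        (1 + (σ * √x : ℝ) * Complex.I)) + e (σ * √x) x)) (𝓝[>] 0)
        (𝓝 (Complex.exp (-((C * σ ^ 2 : ℝ) / 1) + 0))) :=
      (Complex.continuous_exp.tendsto _).comp
        (((tendsto_const_nhds.div hone one_ne_zero).neg).add he)
    have hp : Tendsto (fun x : ℝ => p (σ * √x) x *
        Complex.exp ((C / x : ℝ) * ((σ * √x : ℝ) * Complex.I - 1))) (𝓝[>] 0) (𝓝 0) := by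
      refine squeeze_zero_norm' (a := fun x => K * (x / C)) ?_
        (by simpa using (hid0.div_const C).const_mul K)
      filter_upwards [hgood] with x hx
      have h1 : ((C / x : ℝ) * ((σ * √x : ℝ) * Complex.I - 1) : ℂ).re = -(C / x) := by simp
      rw [norm_mul, Complex.norm_exp, h1]
      exact mul_le_mul (hep _ _ hx.2.2 hx.1 (by linarith)).2.1 (Real.exp_neg_div_le hC hx.1)
        (Real.exp_pos _).le hK
    have hfin := (((hmain.const_mul (lam : ℂ)).sub hp).mul hw).const_mul (A : ℂ)
    have hval : (A : ℂ) * ((lam * Complex.exp (-((C * σ ^ 2 : ℝ) / 1) + 0) - 0) * 1) =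
        (A * lam : ℝ) * (Real.exp (-C * σ ^ 2) : ℝ) := by
      push_cast
      rw [div_one, add_zero, sub_zero, mul_one, neg_mul]
      ring
    rw [hval] at hfin
    refine hfin.congr' ?_
    filter_upwards [hgood] with x hx
    have h1 := (hep _ _ hx.2.2 hx.1 (by linarith)).2.2
    have h2 := stepTransform_exponent (C := C) hx.1 (σ * √x)
    have h3 : C * (σ * √x) ^ 2 / x = C * σ ^ 2 := by
      rw [mul_pow, Real.sq_sqrt hx.1.le]
      have := hx.1.ne'
      field_simp
    rw [h3] at h2
    have hsx : (√x : ℂ) ≠ 0 := by exact_mod_cast (Real.sqrt_pos.2 hx.1).ne'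
    rw [stepTransform, h1, ← h2]
    have h4 : Complex.exp ((C / x : ℝ) * ((σ * √x : ℝ) * Complex.I - 1) +
        C / (x * (1 + (σ * √x : ℝ) * Complex.I)) + e (σ * √x) x) =
        Complex.exp ((C / x : ℝ) * ((σ * √x : ℝ) * Complex.I - 1)) *
        Complex.exp (C / (x * (1 + (σ * √x : ℝ) * Complex.I)) + e (σ * √x) x) := by
      rw [← Complex.exp_add, add_assoc]
    rw [h4, Complex.ofReal_div A]
    generalize Complex.exp ((C / x : ℝ) * ((σ * √x : ℝ) * Complex.I - 1)) = E1
    generalize Complex.exp (C / (x * (1 + (σ * √x : ℝ) * Complex.I)) + e (σ * √x) x) = E2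
    field_simp
  have hL : ∫ σ : ℝ, ((A * lam : ℝ) * (Real.exp (-C * σ ^ 2) : ℝ) : ℂ) = 2 * Real.pi := by
    rw [integral_const_mul, integral_complex_ofReal, integral_gaussian, ← Complex.ofReal_mul]
    have h1 : A * lam * √(Real.pi / C) = 2 * Real.pi := by
      have h2 : √(Real.pi * C) * √(Real.pi / C) = Real.pi := by
        rw [← Real.sqrt_mul (by have := Real.pi_pos; positivity)]
        have : Real.pi * C * (Real.pi / C) = Real.pi ^ 2 := by field_simp
        rw [this, Real.sqrt_sq Real.pi_pos.le]
      rw [hAdef, div_mul_cancel₀ _ hlam.ne', mul_assoc, h2]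
    rw [h1]
    push_cast
    rfl
  have hc : 0 < C / 2 := by positivity
  have h := tendsto_one_of_fourier_tendsto (l := 𝓝[>] (0 : ℝ)) (h := stepFun a C A)
    (F := stepTransform a C A)
    (hpos.mono fun x hx v => by have := hnn ⌊C / x ^ 2 + v / x⌋₊; unfold stepFun; positivity)
    (hpos.mono fun x hx => integrable_stepFun hm ha0 hs hx)
    (hpos.mono fun x hx => monotone_exp_mul_stepFun hm hx hA.le)
    (hpos.mono fun x hx s => (integrable_stepFun_mul_exp hm ha0 hs hx s).2.symm)
    (fun Δ hΔ g hg => by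
      have h := tendsto_integral_of_concentration hc hδ hcont hn hpt hf hΔ hg
      rwa [integral_const_mul, hL, mul_comm] at h)
    (hcont.mono fun x hx => hx.intervalIntegrable _ _)
    (integral_norm_le_of_concentration hc hδ hcont hn hf)
  simpa [stepFun] using h

end Tauberian

/-! ### Application to H with its initial coefficients removed -/

section EventuallyIncreasing

/-- The coefficients of the infinite product, with those of index less than `m` removed. -/
def tailCoeff (P : Polynomial ℝ) (m n : ℕ) : ℝ := if n < m then 0 else eulerCoeff P n

variable {P : Polynomial ℝ} {m : ℕ}

theorem tailCoeff_of_le {n : ℕ} (h : m ≤ n) : tailCoeff P m n = eulerCoeff P n :=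
  if_neg (not_lt.2 h)

theorem tailCoeff_zero (hm : 0 < m) : tailCoeff P m 0 = 0 := if_pos hm

theorem monotone_tailCoeff (h : ∀ n, m ≤ n → 0 ≤ eulerCoeff P n ∧
    eulerCoeff P n ≤ eulerCoeff P (n + 1)) : Monotone (tailCoeff P m) := by
  refine monotone_nat_of_le_succ fun n => ?_
  unfold tailCoeff
  split_ifs with h1 h2 h2
  · exact le_rfl
  · exact (h _ (not_lt.1 h2)).1
  · omega
  · exact (h _ (not_lt.1 h1)).2

theorem summable_tailCoeff (h0 : P.eval 0 = 1) {r : ℝ} (hr0 : 0 ≤ r) (hr : r < 1) :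
    Summable fun n => tailCoeff P m n * r ^ n := by
  refine Summable.of_norm_bounded (summable_eulerCoeff h0 hr0 hr) fun n => ?_
  rw [norm_mul, norm_pow, Real.norm_of_nonneg hr0, Real.norm_eq_abs]
  refine mul_le_mul_of_nonneg_right ?_ (pow_nonneg hr0 n)
  unfold tailCoeff
  split_ifs <;> simp

/-- The removed initial segment is a polynomial, bounded on the disc by the sum of the moduli of its
coefficients; this is negligible beside e^{C/x}. -/
theorem exists_powFun_tailCoeff (h0 : P.eval 0 = 1) (m : ℕ) : ∃ K : ℝ, 0 ≤ K ∧
    ∀ q : ℂ, ‖q‖ < 1 → ∃ p : ℂ, ‖p‖ ≤ K ∧ powFun (tailCoeff P m) q = eulerFun P q - p := by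
  refine ⟨∑ n ∈ Finset.range m, |eulerCoeff P n|, Finset.sum_nonneg fun _ _ => abs_nonneg _,
    fun q hq => ⟨∑ n ∈ Finset.range m, (eulerCoeff P n : ℂ) * q ^ n, ?_, ?_⟩⟩
  · refine norm_sum_le_of_le _ fun n _ => ?_
    rw [norm_mul, norm_pow, Complex.norm_real, Real.norm_eq_abs]
    exact mul_le_of_le_one_right (abs_nonneg _) (pow_le_one₀ (norm_nonneg _) hq.le)
  · have hs1 : Summable fun n : ℕ => (eulerCoeff P n : ℂ) * q ^ n := by
      refine Summable.of_norm ((summable_eulerCoeff h0 (norm_nonneg q) hq).congr fun n => ?_)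
      rw [norm_mul, norm_pow, Complex.norm_real, Real.norm_eq_abs]
    have hs2 : Summable fun n : ℕ => (tailCoeff P m n : ℂ) * q ^ n := by
      refine Summable.of_norm ((summable_tailCoeff (m := m) h0 (norm_nonneg q) hq).norm.congr
        fun n => ?_)
      rw [norm_mul, norm_mul, norm_pow, norm_pow, Complex.norm_real, norm_norm]
    rw [powFun, eulerFun, ← hs2.sum_add_tsum_nat_add m, ← hs1.sum_add_tsum_nat_add m,
      add_sub_cancel_left, Finset.sum_eq_zero, zero_add]
    · refine tsum_congr fun n => ?_
      rw [tailCoeff_of_le (Nat.le_add_left m n)]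
    · intro n hn
      rw [tailCoeff, if_pos (Finset.mem_range.1 hn)]
      simp

theorem norm_exp_ray_lt_one {x : ℝ} (hx : 0 < x) (t : ℝ) :
    ‖Complex.exp (-(x * (1 + t * Complex.I)))‖ < 1 := by
  rw [norm_exp_ray, Real.exp_lt_one_iff]
  linarith

theorem rayVal_zero_left_ne_zero (hpos : ∀ x ∈ Set.Icc (0 : ℝ) 1, 0 < P.eval x) {r : ℝ}
    (hr : 0 ≤ r) : rayVal P 0 r ≠ 0 := by
  rw [rayVal_zero_left, Complex.ofReal_ne_zero]
  exact (hpos _ ⟨(Real.exp_pos _).le, Real.exp_le_one_iff.2 (by linarith)⟩).ne'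

/-- An infinite product with eventually increasing nonnegative coefficients is unbounded. -/
theorem logIntegral_pos (h0 : P.eval 0 = 1) (hpos : ∀ x ∈ Set.Icc (0 : ℝ) 1, 0 < P.eval x)
    (h : ∀ n, m ≤ n → 0 ≤ eulerCoeff P n ∧ eulerCoeff P n ≤ eulerCoeff P (n + 1))
    (hP : P ≠ 1) : 0 < logIntegral P := by
  by_contra! hC
  -- A nonzero coefficient in the monotone range exists, since otherwise H would be a polynomial and
  -- P = 1; all later coefficients are then at least as large.
  obtain ⟨n1, hn1, hc1⟩ : ∃ n, m ≤ n ∧ eulerCoeff P n ≠ 0 := by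
    by_contra! hcon
    exact hP (eq_one_of_eventually_eulerCoeff_eq_zero h0
      (eventually_atTop.2 ⟨m, fun n hn => hcon n hn⟩))
  set a := tailCoeff P m
  have hmon : Monotone a := monotone_tailCoeff h
  have hnn : ∀ n, 0 ≤ a n := fun n => by
    simp only [a, tailCoeff]
    split_ifs with h1
    · exact le_rfl
    · exact (h n (not_lt.1 h1)).1
  have han : 0 < a n1 := by
    simp only [a, tailCoeff_of_le hn1]
    exact lt_of_le_of_ne (h n1 hn1).1 hc1.symm
  obtain ⟨K, -, hK⟩ := exists_powFun_tailCoeff h0 m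
  obtain ⟨-, M, hM⟩ := exists_norm_eulerFun_eq h0 (t := 0)
    fun r hr => rayVal_zero_left_ne_zero hpos hr
  rw [← logIntegral_eq] at hM
  set B := Real.exp (-(1 / 2 * Real.log |P.eval 1|) + |M|)
  obtain ⟨N, hN⟩ := exists_nat_gt ((B + K) / (a n1 * Real.exp (-1)))
  rw [div_lt_iff₀ (by positivity)] at hN
  -- For the N indices from n1 on, nx ≤ 1, so each term is at least a(n1)e^{-1}; N was chosen to
  -- make their sum exceed the bound B + K available when C_P ≤ 0.
  set x : ℝ := ((n1 + N + 1 : ℕ) : ℝ)⁻¹ with hxdef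
  have hx : 0 < x := by positivity
  have hx1 : x ≤ 1 := inv_le_one_of_one_le₀ (by exact_mod_cast (by omega : 1 ≤ n1 + N + 1))
  obtain ⟨e, he, heq⟩ := hM x hx hx1
  obtain ⟨p, hp, hpeq⟩ := hK _ (norm_exp_ray_lt_one hx 0)
  have hup : ‖powFun a (Complex.exp (-(x * (1 + (0 : ℝ) * Complex.I))))‖ ≤ B + K := by
    rw [hpeq]
    refine (norm_sub_le _ _).trans (add_le_add ?_ hp)
    rw [heq]
    apply Real.exp_le_exp.2
    have h1 : x⁻¹ * logIntegral P ≤ 0 := mul_nonpos_of_nonneg_of_nonpos (by positivity) hC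
    have h2 : e ≤ |M| := by
      have h3 : M * x ≤ |M| * 1 := mul_le_mul (le_abs_self M) hx1 hx.le (abs_nonneg M)
      linarith [le_abs_self e]
    linarith
  have hreal : powFun a (Complex.exp (-(x * (1 + (0 : ℝ) * Complex.I)))) =
      ((∑' n : ℕ, a n * Real.exp (-x) ^ n : ℝ) : ℂ) := by
    rw [powFun]
    push_cast
    simp
  have hs := summable_tailCoeff (m := m) h0 (Real.exp_pos (-x)).le
    (Real.exp_lt_one_iff.2 (by linarith))
  have hlow : N * (a n1 * Real.exp (-1)) ≤ ∑' n : ℕ, a n * Real.exp (-x) ^ n := by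
    have h1 : ∀ n ∈ Finset.Ico n1 (n1 + N), a n1 * Real.exp (-1) ≤ a n * Real.exp (-x) ^ n := by
      intro n hn
      obtain ⟨h2, h3⟩ := Finset.mem_Ico.1 hn
      refine mul_le_mul (hmon h2) ?_ (Real.exp_pos _).le (hnn n)
      rw [← Real.exp_nat_mul]
      apply Real.exp_le_exp.2
      have h4 : (n : ℝ) * x ≤ 1 := by
        rw [hxdef, ← div_eq_mul_inv, div_le_one (by positivity)]
        exact_mod_cast (by omega : n ≤ n1 + N + 1)
      linarith
    have h2 := Finset.card_nsmul_le_sum _ _ _ h1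
    rw [Nat.card_Ico, add_tsub_cancel_left, nsmul_eq_mul] at h2
    exact h2.trans (hs.sum_le_tsum _ fun n _ => mul_nonneg (hnn n) (by positivity))
  rw [hreal, Complex.norm_real] at hup
  linarith [Real.le_norm_self (∑' n : ℕ, a n * Real.exp (-x) ^ n)]

/-- On rays without zeros the infinite product is smaller than on the real axis. -/
theorem integral_log_rayVal_lt_logIntegral (h0 : P.eval 0 = 1)
    (hpos : ∀ x ∈ Set.Icc (0 : ℝ) 1, 0 < P.eval x) (hm : 0 < m)
    (h : ∀ n, m ≤ n → 0 ≤ eulerCoeff P n ∧ eulerCoeff P n ≤ eulerCoeff P (n + 1))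
    (hC : 0 < logIntegral P) {t : ℝ} (ht : t ≠ 0) (hne : ∀ r : ℝ, 0 ≤ r → rayVal P t r ≠ 0) :
    ∫ r in Set.Ioi (0 : ℝ), Real.log ‖rayVal P t r‖ < logIntegral P := by
  by_contra! hV
  set V := ∫ r in Set.Ioi (0 : ℝ), Real.log ‖rayVal P t r‖
  set C := logIntegral P
  set L := 1 / 2 * Real.log |P.eval 1|
  set a := tailCoeff P m
  have hmon : Monotone a := monotone_tailCoeff h
  have ha0 : a 0 = 0 := tailCoeff_zero hm
  obtain ⟨K, hK0, hK⟩ := exists_powFun_tailCoeff h0 m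
  obtain ⟨-, M0, hM0⟩ := exists_norm_eulerFun_eq h0 (t := 0)
    fun r hr => rayVal_zero_left_ne_zero hpos hr
  rw [← logIntegral_eq] at hM0
  obtain ⟨-, M1, hM1⟩ := exists_norm_eulerFun_eq h0 hne
  set ζ := ‖(1 + t * Complex.I : ℂ)‖
  have hζ : 1 < ζ := by
    have h1 : ζ ^ 2 = 1 + t ^ 2 := by
      rw [← Complex.normSq_eq_norm_sq, Complex.normSq_apply]
      simp [← sq]
    have h2 : 0 < t ^ 2 := by positivity
    nlinarith [norm_nonneg (1 + t * Complex.I : ℂ)]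
  -- The inequality |1−q||A(q)| ≤ (1−|q|)A(|q|) divided by x e^{C/x − L}; the common constant L
  -- cancels, and letting x → 0 gives ζ ≤ 1, which is false for t ≠ 0.
  have key : ∀ x : ℝ, 0 < x → x < 1 → x < 1 / ζ →
      ζ * (1 - x * ζ) * (Real.exp (-(M1 * x)) - K * (Real.exp L * (x / C))) ≤
        Real.exp (M0 * x) + K * (Real.exp L * (x / C)) := by
    intro x hx hx1 hxζ
    have hxζ' : x * ζ < 1 := (lt_div_iff₀ (by linarith)).1 hxζ
    obtain ⟨e0, he0, heq0⟩ := hM0 x hx hx1.le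
    obtain ⟨e1, he1, heq1⟩ := hM1 x hx hx1.le
    change _ = Real.exp (x⁻¹ * C - L + e0) at heq0
    change _ = Real.exp (x⁻¹ * V - L + e1) at heq1
    obtain ⟨p0, hp0, hpeq0⟩ := hK _ (norm_exp_ray_lt_one hx 0)
    obtain ⟨p1, hp1, hpeq1⟩ := hK _ (norm_exp_ray_lt_one hx t)
    have hmain := norm_one_sub_mul_powFun_le hmon ha0
      (fun r hr0 hr => summable_tailCoeff h0 hr0 hr) (norm_exp_ray_lt_one hx t)
    have hreal : ((∑' n : ℕ, a n * ‖Complex.exp (-(x * (1 + t * Complex.I)))‖ ^ n : ℝ) : ℂ) =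
        powFun a (Complex.exp (-(x * (1 + (0 : ℝ) * Complex.I)))) := by
      rw [norm_exp_ray, powFun]
      push_cast
      simp
    set E := Real.exp (C / x - L) with hE
    have hEpos : 0 < E := Real.exp_pos _
    -- The bounded error K is o(E) because C > 0 makes E grow like e^{C/x}.
    have hKE : K ≤ K * (Real.exp L * (x / C)) * E := by
      have h1 : Real.exp (-(C / x)) * (Real.exp L * E) = 1 := by
        rw [hE, ← Real.exp_add, ← Real.exp_add, Real.exp_eq_one_iff]
        ring
      have h2 := Real.exp_neg_div_le hC hx
      have h3 : 1 ≤ x / C * (Real.exp L * E) := by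
        rw [← h1]; gcongr
      calc K = K * 1 := by ring
        _ ≤ K * (x / C * (Real.exp L * E)) := by gcongr
        _ = _ := by ring
    have hsum : ∑' n : ℕ, a n * ‖Complex.exp (-(x * (1 + t * Complex.I)))‖ ^ n ≤
        E * Real.exp (M0 * x) + K := by
      refine (Real.le_norm_self _).trans ?_
      rw [← Complex.norm_real, hreal, hpeq0]
      refine (norm_sub_le _ _).trans (add_le_add ?_ hp0)
      rw [heq0, hE, ← Real.exp_add]
      apply Real.exp_le_exp.2
      have h1 : x⁻¹ * C = C / x := by ring
      linarith [le_abs_self e0]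
    have hlow : E * Real.exp (-(M1 * x)) - K ≤
        ‖powFun a (Complex.exp (-(x * (1 + t * Complex.I))))‖ := by
      rw [hpeq1]
      refine le_trans (sub_le_sub ?_ hp1) (norm_sub_norm_le _ _)
      rw [heq1, hE, ← Real.exp_add]
      apply Real.exp_le_exp.2
      have h1 : C / x ≤ x⁻¹ * V := by
        rw [div_eq_inv_mul]; gcongr
      linarith [neg_abs_le e1]
    have hz : ‖(x * (1 + t * Complex.I) : ℂ)‖ = x * ζ := by
      rw [norm_mul, Complex.norm_real, Real.norm_of_nonneg hx.le]
    have hq : x * ζ * (1 - x * ζ) ≤ ‖1 - Complex.exp (-(x * (1 + t * Complex.I)))‖ := by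
      have hz0 : (x * (1 + t * Complex.I) : ℂ) ≠ 0 :=
        mul_ne_zero (by exact_mod_cast hx.ne') (one_add_ofReal_mul_I_ne_zero t)
      have h1 := norm_one_sub_exp_neg_div_sub_one_le hz0 (hz.le.trans hxζ'.le)
      have h2 := norm_sub_norm_le (1 : ℂ) (1 - (1 - Complex.exp (-(x * (1 + t * Complex.I)))) /
        (x * (1 + t * Complex.I)))
      rw [sub_sub_cancel, norm_sub_rev, norm_one, norm_div, hz] at h2
      rw [norm_sub_rev, hz, norm_sub_rev] at h1
      have h3 : 1 - x * ζ ≤ ‖1 - Complex.exp (-(x * (1 + t * Complex.I)))‖ / (x * ζ) := by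
        linarith
      rwa [le_div_iff₀ (by positivity), mul_comm] at h3
    have hx2 : 1 - ‖Complex.exp (-(x * (1 + t * Complex.I)))‖ ≤ x := by
      rw [norm_exp_ray]; linarith [Real.add_one_le_exp (-x)]
    have hx3 : 0 ≤ E * Real.exp (M0 * x) + K := by positivity
    have h4 : x * ζ * (1 - x * ζ) * (E * Real.exp (-(M1 * x)) - K) ≤
        x * (E * Real.exp (M0 * x) + K) := by
      have h5 : 0 ≤ x * ζ * (1 - x * ζ) := mul_nonneg (by positivity) (by linarith)
      calc _ ≤ x * ζ * (1 - x * ζ) * ‖powFun a (Complex.exp (-(x * (1 + t * Complex.I))))‖ :=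
            mul_le_mul_of_nonneg_left hlow h5
        _ ≤ _ := mul_le_mul_of_nonneg_right hq (norm_nonneg _)
        _ ≤ _ := hmain
        _ ≤ (1 - ‖Complex.exp (-(x * (1 + t * Complex.I)))‖) * (E * Real.exp (M0 * x) + K) :=
            mul_le_mul_of_nonneg_left hsum (by linarith [norm_exp_ray_lt_one hx t])
        _ ≤ _ := mul_le_mul_of_nonneg_right hx2 hx3
    have h5 : 0 ≤ ζ * (1 - x * ζ) := mul_nonneg (by linarith) (by linarith)
    have h6 : ζ * (1 - x * ζ) * (E * Real.exp (-(M1 * x)) - K * (Real.exp L * (x / C)) * E) ≤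
        ζ * (1 - x * ζ) * (E * Real.exp (-(M1 * x)) - K) :=
      mul_le_mul_of_nonneg_left (by linarith) h5
    have h7 : ζ * (1 - x * ζ) * (E * Real.exp (-(M1 * x)) - K) ≤ E * Real.exp (M0 * x) + K := by
      refine le_of_mul_le_mul_left (le_trans (le_of_eq ?_) h4) hx
      ring
    refine le_of_mul_le_mul_left ?_ hEpos
    linarith
  have hlim1 : Tendsto (fun x : ℝ => ζ * (1 - x * ζ) * (Real.exp (-(M1 * x)) -
      K * (Real.exp L * (x / C)))) (𝓝[>] 0) (𝓝 ζ) := by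
    have h1 : Continuous fun x : ℝ => ζ * (1 - x * ζ) * (Real.exp (-(M1 * x)) -
      K * (Real.exp L * (x / C))) := by fun_prop
    have h2 := h1.tendsto 0
    simp only [zero_mul, sub_zero, mul_one, mul_zero, neg_zero, Real.exp_zero, zero_div] at h2
    exact h2.mono_left nhdsWithin_le_nhds
  have hlim2 : Tendsto (fun x : ℝ => Real.exp (M0 * x) + K * (Real.exp L * (x / C)))
      (𝓝[>] 0) (𝓝 1) := by
    have h1 : Continuous fun x : ℝ => Real.exp (M0 * x) + K * (Real.exp L * (x / C)) := by
      fun_prop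
    have h2 := h1.tendsto 0
    simp only [mul_zero, Real.exp_zero, zero_div, add_zero] at h2
    exact h2.mono_left nhdsWithin_le_nhds
  refine absurd (le_of_tendsto_of_tendsto hlim1 hlim2 ?_) (not_le.2 hζ)
  have hζ0 : 0 < 1 / ζ := by positivity
  filter_upwards [self_mem_nhdsWithin,
    nhdsWithin_le_nhds (Iio_mem_nhds (one_pos : (0 : ℝ) < 1)),
    nhdsWithin_le_nhds (Iio_mem_nhds hζ0)] with x h1 h2 h3
  exact key x h1 h2 h3

/-- All inputs of the Tauberian theorem meet here, with λ = P(1)^{-1/2}: the expansion near t = 0,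
and the uniform gap on the compact set of t between the near zone and Δ. -/
theorem tendsto_tailCoeff (h0 : P.eval 0 = 1)
    (hpos : ∀ x ∈ Set.Icc (0 : ℝ) 1, 0 < P.eval x) (hm : 0 < m)
    (h : ∀ n, m ≤ n → 0 ≤ eulerCoeff P n ∧ eulerCoeff P n ≤ eulerCoeff P (n + 1))
    (hC : 0 < logIntegral P) :
    Tendsto (fun x => 2 * √(Real.pi * logIntegral P) / (√(P.eval 1))⁻¹ / (x * √x) *
      Real.exp (-(2 * logIntegral P / x)) * tailCoeff P m ⌊logIntegral P / x ^ 2⌋₊)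
      (𝓝[>] 0) (𝓝 1) := by
  have hP1 : 0 < P.eval 1 := hpos 1 (by simp)
  obtain ⟨K, hK0, hK⟩ := exists_powFun_tailCoeff h0 m
  obtain ⟨δ, hδ, M, hnear⟩ := exists_eulerFun_eq_near h0 hpos
  have hlam : Real.exp (-(1 / 2 * Real.log (P.eval 1))) = (√(P.eval 1))⁻¹ := by
    rw [Real.exp_neg, Real.sqrt_eq_rpow, Real.rpow_def_of_pos hP1, mul_comm]
  have hreg := rayRegular_rayVal h0
  have hδ' : 0 < min δ 1 := lt_min hδ one_pos
  refine tendsto_of_powFun_asymptotics (δ := min δ 1) (M := M) (K := K) (monotone_tailCoeff h)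
    (tailCoeff_zero hm) (fun r hr0 hr => summable_tailCoeff h0 hr0 hr) hC (by positivity)
    hδ' (min_le_right _ _) ?_ ?_
  · intro t x ht hx hx1
    obtain ⟨e, he, heq⟩ := hnear t x (ht.trans (min_le_left _ _)) hx hx1
    obtain ⟨p, hp, hpeq⟩ := hK _ (norm_exp_ray_lt_one hx t)
    refine ⟨e, p, he, hp, ?_⟩
    rw [hpeq, heq, ← hlam, Complex.ofReal_exp, ← Complex.exp_add]
    congr 2
    push_cast
    ring
  · intro Δ
    have hcomp : IsCompact {t : ℝ | min δ 1 ≤ |t| ∧ |t| ≤ Δ} := by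
      refine (isCompact_Icc (a := -Δ) (b := Δ)).of_isClosed_subset
        ((isClosed_le continuous_const continuous_abs).inter
          (isClosed_le continuous_abs continuous_const)) fun t ht => abs_le.1 ht.2
    obtain ⟨η, hη, hev⟩ := exists_forall_norm_eulerFun_le h0 hcomp
      (fun t _ => hreg.integrable t) (fun t _ => hreg.ae_ne t)
      (fun t ht => integral_log_rayVal_lt h0 hP1.ne'
        (fun t ht hne => integral_log_rayVal_lt_logIntegral h0 hpos hm h hC ht hne)
        (abs_pos.1 (hδ'.trans_le ht.1)))
    refine ⟨η, hη, ?_⟩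
    filter_upwards [hev, self_mem_nhdsWithin] with x hx hx0 t ht1 ht2
    obtain ⟨p, hp, hpeq⟩ := hK _ (norm_exp_ray_lt_one hx0 t)
    rw [hpeq]
    exact (norm_sub_le _ _).trans (add_le_add (hx t ⟨ht1, ht2⟩) hp)

end EventuallyIncreasing

/-! ### The trivial case P = 1 and the normalisation in terms of n -/

section Constant

theorem logIntegral_one : logIntegral 1 = 0 := by simp [logIntegral]

theorem eulerCoeff_one {n : ℕ} (hn : n ≠ 0) : eulerCoeff 1 n = 0 := by
  simp [eulerCoeff, eulerProduct, PowerSeries.coeff_one, hn]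

end Constant

/-- The normalising factor of the Tauberian theorem in terms of `n`. -/
theorem normalising_factor_eq {C p : ℝ} (hC : 0 < C) (hp : 0 < p) {n : ℕ} (hn : 0 < n) :
    (C ^ (1 / 4 : ℝ) / (2 * √(Real.pi * p) * (n : ℝ) ^ (3 / 4 : ℝ)) *
      Real.exp (2 * √(C * n)))⁻¹ =
    2 * √(Real.pi * C) / (√p)⁻¹ / (√(C / n) * √(√(C / n))) * Real.exp (-(2 * C / √(C / n))) := by
  have hn' : (0 : ℝ) < n := by exact_mod_cast hn
  have hpi := Real.pi_pos
  have h1 : C / √(C / n) = √(C * n) := by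
    rw [div_eq_iff (by positivity), ← Real.sqrt_mul (by positivity)]
    have : C * n * (C / n) = C ^ 2 := by field_simp
    rw [this, Real.sqrt_sq hC.le]
  have h2 : √(C / n) * √(√(C / n)) = C ^ (3 / 4 : ℝ) / (n : ℝ) ^ (3 / 4 : ℝ) := by
    rw [← Real.div_rpow hC.le hn'.le, Real.sqrt_eq_rpow, Real.sqrt_eq_rpow, ← Real.rpow_mul
      (by positivity), ← Real.rpow_add (by positivity)]
    norm_num
  have h3 : √C * C ^ (1 / 4 : ℝ) = C ^ (3 / 4 : ℝ) := by
    rw [Real.sqrt_eq_rpow, ← Real.rpow_add hC]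
    norm_num
  rw [h2, mul_div_assoc 2 C, h1, Real.exp_neg, Real.sqrt_mul hpi.le, Real.sqrt_mul hpi.le, ← h3]
  field_simp
end

/-! ### The theorem -/

theorem mainTheorem4 (P : Polynomial ℝ)
    (hP0 : P.eval 0 = 1)
    (hP1 : 0 < P.eval 1)
    (hzero : ∀ x ∈ Set.Icc (0 : ℝ) 1, P.eval x ≠ 0)
    (hnonneg : ∀ᶠ n : ℕ in atTop, 0 ≤ eulerCoeff P n)
    (hmono : ∀ᶠ n : ℕ in atTop, eulerCoeff P n ≤ eulerCoeff P (n + 1)) :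
    IntegrableOn (fun x : ℝ => Real.log (P.eval (Real.exp (-x)))) (Set.Ioi 0) ∧
    (P ≠ 1 → 0 < logIntegral P) ∧
    (fun n : ℕ => eulerCoeff P n) ~[atTop]
      (fun n : ℕ =>
        logIntegral P ^ (1 / 4 : ℝ) /
            (2 * Real.sqrt (Real.pi * P.eval 1) * (n : ℝ) ^ (3 / 4 : ℝ)) *
          Real.exp (2 * Real.sqrt (logIntegral P * n))) := by
  have hpos : ∀ x ∈ Set.Icc (0 : ℝ) 1, 0 < P.eval x := by
    intro x hx
    by_contra! hneg
    obtain ⟨y, hy, hy0⟩ := intermediate_value_Icc' hx.1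
      (f := fun y => P.eval y) P.continuous.continuousOn ⟨hneg, by simp [hP0]⟩
    exact hzero y ⟨hy.1, hy.2.trans hx.2⟩ hy0
  obtain ⟨m, hm⟩ := eventually_atTop.1 (hnonneg.and hmono)
  -- The cutoff is raised to m + 1 > 0 so that the coefficient of index 0 is removed, as the
  -- transforms require a 0 = 0.
  have h : ∀ n, m + 1 ≤ n → 0 ≤ eulerCoeff P n ∧ eulerCoeff P n ≤ eulerCoeff P (n + 1) :=
    fun n hn => hm n (by omega)
  refine ⟨integrableOn_log_eval hP0, logIntegral_pos hP0 hpos h, ?_⟩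
  by_cases hP : P = 1
  · subst hP
    have h1 : (fun n : ℕ => eulerCoeff 1 n) =ᶠ[atTop] fun _ => 0 := by
      filter_upwards [eventually_ne_atTop 0] with n hn
      exact eulerCoeff_one hn
    refine h1.trans_isEquivalent ?_
    simp only [logIntegral_one]
    -- For P = 1 the constant is 0 and 0^{1/4} = 0, so the right side is identically zero.
    rw [Real.zero_rpow (by norm_num)]
    simp only [zero_div, zero_mul]
    exact IsEquivalent.refl
  set C := logIntegral P
  have hC : 0 < C := logIntegral_pos hP0 hpos h hP
  have hx : Tendsto (fun n : ℕ => √(C / n)) atTop (𝓝[>] 0) := by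
    refine tendsto_nhdsWithin_iff.2 ⟨?_, ?_⟩
    · have h1 := (tendsto_const_div_atTop_nhds_zero_nat C).sqrt
      rwa [Real.sqrt_zero] at h1
    · filter_upwards [eventually_gt_atTop 0] with n hn
      have hn' : (0 : ℝ) < n := by exact_mod_cast hn
      exact Real.sqrt_pos.2 (by positivity)
  have hlim := (tendsto_tailCoeff hP0 hpos m.succ_pos h hC).comp hx
  refine isEquivalent_of_tendsto_one (hlim.congr' ?_)
  filter_upwards [eventually_ge_atTop (m + 1)] with n hn
  have hn0 : 0 < n := by omega
  have hn' : (0 : ℝ) < n := by exact_mod_cast hn0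
  -- With x = √(C/n) the centre C/x² is exactly the integer n, so the floor loses nothing.
  have hfloor : C / √(C / n) ^ 2 = n := by
    rw [Real.sq_sqrt (by positivity)]
    field_simp
  simp only [Function.comp_apply, Pi.div_apply]
  change _ * tailCoeff P (m + 1) ⌊C / √(C / n) ^ 2⌋₊ = _
  rw [hfloor, Nat.floor_natCast, tailCoeff_of_le hn, div_eq_mul_inv (eulerCoeff P n),
    normalising_factor_eq hC hP1 hn0, mul_comm (eulerCoeff P n)]
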